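/- Let $\delta,\Delta\in\mathbb{R}$, and let $(M,g)$ be a smooth Riemannian manifold (not necessarily compact) whose sectional curvatures all lie in $[\delta,\Delta]$. Let $\operatorname{Riem}(X,Y,Z,W)=g(R(X,Y)Z,W)$ with $R(X,Y)=[\nabla_X,\nabla_Y]-\nabla_{[X,Y]}$, where $\nabla$ is the Levi-Civita connection; thus $\operatorname{Riem}(X,Y,Y,X)/|X\wedge Y|^2$ is the sectional curvature. In a local orthonormal frame let $\hat R$ be the operator on $2$-forms $$(\hat R\beta)_{ij}=\sum_{k,l}\operatorname{Riem}_{ijkl}\,\beta_{kl}.$$ (a) Suppose $\dim M=7$ and $g$ is induced by a nearly $G_2$ structure: a $G_2$-structure $\varphi\in\Omega^3(M)$ with Hodge dual $\psi=\star\varphi$ such that $d\varphi=\tau_0\psi$ for some constant $\tau_0\neq0$, and $d\psi=0$. Let $\Omega^2_{14}=\{\beta\in\Omega^2:\sum_{i,j}\beta_{ij}\varphi_{ijk}=0 \text{ for all } k\}$. Then, at each point of $M$, $\hat R$ maps the fibre of $\Omega^2_{14}$ into itself, and all eigenvalues of $\hat R$ on this fibre lie in $$\Big[-(\Delta+\delta)-\tfrac73(\Delta-\delta),\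 -(\Delta+\delta)+\tfrac73(\Delta-\delta)\Big].$$ (b) Suppose $\dim M=6$ and $(M,g)$ is nearly Kähler: it carries an $SU(3)$-structure compatible with $g$, with fundamental $2$-form $\omega$ and complex volume form $\psi^++i\psi^-$ (so that at each point, in some orthonormal basis with dual basis $e^1,\dots,e^6$, $\omega=e^{12}+e^{34}+e^{56}$ and $\psi^++i\psi^-=(e^1+ie^2)\wedge(e^3+ie^4)\wedge(e^5+ie^6)$), such that $\nabla_X\omega=-X\lrcorner\psi^+$ and $\nabla_X\psi^+=X^\flat\wedge\omega$ for all vector fields $X$. Let $\Omega^2_8=\{\beta\in\Omega^2:\sum_{i,j}\beta_{ij}\psi^+_{ijk}=0 \text{ for all } k,\ \sum_{i,j}\beta_{ij}\omega_{ij}=0\}$ (the primitive $2$-forms of type $(1,1)$). Then, at each point of $M$, $\hat R$ maps the fibre of $\Omega^2_8$ into itself, and all eigenvalues of $\hat R$ on this fibre lie in the same interval. -/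

import Mathlib

open scoped Manifold ContDiff Bundle

noncomputable section

namespace NearlyGeom

/-- The model space `ℝⁿ`. -/
abbrev E (n : ℕ) := EuclideanSpace ℝ (Fin n)

/-- The coordinate vector `∂ᵢ` of `ℝⁿ`. -/
def ebasis {n : ℕ} (i : Fin n) : E n := EuclideanSpace.single i 1

/-- The partial derivative `∂ᵢ f` at the point `y` of `ℝⁿ`. -/
def pderiv {n : ℕ} (i : Fin n) (f : E n → ℝ) (y : E n) : ℝ := fderiv ℝ f y (ebasis i)

section Charts

variable {n : ℕ} {M : Type*} [TopologicalSpace M] [ChartedSpace (E n) M]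

/-- The coordinate representation, in the chart `e`, of a field `α` of alternating `k`-forms on
`M`: its pullback under the inverse of the chart. It is meaningful on `e.target`. -/
def chartForm {k : ℕ} (e : OpenPartialHomeomorph M (E n))
    (α : ∀ x : M, TangentSpace (𝓡 n) x [⋀^Fin k]→L[ℝ] ℝ) (y : E n) : E n [⋀^Fin k]→L[ℝ] ℝ :=
  (α (e.symm y)).compContinuousLinearMap (mfderiv (𝓡 n) (𝓡 n) e.symm y)

/-- A field of `k`-forms is smooth (is a differential form) if it is smooth in every chart of the
atlas. -/
def IsSmoothForm {k : ℕ} (α : ∀ x : M, TangentSpace (𝓡 n) x [⋀^Fin k]→L[ℝ] ℝ) : Prop :=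
  ∀ e ∈ atlas (E n) M, ContDiffOn ℝ ∞ (chartForm e α) e.target

/-- `dα = η`, where `d` is computed in every chart of the atlas with Mathlib's exterior
derivative `extDeriv`. -/
def HasExtDeriv {k : ℕ} (α : ∀ x : M, TangentSpace (𝓡 n) x [⋀^Fin k]→L[ℝ] ℝ)
    (η : ∀ x : M, TangentSpace (𝓡 n) x [⋀^Fin (k + 1)]→L[ℝ] ℝ) : Prop :=
  ∀ e ∈ atlas (E n) M, ∀ y ∈ e.target, extDeriv (chartForm e α) y = chartForm e η y

/-- The component `α_{j₁ … j_k}` of `α` in the coordinates of the chart `e`. -/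
def formComp {k : ℕ} (e : OpenPartialHomeomorph M (E n))
    (α : ∀ x : M, TangentSpace (𝓡 n) x [⋀^Fin k]→L[ℝ] ℝ) (j : Fin k → Fin n) (y : E n) : ℝ :=
  chartForm e α y (fun s => ebasis (j s))

variable [Bundle.RiemannianBundle (fun x : M => TangentSpace (𝓡 n) x)]

/-- The matrix `g_{ij}` of the Riemannian metric in the coordinates of the chart `e`. -/
def metricComp (e : OpenPartialHomeomorph M (E n)) (y : E n) : Matrix (Fin n) (Fin n) ℝ :=
  Matrix.of fun i j =>
    inner ℝ (mfderiv (𝓡 n) (𝓡 n) e.symm y (ebasis i) : TangentSpace (𝓡 n) (e.symm y))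
      (mfderiv (𝓡 n) (𝓡 n) e.symm y (ebasis j) : TangentSpace (𝓡 n) (e.symm y))

/-- The Christoffel symbol `Γᵏᵢⱼ` of the Levi-Civita connection, `∇_{∂ᵢ} ∂ⱼ = Γᵏᵢⱼ ∂ₖ`, in the
chart `e`:
`Γᵏᵢⱼ = ½ gᵏˡ (∂ᵢ gⱼₗ + ∂ⱼ gᵢₗ - ∂ₗ gᵢⱼ)`. -/
def christoffel (e : OpenPartialHomeomorph M (E n)) (k i j : Fin n) (y : E n) : ℝ :=
  (1 / 2) * ∑ l, (metricComp e y)⁻¹ k l *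
    (pderiv i (fun z => metricComp e z j l) y + pderiv j (fun z => metricComp e z i l) y
      - pderiv l (fun z => metricComp e z i j) y)

/-- The component `(∇ᵢ α)_{j₁ … j_k} = ∂ᵢ α_{j₁ … j_k} - ∑ₛ Γᵐ_{i jₛ} α_{j₁ … m … j_k}` of the
covariant derivative (for the Levi-Civita connection) of a `k`-form, in the chart `e`. -/
def covDerivComp {k : ℕ} (e : OpenPartialHomeomorph M (E n))
    (α : ∀ x : M, TangentSpace (𝓡 n) x [⋀^Fin k]→L[ℝ] ℝ) (i : Fin n) (j : Fin k → Fin n)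
    (y : E n) : ℝ :=
  pderiv i (formComp e α j) y
    - ∑ s, ∑ m, christoffel e m i (j s) y * formComp e α (Function.update j s m) y

/-- The component `Rᵢⱼₖˡ` of the Riemann tensor in the chart `e`, where
`R(∂ᵢ, ∂ⱼ) ∂ₖ = (∇_{∂ᵢ} ∇_{∂ⱼ} - ∇_{∂ⱼ} ∇_{∂ᵢ}) ∂ₖ = Rᵢⱼₖˡ ∂ₗ`. -/
def riemannUp (e : OpenPartialHomeomorph M (E n)) (i j k l : Fin n) (y : E n) : ℝ :=
  pderiv i (christoffel e l j k) y - pderiv j (christoffel e l i k) y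
    + ∑ m, (christoffel e l i m y * christoffel e m j k y
      - christoffel e l j m y * christoffel e m i k y)

/-- The component `Rᵢⱼₖₗ = g(R(∂ᵢ, ∂ⱼ) ∂ₖ, ∂ₗ)` of the Riemann curvature tensor in the chart `e`. -/
def riemannComp (e : OpenPartialHomeomorph M (E n)) (i j k l : Fin n) (y : E n) : ℝ :=
  ∑ m, metricComp e y l m * riemannUp e i j k m y

/-- The `i`-th coordinate of tangent vectors at `x`, with respect to the coordinate vectors at `x`
of the preferred chart at `x`. -/
def coord (x : M) (i : Fin n) : TangentSpace (𝓡 n) x →L[ℝ] ℝ :=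
  (EuclideanSpace.proj i : E n →L[ℝ] ℝ).comp (mfderiv (𝓡 n) (𝓡 n) (chartAt (E n) x) x)

/-- The Riemann curvature tensor `R(u, v, w, z) = g(R(u, v) w, z)` at the point `x`. -/
def riemann (x : M) (u v w z : TangentSpace (𝓡 n) x) : ℝ :=
  ∑ i, ∑ j, ∑ k, ∑ l, riemannComp (chartAt (E n) x) i j k l (chartAt (E n) x x)
    * (coord x i u * coord x j v * coord x k w * coord x l z)

/-- The sectional curvature `R(u, v, v, u) / |u ∧ v|²` of the plane spanned by the linearly
independent tangent vectors `u`, `v`. -/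
def sectionalCurvature (x : M) (u v : TangentSpace (𝓡 n) x) : ℝ :=
  riemann x u v v u / (inner ℝ u u * inner ℝ v v - inner ℝ u v ^ 2)

variable (n M) in
/-- All sectional curvatures of `M` lie in `[δ, Δ]`. -/
def SectionalCurvatureBounds (δ Δ : ℝ) : Prop :=
  ∀ (x : M) (u v : TangentSpace (𝓡 n) x), LinearIndependent ℝ ![u, v] →
    sectionalCurvature x u v ∈ Set.Icc δ Δ

lemma riemannComp_antisymm (e : OpenPartialHomeomorph M (E n)) (i j k l : Fin n) (y : E n) :
    riemannComp e i j k l y = - riemannComp e j i k l y := by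
  simp only [riemannComp, riemannUp, Finset.sum_sub_distrib, ← Finset.sum_neg_distrib]
  refine Finset.sum_congr rfl fun m _ => ?_
  ring

lemma riemann_antisymm (x : M) (u v w z : TangentSpace (𝓡 n) x) :
    riemann x u v w z = - riemann x v u w z := by
  simp only [riemann, ← Finset.sum_neg_distrib]
  rw [Finset.sum_comm]
  refine Finset.sum_congr rfl fun i _ => Finset.sum_congr rfl fun j _ =>
    Finset.sum_congr rfl fun k _ => Finset.sum_congr rfl fun l _ => ?_
  rw [riemannComp_antisymm]
  ring

lemma riemann_add_left (x : M) (u u' v w z : TangentSpace (𝓡 n) x) :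
    riemann x (u + u') v w z = riemann x u v w z + riemann x u' v w z := by
  simp only [riemann, map_add, ← Finset.sum_add_distrib]
  refine Finset.sum_congr rfl fun i _ => Finset.sum_congr rfl fun j _ =>
    Finset.sum_congr rfl fun k _ => Finset.sum_congr rfl fun l _ => ?_
  ring

lemma riemann_smul_left (x : M) (c : ℝ) (u v w z : TangentSpace (𝓡 n) x) :
    riemann x (c • u) v w z = c * riemann x u v w z := by
  simp only [riemann, map_smul, smul_eq_mul, Finset.mul_sum]
  refine Finset.sum_congr rfl fun i _ => Finset.sum_congr rfl fun j _ =>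
    Finset.sum_congr rfl fun k _ => Finset.sum_congr rfl fun l _ => ?_
  ring

/-- The space `Λ²` of `2`-forms at the point `x`. -/
abbrev TwoForm (x : M) := TangentSpace (𝓡 n) x [⋀^Fin 2]→L[ℝ] ℝ

/-- The `2`-form `(u, v) ↦ R(u, v, w, z)` at the point `x`. -/
def curvatureForm (x : M) (w z : TangentSpace (𝓡 n) x) : TwoForm (n := n) x where
  toFun v := riemann x (v 0) (v 1) w z
  map_update_add' := by
    intro _ v i a b
    fin_cases i
    · simp [Function.update, riemann_add_left]
    · simp only [Function.update]
      simp [riemann_antisymm x (v 0), riemann_add_left]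
      ring
  map_update_smul' := by
    intro _ v i c a
    fin_cases i
    · simp [Function.update, riemann_smul_left]
    · simp only [Function.update]
      simp [riemann_antisymm x (v 0), riemann_smul_left]
  map_eq_zero_of_eq' := by
    intro v i j h hij
    have h01 : v 0 = v 1 := by
      fin_cases i <;> fin_cases j <;> simp_all
    have := riemann_antisymm x (v 0) (v 1) w z
    rw [h01] at this ⊢
    linarith
  cont := by
    simp only [riemann]
    fun_prop

instance (x : M) : FiniteDimensional ℝ (TangentSpace (𝓡 n) x) :=
  inferInstanceAs (FiniteDimensional ℝ (E n))

lemma finrank_tangentSpace (x : M) : Module.finrank ℝ (TangentSpace (𝓡 n) x) = n :=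
  (finrank_euclideanSpace_fin : Module.finrank ℝ (E n) = n)

/-- An orthonormal frame of the tangent space at `x`, used to compute traces (which do not depend
on its choice). -/
def frame (x : M) : OrthonormalBasis (Fin n) ℝ (TangentSpace (𝓡 n) x) :=
  (stdOrthonormalBasis ℝ (TangentSpace (𝓡 n) x)).reindex (finCongr (finrank_tangentSpace x))

/-- The curvature operator on `2`-forms, `(R̂ β)ᵢⱼ = ∑ₖₗ Rᵢⱼₖₗ βₖₗ` in an orthonormal frame. -/
def hatR (x : M) : TwoForm (n := n) x →ₗ[ℝ] TwoForm (n := n) x where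
  toFun β := ∑ k, ∑ l, β ![frame x k, frame x l] • curvatureForm x (frame x k) (frame x l)
  map_add' β γ := by
    simp only [ContinuousAlternatingMap.add_apply, add_smul, Finset.sum_add_distrib]
  map_smul' c β := by
    simp only [ContinuousAlternatingMap.smul_apply, smul_eq_mul, mul_smul, Finset.smul_sum,
      RingHom.id_apply]

/-- The `2`-forms `β` at `x` with `∑ᵢⱼ βᵢⱼ αᵢⱼₖ = 0` for all `k`, in an orthonormal frame. -/
def annihilator₃ (x : M) (α : TangentSpace (𝓡 n) x [⋀^Fin 3]→L[ℝ] ℝ) :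
    Submodule ℝ (TwoForm (n := n) x) where
  carrier := {β | ∀ k, ∑ i, ∑ j, β ![frame x i, frame x j] * α ![frame x i, frame x j, frame x k]
    = 0}
  zero_mem' := by simp
  add_mem' := by
    intro β γ hβ hγ k
    simp only [ContinuousAlternatingMap.add_apply, add_mul, Finset.sum_add_distrib, hβ k, hγ k,
      add_zero]
  smul_mem' := by
    intro c β hβ k
    simp only [ContinuousAlternatingMap.smul_apply, smul_eq_mul, mul_assoc, ← Finset.mul_sum,
      hβ k, mul_zero]

/-- The `2`-forms `β` at `x` with `∑ᵢⱼ βᵢⱼ αᵢⱼ = 0`, in an orthonormal frame. -/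
def annihilator₂ (x : M) (α : TwoForm (n := n) x) : Submodule ℝ (TwoForm (n := n) x) where
  carrier := {β | ∑ i, ∑ j, β ![frame x i, frame x j] * α ![frame x i, frame x j] = 0}
  zero_mem' := by simp
  add_mem' := by
    intro β γ hβ hγ
    simp only [Set.mem_ofPred_eq] at hβ hγ
    simp only [Set.mem_ofPred_eq, ContinuousAlternatingMap.add_apply, add_mul,
      Finset.sum_add_distrib, hβ, hγ, add_zero]
  smul_mem' := by
    intro c β hβ
    simp only [Set.mem_ofPred_eq] at hβ
    simp only [Set.mem_ofPred_eq, ContinuousAlternatingMap.smul_apply, smul_eq_mul, mul_assoc,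
      ← Finset.mul_sum, hβ, mul_zero]

end Charts

/-- The value on `v` of the decomposable form `e^{I₁} ∧ … ∧ e^{I_k}` built from the coframe dual to
an orthonormal basis `b` (wedge products carry no numerical factor, so `e¹ ∧ e² = e¹ ⊗ e² - e² ⊗ e¹`);
here the basis is numbered `0, …, n - 1`. -/
def wedge {V : Type*} [NormedAddCommGroup V] [InnerProductSpace ℝ V] {n k : ℕ}
    (b : OrthonormalBasis (Fin n) ℝ V) (I : Fin k → Fin n) (v : Fin k → V) : ℝ :=
  Matrix.det (Matrix.of fun s t => (inner ℝ (b (I s)) (v t) : ℝ))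

section G2

variable {M : Type*} [TopologicalSpace M] [ChartedSpace (E 7) M]
  [Bundle.RiemannianBundle (fun x : M => TangentSpace (𝓡 7) x)]

/-- `φ` is a `G₂`-structure on `M` whose associated metric is the given Riemannian metric, and
`ψ = ⋆φ`: at each point there is an orthonormal basis `e₁, …, e₇` in which
`φ = e¹²³ - e¹⁶⁷ - e⁵²⁷ - e⁵⁶³ - e⁴¹⁵ - e⁴²⁶ - e⁴³⁷`, and then
`ψ = e⁴⁵⁶⁷ - e⁴⁵²³ - e⁴¹⁶³ - e⁴¹²⁷ - e²⁶³⁷ - e¹⁵³⁷ - e¹⁵²⁶` is its Hodge dual for the orientation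
`e¹²³⁴⁵⁶⁷`. (Indices are shifted by one in the code.) -/
structure IsG2Structure (φ : ∀ x : M, TangentSpace (𝓡 7) x [⋀^Fin 3]→L[ℝ] ℝ)
    (ψ : ∀ x : M, TangentSpace (𝓡 7) x [⋀^Fin 4]→L[ℝ] ℝ) : Prop where
  smooth_φ : IsSmoothForm φ
  smooth_ψ : IsSmoothForm ψ
  adapted : ∀ x : M, ∃ b : OrthonormalBasis (Fin 7) ℝ (TangentSpace (𝓡 7) x),
    (∀ v, φ x v = wedge b ![0, 1, 2] v - wedge b ![0, 5, 6] v - wedge b ![4, 1, 6] v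
      - wedge b ![4, 5, 2] v - wedge b ![3, 0, 4] v - wedge b ![3, 1, 5] v
      - wedge b ![3, 2, 6] v) ∧
    (∀ v, ψ x v = wedge b ![3, 4, 5, 6] v - wedge b ![3, 4, 1, 2] v - wedge b ![3, 0, 5, 2] v
      - wedge b ![3, 0, 1, 6] v - wedge b ![1, 5, 2, 6] v - wedge b ![0, 4, 2, 6] v
      - wedge b ![0, 4, 1, 5] v)

/-- The `G₂`-structure is nearly `G₂`: `dφ = τ₀ ψ` for some constant `τ₀ ≠ 0`, and `dψ = 0`. -/
structure IsNearlyG2 (φ : ∀ x : M, TangentSpace (𝓡 7) x [⋀^Fin 3]→L[ℝ] ℝ)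
    (ψ : ∀ x : M, TangentSpace (𝓡 7) x [⋀^Fin 4]→L[ℝ] ℝ) : Prop
    extends IsG2Structure φ ψ where
  dφ : ∃ τ₀ : ℝ, τ₀ ≠ 0 ∧ HasExtDeriv φ (fun x => τ₀ • ψ x)
  dψ : HasExtDeriv ψ (fun _ => 0)

/-- The fibre at `x` of `Ω²₁₄ = {β | βᵢⱼ φᵢⱼₖ = 0}`, equivalently of `{β | ⋆(φ ∧ β) = β}`. -/
def Lambda14 (φ : ∀ x : M, TangentSpace (𝓡 7) x [⋀^Fin 3]→L[ℝ] ℝ) (x : M) :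
    Submodule ℝ (TwoForm (n := 7) x) :=
  annihilator₃ x (φ x)

end G2

section SU3

variable {M : Type*} [TopologicalSpace M] [ChartedSpace (E 6) M]
  [Bundle.RiemannianBundle (fun x : M => TangentSpace (𝓡 6) x)]

/-- `(ω, ψ⁺ + i ψ⁻)`, written `om`, `ψp`, `ψm` in the code, is an `SU(3)`-structure on `M`
compatible with the given Riemannian metric: at each point there is an orthonormal basis `e₁, …, e₆` in which `ω = e¹² + e³⁴ + e⁵⁶` and
`ψ⁺ + i ψ⁻ = (e¹ + i e²) ∧ (e³ + i e⁴) ∧ (e⁵ + i e⁶)`. The almost complex structure `J` is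
determined by `ω(u, v) = g(J u, v)`. (Indices are shifted by one in the code.) -/
structure IsSU3Structure (om : ∀ x : M, TangentSpace (𝓡 6) x [⋀^Fin 2]→L[ℝ] ℝ)
    (ψp ψm : ∀ x : M, TangentSpace (𝓡 6) x [⋀^Fin 3]→L[ℝ] ℝ) : Prop where
  smooth_om : IsSmoothForm om
  smooth_ψp : IsSmoothForm ψp
  smooth_ψm : IsSmoothForm ψm
  adapted : ∀ x : M, ∃ b : OrthonormalBasis (Fin 6) ℝ (TangentSpace (𝓡 6) x),
    (∀ v, om x v = wedge b ![0, 1] v + wedge b ![2, 3] v + wedge b ![4, 5] v) ∧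
    (∀ v, ψp x v = wedge b ![0, 2, 4] v - wedge b ![0, 3, 5] v - wedge b ![1, 2, 5] v
      - wedge b ![1, 3, 4] v) ∧
    (∀ v, ψm x v = wedge b ![0, 2, 5] v + wedge b ![0, 3, 4] v + wedge b ![1, 2, 4] v
      - wedge b ![1, 3, 5] v)

/-- The `SU(3)`-structure is nearly Kähler: `∇_X ω = - X ⌟ ψ⁺` and `∇_X ψ⁺ = X ∧ ω`, where `∇` is
the Levi-Civita connection. In coordinates, `∇ᵢ ωⱼₖ = - ψ⁺ᵢⱼₖ` and
`∇ᵢ ψ⁺ⱼₖₗ = gᵢⱼ ωₖₗ + gᵢₖ ωₗⱼ + gᵢₗ ωⱼₖ`. -/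
structure IsNearlyKahler6 (om : ∀ x : M, TangentSpace (𝓡 6) x [⋀^Fin 2]→L[ℝ] ℝ)
    (ψp ψm : ∀ x : M, TangentSpace (𝓡 6) x [⋀^Fin 3]→L[ℝ] ℝ) : Prop
    extends IsSU3Structure om ψp ψm where
  nabla_om : ∀ e ∈ atlas (E 6) M, ∀ y ∈ e.target, ∀ i j k : Fin 6,
    covDerivComp e om i ![j, k] y = - formComp e ψp ![i, j, k] y
  nabla_ψp : ∀ e ∈ atlas (E 6) M, ∀ y ∈ e.target, ∀ i j k l : Fin 6,
    covDerivComp e ψp i ![j, k, l] y =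
      metricComp e y i j * formComp e om ![k, l] y + metricComp e y i k * formComp e om ![l, j] y
        + metricComp e y i l * formComp e om ![j, k] y

/-- The fibre at `x` of `Ω²₈ = {β | βᵢⱼ ψ⁺ᵢⱼₖ = 0, βᵢⱼ ωᵢⱼ = 0}`, the primitive `2`-forms of type
`(1, 1)`, equivalently of `{β | ⋆(β ∧ ω) = -β}`. -/
def Lambda8 (om : ∀ x : M, TangentSpace (𝓡 6) x [⋀^Fin 2]→L[ℝ] ℝ)
    (ψp : ∀ x : M, TangentSpace (𝓡 6) x [⋀^Fin 3]→L[ℝ] ℝ) (x : M) :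
    Submodule ℝ (TwoForm (n := 6) x) :=
  annihilator₃ x (ψp x) ⊓ annihilator₂ x (om x)

end SU3

end NearlyGeom
end

/-!
The proof reduces both parts to a statement about one algebraic curvature tensor `R` on a Euclidean
space.

*Torsion.* For a nearly `G₂`-structure with `dφ = τ ψ` and `dψ = 0` one has `∇φ = (τ / 4) ψ`.
Differentiating the contraction identity
`∑ₚ φ(a, b, eₚ) φ(c, d, eₚ) = ⟨a, c⟩⟨b, d⟩ - ⟨a, d⟩⟨b, c⟩ - ψ(a, b, c, d)` expresses `∇ψ` by `∇φ`
(`IsG2Structure.cov_psi`). Skew-symmetry of `∇ψ` then forces `∇ₘφ = ∑ₙ Tₘₙ eₙ ⌟ ψ` for some matrix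
`T` (`exists_contraction_psi`), and the equations for `dφ` and `dψ`, where `d` is the alternation of
`∇`, give `T = (τ / 4) · 1` (`torsion_eq`). For a nearly Kähler structure the analogous equations
for `∇ω` and `∇ψ⁺` are part of the definition.

*Curvature.* By the Ricci identity (`ricci_identity`) the curvature acts on the defining forms as
the curvature tensor of constant curvature `κ` does, where `κ = τ² / 16` or `κ = 1`. Hence `R - κ`
takes values in their stabilizer `𝔤₂` or `𝔰𝔲(3)` (`IsNearlyG2.exists_action_eq_zero`,
`IsNearlyKahler6.action_om_eq_zero`, `IsNearlyKahler6.action_ψp_eq_zero`), which is orthogonal to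
the forms that cut out `Ω²₁₄` or `Ω²₈`. As `R - κ` has the pair symmetry, and the tensor of constant
curvature acts on `2`-forms as a multiple of the identity, `R̂` preserves these fibres
(`IsCurvatureTensor.sum_curvature_mul_eq_zero`). The stabilizers contain no curvature tensor which
is not Ricci flat, so that `κ` is a mean of sectional curvatures and lies in `[δ, Δ]`
(`mem_Icc_of_ricci`).

*The estimate.* Let `β` be an eigenform with eigenvalue `r`. In dimension `7` it kills a unit vector
`n`, and it commutes with the complex structure `n ⌟ φ` of the orthogonal complement of `n`; in
dimension `6` it commutes with the complex structure given by `ω`. So there are an orthonormal basis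
`eₐ, J eₐ` of a `6`-dimensional space and real numbers with `β = ∑ cₐ eₐ ∧ J eₐ` and
`c₀ + c₁ + c₂ = 0` (`IsComplexStructure.exists_isDiagonal`). With `Rₐᵦ = R(eₐ, J eₐ, eᵦ, J eᵦ)` the
eigenvalue equation reads `2 ∑ Rₐᵦ cᵦ = r cₐ`, and `∑ᵦ Rₐᵦ = - κ`, as `R - κ` is orthogonal to the
fundamental form of `J`. After recentring at `½ (δ + Δ)` the diagonal entries are at most
`ε = ½ (Δ - δ)` in absolute value, and the others at most `4 ε / 3` by Berger's estimate
(`IsCurvatureTensor.abs_apply_le`). Adding suitable multiples of the row relations to the quadratic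
form `∑ Rₐᵦ cₐ cᵦ` before the entries are estimated gives the bound `7 ε |c|² / 3` for the recentred
form (`abs_quadratic_le`), which is the claim for `r` (`IsCurvatureTensor.eigenvalue_mem`).
-/

namespace NearlyGeom

/-! ### The Ricci identity in local coordinates -/

section LocalConnection

variable {n : ℕ}

/-- The curvature operator `R(u, v) w` of the connection `∇_u v = ∂_u v + Γ(u, v)` on an open
subset of `ℝⁿ`. -/
noncomputable def curv (Γ : E n → E n →ₗ[ℝ] E n →ₗ[ℝ] E n) (y u v w : E n) : E n :=
  fderiv ℝ (fun z => Γ z v w) y u - fderiv ℝ (fun z => Γ z u w) y v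
    + Γ y u (Γ y v w) - Γ y v (Γ y u w)

lemma sum_coord_smul_ebasis (a : E n) : ∑ m, a m • ebasis m = a := by
  simpa [ebasis] using (EuclideanSpace.basisFun (Fin n) ℝ).sum_repr a

/-- The product rule for `T(v₁, …, A, …, v_k)`, for a field `T` of tensors and a vector field `A` in
one of the slots. -/
lemma hasFDerivAt_multilinear_update {k : ℕ}
    {T : E n → MultilinearMap ℝ (fun _ : Fin k => E n) ℝ} {A : E n → E n} {y : E n}
    (hT : ∀ v, DifferentiableAt ℝ (fun z => T z v) y) (hA : DifferentiableAt ℝ A y)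
    (v : Fin k → E n) (s : Fin k) (u : E n) :
    DifferentiableAt ℝ (fun z => T z (Function.update v s (A z))) y ∧
    fderiv ℝ (fun z => T z (Function.update v s (A z))) y u =
      T y (Function.update v s (fderiv ℝ A y u))
        + fderiv ℝ (fun z => T z (Function.update v s (A y))) y u := by
  have key : ∀ (z : E n) (a : E n),
      T z (Function.update v s a) = ∑ m, a m * T z (Function.update v s (ebasis m)) := by
    intro z a
    conv_lhs => rw [← sum_coord_smul_ebasis a]
    rw [MultilinearMap.map_update_sum]
    simp [MultilinearMap.map_update_smul]
  have hAm : ∀ m, HasFDerivAt (fun z => A z m) ((EuclideanSpace.proj m).comp (fderiv ℝ A y)) y :=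
    fun m => (EuclideanSpace.proj m : E n →L[ℝ] ℝ).hasFDerivAt.comp y hA.hasFDerivAt
  have h1 := HasFDerivAt.fun_sum (u := Finset.univ) fun m _ =>
    (hAm m).fun_mul (hT (Function.update v s (ebasis m))).hasFDerivAt
  have h2 := HasFDerivAt.fun_sum (u := Finset.univ) fun m _ =>
    (hT (Function.update v s (ebasis m))).hasFDerivAt.const_mul (A y m)
  rw [funext fun z => key z (A z), funext fun z => key z (A y), key y (fderiv ℝ A y u)]
  refine ⟨h1.differentiableAt, ?_⟩
  rw [h1.fderiv, h2.fderiv]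
  simp only [sum_apply, add_apply, smul_apply, ContinuousLinearMap.comp_apply,
    PiLp.proj_apply, smul_eq_mul, Finset.sum_add_distrib]
  rw [add_comm]
  simp only [mul_comm]

lemma isSymm_second_fderiv {U : Set (E n)} (hU : IsOpen U) {f : E n → ℝ}
    (hf : ContDiffOn ℝ 2 f U) {y : E n} (hy : y ∈ U) (u w : E n) :
    fderiv ℝ (fun z => fderiv ℝ f z u) y w = fderiv ℝ (fun z => fderiv ℝ f z w) y u := by
  have hc : ContDiffAt ℝ 2 f y := hf.contDiffAt (hU.mem_nhds hy)
  have hd : DifferentiableAt ℝ (fderiv ℝ f) y :=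
    (hc.fderiv_right (m := 1) (by norm_num)).differentiableAt (by norm_num)
  have hs : IsSymmSndFDerivAt ℝ f y := hc.isSymmSndFDerivAt (by simp)
  rw [fderiv_clm_apply hd (differentiableAt_const _), fderiv_clm_apply hd (differentiableAt_const _)]
  simpa using hs.eq w u

/-- The commutator of the derivations of the tensor algebra induced by `A` and `B` is the one
induced by their commutator: the terms in which `A` and `B` act on different slots cancel. -/
lemma update_update_sum_comm {k : ℕ} (T : MultilinearMap ℝ (fun _ : Fin k => E n) ℝ)
    (A B : E n → E n) (v : Fin k → E n) :
    (∑ s, ∑ t, T (Function.update (Function.update v s (A (v s))) t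
        (B (Function.update v s (A (v s)) t))))
      - (∑ s, ∑ t, T (Function.update (Function.update v s (B (v s))) t
        (A (Function.update v s (B (v s)) t))))
      = ∑ s, (T (Function.update v s (B (A (v s)))) - T (Function.update v s (A (B (v s))))) := by
  rw [Finset.sum_comm (f := fun s t => T (Function.update (Function.update v s (B (v s))) t
        (A (Function.update v s (B (v s)) t)))), ← Finset.sum_sub_distrib]
  refine Finset.sum_congr rfl fun s _ => ?_
  rw [← Finset.sum_sub_distrib, Finset.sum_eq_single s]
  · simp
  · intro t _ hts
    rw [Function.update_of_ne hts, Function.update_of_ne hts.symm, Function.update_comm hts, sub_self]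
  · simp

/-- The Ricci identity for covariant tensors of any rank, for a torsion-free connection `Γ` on an
open set `U`: if `∇T = S` and `∇S = S₂` then
`S₂(w, u; v) - S₂(u, w; v) = -∑ₛ T(v₁, …, R(w, u) vₛ, …, v_k)`. -/
theorem ricci_identity {k : ℕ} {U : Set (E n)} (hU : IsOpen U)
    {Γ : E n → E n →ₗ[ℝ] E n →ₗ[ℝ] E n} (hΓ : ∀ u v, DifferentiableOn ℝ (fun y => Γ y u v) U)
    (hsymm : ∀ y u v, Γ y u v = Γ y v u)
    {T : E n → MultilinearMap ℝ (fun _ : Fin k => E n) ℝ}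
    (hT : ∀ v, ContDiffOn ℝ 2 (fun y => T y v) U)
    {S : E n → E n → (Fin k → E n) → ℝ}
    (hS : ∀ y ∈ U, ∀ u v, fderiv ℝ (fun z => T z v) y u
      = S y u v + ∑ s, T y (Function.update v s (Γ y u (v s))))
    {y : E n} (hy : y ∈ U) {S₂ : E n → E n → (Fin k → E n) → ℝ}
    (hS₂ : ∀ w u v, fderiv ℝ (fun z => S z u v) y w
      = S₂ w u v + S y (Γ y w u) v + ∑ s, S y u (Function.update v s (Γ y w (v s))))
    (w u : E n) (v : Fin k → E n) :
    S₂ w u v - S₂ u w v = - ∑ s, T y (Function.update v s (curv Γ y w u (v s))) := by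
  have hTd : ∀ v, DifferentiableAt ℝ (fun z => T z v) y := fun v =>
    ((hT v).contDiffAt (hU.mem_nhds hy)).differentiableAt (by norm_num)
  have hΓd : ∀ u v, DifferentiableAt ℝ (fun z => Γ z u v) y := fun u v =>
    (hΓ u v).differentiableAt (hU.mem_nhds hy)
  have hSd : ∀ u v, DifferentiableAt ℝ (fun z => S z u v) y := by
    intro u v
    have hc : ContDiffAt ℝ 2 (fun z => T z v) y := (hT v).contDiffAt (hU.mem_nhds hy)
    have hd : DifferentiableAt ℝ (fderiv ℝ (fun z => T z v)) y :=
      (hc.fderiv_right (m := 1) (by norm_num)).differentiableAt (by norm_num)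
    have h1 : DifferentiableAt ℝ (fun z => fderiv ℝ (fun z => T z v) z u
        - ∑ s, T z (Function.update v s (Γ z u (v s)))) y :=
      (hd.clm_apply (differentiableAt_const _)).sub (DifferentiableAt.fun_sum fun s _ =>
        (hasFDerivAt_multilinear_update hTd (hΓd u (v s)) v s 0).1)
    refine h1.congr_of_eventuallyEq ?_
    filter_upwards [hU.mem_nhds hy] with z hz
    rw [hS z hz]; ring
  -- The second partial derivatives of `T`, expressed by `S₂` and `Γ`; their symmetry is the claim.
  have second : ∀ w u, fderiv ℝ (fun z => fderiv ℝ (fun z => T z v) z u) y w =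
      S₂ w u v + S y (Γ y w u) v + ∑ s, S y u (Function.update v s (Γ y w (v s)))
      + ∑ s, (T y (Function.update v s (fderiv ℝ (fun z => Γ z u (v s)) y w))
        + (S y w (Function.update v s (Γ y u (v s)))
          + ∑ t, T y (Function.update (Function.update v s (Γ y u (v s))) t
              (Γ y w (Function.update v s (Γ y u (v s)) t))))) := by
    intro w u
    have heq : (fun z => fderiv ℝ (fun z => T z v) z u) =ᶠ[nhds y]
        fun z => S z u v + ∑ s, T z (Function.update v s (Γ z u (v s))) := by
      filter_upwards [hU.mem_nhds hy] with z hz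
      exact hS z hz u v
    rw [heq.fderiv_eq, fderiv_fun_add (hSd u v) (DifferentiableAt.fun_sum fun s _ =>
        (hasFDerivAt_multilinear_update hTd (hΓd u (v s)) v s 0).1),
      fderiv_fun_sum fun s _ => (hasFDerivAt_multilinear_update hTd (hΓd u (v s)) v s 0).1]
    simp only [add_apply, sum_apply, hS₂]
    congr 1
    refine Finset.sum_congr rfl fun s _ => ?_
    rw [(hasFDerivAt_multilinear_update hTd (hΓd u (v s)) v s w).2, hS y hy]
  have hsw := isSymm_second_fderiv hU (hT v) hy u w
  rw [second w u, second u w, hsymm y u w] at hsw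
  have hcomm := update_update_sum_comm (T y) (Γ y u) (Γ y w) v
  simp only [curv, MultilinearMap.map_update_add, MultilinearMap.map_update_sub,
    Finset.sum_add_distrib, Finset.sum_sub_distrib] at hsw hcomm ⊢
  linarith

/-- The first Bianchi identity. -/
lemma curv_cyclic {Γ : E n → E n →ₗ[ℝ] E n →ₗ[ℝ] E n}
    (hsymm : ∀ y u v, Γ y u v = Γ y v u) (y u v w : E n) :
    curv Γ y u v w + curv Γ y v w u + curv Γ y w u v = 0 := by
  simp only [curv, hsymm _ w u, hsymm _ w v, hsymm _ v u]
  abel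

end LocalConnection

/-! ### The metric and the Levi-Civita connection in a chart -/

section ChartCalculus

variable {n : ℕ} {M : Type*} [TopologicalSpace M] [ChartedSpace (E n) M]
  [Bundle.RiemannianBundle (fun x : M => TangentSpace (𝓡 n) x)]

/-- The Riemannian metric in the chart `e`, as a bilinear form on `ℝⁿ`. -/
noncomputable def gmet (e : OpenPartialHomeomorph M (E n)) (y : E n) : E n →ₗ[ℝ] E n →ₗ[ℝ] ℝ :=
  LinearMap.mk₂ ℝ (fun u v => inner ℝ
      (mfderiv (𝓡 n) (𝓡 n) e.symm y u : TangentSpace (𝓡 n) (e.symm y))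
      (mfderiv (𝓡 n) (𝓡 n) e.symm y v : TangentSpace (𝓡 n) (e.symm y)))
    (fun u v w => by
      rw [show mfderiv (𝓡 n) (𝓡 n) e.symm y (u + v) = mfderiv (𝓡 n) (𝓡 n) e.symm y u
        + mfderiv (𝓡 n) (𝓡 n) e.symm y v from map_add _ u v, inner_add_left])
    (fun c u v => by
      rw [show mfderiv (𝓡 n) (𝓡 n) e.symm y (c • u) = c • mfderiv (𝓡 n) (𝓡 n) e.symm y u
        from map_smul _ c u, inner_smul_left]; rfl)
    (fun u v w => by
      rw [show mfderiv (𝓡 n) (𝓡 n) e.symm y (v + w) = mfderiv (𝓡 n) (𝓡 n) e.symm y v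
        + mfderiv (𝓡 n) (𝓡 n) e.symm y w from map_add _ v w, inner_add_right])
    (fun c u v => by
      rw [show mfderiv (𝓡 n) (𝓡 n) e.symm y (c • v) = c • mfderiv (𝓡 n) (𝓡 n) e.symm y v
        from map_smul _ c v, inner_smul_right]; rfl)

lemma gmet_apply (e : OpenPartialHomeomorph M (E n)) (y u v : E n) :
    gmet e y u v = inner ℝ
      (mfderiv (𝓡 n) (𝓡 n) e.symm y u : TangentSpace (𝓡 n) (e.symm y))
      (mfderiv (𝓡 n) (𝓡 n) e.symm y v : TangentSpace (𝓡 n) (e.symm y)) := rfl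

lemma metricComp_eq_gmet (e : OpenPartialHomeomorph M (E n)) (y : E n) (i j : Fin n) :
    metricComp e y i j = gmet e y (ebasis i) (ebasis j) := rfl

lemma gmet_symm (e : OpenPartialHomeomorph M (E n)) (y u v : E n) :
    gmet e y u v = gmet e y v u := by
  rw [gmet_apply, gmet_apply, real_inner_comm]

/-- The Levi-Civita connection form `Γ(u, v)` of the chart `e`. -/
noncomputable def Gam (e : OpenPartialHomeomorph M (E n)) (y : E n) :
    E n →ₗ[ℝ] E n →ₗ[ℝ] E n :=
  LinearMap.mk₂ ℝ (fun u v => ∑ k, (∑ i, ∑ j, christoffel e k i j y * (u i * v j)) • ebasis k)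
    (fun u v w => by
      simp only [PiLp.add_apply, add_mul, mul_add, Finset.sum_add_distrib, add_smul])
    (fun c u v => by
      simp only [PiLp.smul_apply, smul_eq_mul, Finset.smul_sum, smul_smul, Finset.mul_sum]
      refine Finset.sum_congr rfl fun k _ => ?_
      congr 1
      refine Finset.sum_congr rfl fun i _ => Finset.sum_congr rfl fun j _ => by ring)
    (fun u v w => by
      simp only [PiLp.add_apply, mul_add, Finset.sum_add_distrib, add_smul])
    (fun c u v => by
      simp only [PiLp.smul_apply, smul_eq_mul, Finset.smul_sum, smul_smul, Finset.mul_sum]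
      refine Finset.sum_congr rfl fun k _ => ?_
      congr 1
      refine Finset.sum_congr rfl fun i _ => Finset.sum_congr rfl fun j _ => by ring)

lemma Gam_apply (e : OpenPartialHomeomorph M (E n)) (y u v : E n) :
    Gam e y u v = ∑ k, (∑ i, ∑ j, christoffel e k i j y * (u i * v j)) • ebasis k := rfl

lemma ebasis_apply (i j : Fin n) : (ebasis i : E n) j = if j = i then 1 else 0 := by
  simp [ebasis]

lemma Gam_ebasis (e : OpenPartialHomeomorph M (E n)) (y : E n) (i j : Fin n) :
    Gam e y (ebasis i) (ebasis j) = ∑ k, christoffel e k i j y • ebasis k := by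
  simp [Gam_apply, ebasis_apply]

lemma metricComp_symm (e : OpenPartialHomeomorph M (E n)) (y : E n) (i j : Fin n) :
    metricComp e y i j = metricComp e y j i := gmet_symm e y _ _

lemma christoffel_symm (e : OpenPartialHomeomorph M (E n)) (k i j : Fin n) (y : E n) :
    christoffel e k i j y = christoffel e k j i y := by
  simp only [christoffel]
  congr 1
  refine Finset.sum_congr rfl fun l _ => ?_
  have : (fun z => metricComp e z i j) = fun z => metricComp e z j i :=
    funext fun z => metricComp_symm e z i j
  rw [this]; ring

lemma Gam_symm (e : OpenPartialHomeomorph M (E n)) (y u v : E n) : Gam e y u v = Gam e y v u := by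
  rw [Gam_apply, Gam_apply]
  refine Finset.sum_congr rfl fun k _ => ?_
  congr 1
  rw [Finset.sum_comm]
  refine Finset.sum_congr rfl fun i _ => Finset.sum_congr rfl fun j _ => ?_
  rw [christoffel_symm]; ring

variable [IsManifold (𝓡 n) ∞ M]

omit [Bundle.RiemannianBundle (fun x : M => TangentSpace (𝓡 n) x)] in
lemma mfderiv_symm_bijective {e : OpenPartialHomeomorph M (E n)} (he : e ∈ atlas (E n) M) {y : E n}
    (hy : y ∈ e.target) : Function.Bijective (mfderiv (𝓡 n) (𝓡 n) e.symm y) := by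
  have := (mdifferentiable_of_mem_atlas (I := 𝓡 n) he).symm.mfderiv_bijective hy
  exact this

lemma gmet_pos {e : OpenPartialHomeomorph M (E n)} (he : e ∈ atlas (E n) M) {y : E n}
    (hy : y ∈ e.target) {u : E n} (hu : u ≠ 0) : 0 < gmet e y u u := by
  rw [gmet_apply, real_inner_self_eq_norm_sq]
  have : (mfderiv (𝓡 n) (𝓡 n) e.symm y u : TangentSpace (𝓡 n) (e.symm y)) ≠ 0 := by
    intro h
    exact hu ((mfderiv_symm_bijective he hy).1 (h.trans (map_zero _).symm))
  positivity

variable [IsContMDiffRiemannianBundle (𝓡 n) ∞ (E n) (fun x : M => TangentSpace (𝓡 n) x)]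

lemma contDiffOn_gmet {e : OpenPartialHomeomorph M (E n)} (he : e ∈ atlas (E n) M) (u v : E n) :
    ContDiffOn ℝ ∞ (fun y => gmet e y u v) e.target := by
  rw [← contMDiffOn_iff_contDiffOn]
  have hsec : ∀ u : E n, ContMDiffOn (𝓡 n) ((𝓡 n).prod 𝓘(ℝ, E n)) ∞
      (fun y => (⟨e.symm y, mfderiv (𝓡 n) (𝓡 n) e.symm y u⟩ : TangentBundle (𝓡 n) M))
      e.target := by
    intro u
    have h1 : ContMDiffOn (𝓡 n) (𝓡 n) ∞ e.symm e.target :=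
      contMDiffOn_symm_of_mem_maximalAtlas (IsManifold.subset_maximalAtlas he)
    have h2 := h1.contMDiffOn_tangentMapWithin (m := ∞) (by simp) e.open_target.uniqueMDiffOn
    have h3 : ContMDiffOn (𝓡 n) ((𝓡 n).prod 𝓘(ℝ, E n)) ∞
        (fun y => (⟨y, u⟩ : TangentBundle (𝓡 n) (E n))) e.target :=
      contMDiffOn_vectorSpace_iff_contDiffOn.2 contDiffOn_const
    have h4 := h2.comp h3 (fun y hy => hy)
    refine h4.congr fun y hy => ?_
    simp [tangentMapWithin, mfderivWithin_of_isOpen e.open_target hy]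
  exact (hsec u).inner_bundle (hsec v)

end ChartCalculus

lemma differentiableAt_det {F : Type*} [NormedAddCommGroup F] [NormedSpace ℝ F] {n : ℕ}
    {A : F → Matrix (Fin n) (Fin n) ℝ} {y : F}
    (hA : ∀ i j, DifferentiableAt ℝ (fun z => A z i j) y) :
    DifferentiableAt ℝ (fun z => (A z).det) y := by
  simp only [Matrix.det_apply']
  fun_prop

lemma differentiableAt_matrix_inv {F : Type*} [NormedAddCommGroup F] [NormedSpace ℝ F] {n : ℕ}
    {A : F → Matrix (Fin n) (Fin n) ℝ} {y : F}
    (hA : ∀ i j, DifferentiableAt ℝ (fun z => A z i j) y) (hdet : (A y).det ≠ 0) (i j : Fin n) :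
    DifferentiableAt ℝ (fun z => (A z)⁻¹ i j) y := by
  simp only [Matrix.inv_def, Ring.inverse_eq_inv', Matrix.smul_apply, smul_eq_mul,
    Matrix.adjugate_apply]
  refine ((differentiableAt_det hA).inv hdet).mul (differentiableAt_det fun k l => ?_)
  by_cases hk : k = j
  · subst hk
    simp
  · simpa [Matrix.updateRow_ne hk] using hA k l

lemma eq_zero_of_basis {ι V : Type*} [AddCommGroup V] [Module ℝ V] (b : Module.Basis ι ℝ V)
    {F : V → ℝ} (hF : IsLinearMap ℝ F) (h : ∀ i, F (b i) = 0) (u : V) : F u = 0 := by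
  have : hF.mk' F = 0 := b.ext h
  exact congrArg (fun L : V →ₗ[ℝ] ℝ => L u) this

lemma eq_zero_of_ebasis {n : ℕ} {F : E n → ℝ} (hF : IsLinearMap ℝ F)
    (h : ∀ i, F (ebasis i) = 0) (u : E n) : F u = 0 :=
  eq_zero_of_basis (EuclideanSpace.basisFun (Fin n) ℝ).toBasis hF
    (fun i => by simpa [ebasis] using h i) u

section ChartCalculus

variable {n : ℕ} {M : Type*} [TopologicalSpace M] [ChartedSpace (E n) M]
  [Bundle.RiemannianBundle (fun x : M => TangentSpace (𝓡 n) x)]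

lemma gmet_eq_dotProduct (e : OpenPartialHomeomorph M (E n)) (y u v : E n) :
    gmet e y u v = ∑ i, ∑ j, u i * v j * metricComp e y i j := by
  conv_lhs => rw [← sum_coord_smul_ebasis u, ← sum_coord_smul_ebasis v]
  simp only [map_sum, map_smul, LinearMap.sum_apply, LinearMap.smul_apply, smul_eq_mul,
    metricComp_eq_gmet, Finset.mul_sum]
  rw [Finset.sum_comm]
  refine Finset.sum_congr rfl fun i _ => Finset.sum_congr rfl fun j _ => by ring

lemma gmet_Gam_ebasis (e : OpenPartialHomeomorph M (E n)) (y : E n) (i j l : Fin n) :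
    gmet e y (ebasis l) (Gam e y (ebasis i) (ebasis j)) =
      ∑ k, metricComp e y l k * christoffel e k i j y := by
  simp [Gam_ebasis, metricComp_eq_gmet, mul_comm]

/-- The metric in the chart `e`, as a field of multilinear maps. -/
noncomputable def gmetMultilinear (e : OpenPartialHomeomorph M (E n)) (y : E n) :
    MultilinearMap ℝ (fun _ : Fin 2 => E n) ℝ where
  toFun v := gmet e y (v 0) (v 1)
  map_update_add' := by
    intro _ v i a b
    fin_cases i <;> simp [Function.update]
  map_update_smul' := by
    intro _ v i a b
    fin_cases i <;> simp [Function.update]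

variable [IsManifold (𝓡 n) ∞ M]

lemma det_metricComp_ne_zero {e : OpenPartialHomeomorph M (E n)} (he : e ∈ atlas (E n) M) {y : E n}
    (hy : y ∈ e.target) : (metricComp e y).det ≠ 0 := by
  intro h
  obtain ⟨v, hv, hv0⟩ := Matrix.exists_mulVec_eq_zero_iff.2 h
  have hu : (WithLp.toLp 2 v : E n) ≠ 0 := fun h0 => hv (by simpa using h0)
  refine (gmet_pos he hy hu).ne' ?_
  rw [gmet_eq_dotProduct]
  refine Finset.sum_eq_zero fun i _ => ?_
  have := congrFun hv0 i
  simp only [Matrix.mulVec, dotProduct, Pi.zero_apply] at this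
  simp only [mul_assoc, ← Finset.mul_sum]
  rw [show ∑ j, v j * metricComp e y i j = 0 by simpa only [mul_comm] using this, mul_zero]

/-- The Koszul formula in coordinates. -/
lemma sum_metricComp_christoffel {e : OpenPartialHomeomorph M (E n)} (he : e ∈ atlas (E n) M)
    {y : E n} (hy : y ∈ e.target) (l i j : Fin n) :
    ∑ k, metricComp e y l k * christoffel e k i j y = (1 / 2) *
      (pderiv i (fun z => metricComp e z j l) y + pderiv j (fun z => metricComp e z i l) y
      - pderiv l (fun z => metricComp e z i j) y) := by
  have hinv : metricComp e y * (metricComp e y)⁻¹ = 1 :=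
    Matrix.mul_nonsing_inv _ (isUnit_iff_ne_zero.2 (det_metricComp_ne_zero he hy))
  simp only [christoffel, Finset.mul_sum]
  rw [Finset.sum_comm]
  have : ∀ m, ∑ k, metricComp e y l k * (1 / 2 * ((metricComp e y)⁻¹ k m *
    (pderiv i (fun z => metricComp e z j m) y + pderiv j (fun z => metricComp e z i m) y
      - pderiv m (fun z => metricComp e z i j) y))) =
      (1 : Matrix (Fin n) (Fin n) ℝ) l m * (1 / 2 *
    (pderiv i (fun z => metricComp e z j m) y + pderiv j (fun z => metricComp e z i m) y
      - pderiv m (fun z => metricComp e z i j) y)) := by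
    intro m
    rw [← hinv, Matrix.mul_apply, Finset.sum_mul]
    exact Finset.sum_congr rfl fun k _ => by ring
  simp only [this, Matrix.one_apply, ite_mul, one_mul, zero_mul, Finset.sum_ite_eq,
    Finset.mem_univ, if_true]

variable [IsContMDiffRiemannianBundle (𝓡 n) ∞ (E n) (fun x : M => TangentSpace (𝓡 n) x)]

lemma contDiffAt_gmet {e : OpenPartialHomeomorph M (E n)} (he : e ∈ atlas (E n) M) (u v : E n)
    {y : E n} (hy : y ∈ e.target) : ContDiffAt ℝ ∞ (fun y => gmet e y u v) y :=
  (contDiffOn_gmet he u v).contDiffAt (e.open_target.mem_nhds hy)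

lemma differentiableAt_christoffel {e : OpenPartialHomeomorph M (E n)} (he : e ∈ atlas (E n) M)
    {y : E n} (hy : y ∈ e.target) (k i j : Fin n) :
    DifferentiableAt ℝ (christoffel e k i j) y := by
  have hg : ∀ i j, ContDiffAt ℝ ∞ (fun z => metricComp e z i j) y :=
    fun i j => contDiffAt_gmet he _ _ hy
  have hp : ∀ i j k, DifferentiableAt ℝ (fun y => pderiv i (fun z => metricComp e z j k) y) y := by
    intro i j k
    have h1 : DifferentiableAt ℝ (fderiv ℝ (fun z => metricComp e z j k)) y :=
      ((hg j k).fderiv_right (m := 1)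
        (by rw [one_add_one_eq_two]; exact ENat.LEInfty.out)).differentiableAt (by norm_num)
    exact h1.clm_apply (differentiableAt_const _)
  have hi := fun k l => differentiableAt_matrix_inv (A := metricComp e) (y := y)
    (fun i j => (hg i j).differentiableAt (by simp)) (det_metricComp_ne_zero he hy) k l
  exact (DifferentiableAt.fun_sum fun l _ =>
    (hi k l).mul (((hp i j l).add (hp j i l)).sub (hp l i j))).const_mul _

lemma differentiableOn_Gam {e : OpenPartialHomeomorph M (E n)} (he : e ∈ atlas (E n) M)
    (u v : E n) : DifferentiableOn ℝ (fun y => Gam e y u v) e.target := by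
  intro y hy
  apply DifferentiableAt.differentiableWithinAt
  have h := fun k i j => differentiableAt_christoffel he hy k i j
  simp only [Gam_apply]
  fun_prop

/-- The Levi-Civita connection is metric. -/
lemma fderiv_gmet {e : OpenPartialHomeomorph M (E n)} (he : e ∈ atlas (E n) M)
    {y : E n} (hy : y ∈ e.target) (u v w : E n) :
    fderiv ℝ (fun z => gmet e z v w) y u = gmet e y (Gam e y u v) w + gmet e y v (Gam e y u w) := by
  have hd : ∀ v w, DifferentiableAt ℝ (fun z => gmet e z v w) y :=
    fun v w => (contDiffAt_gmet he v w hy).differentiableAt (by simp)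
  rw [← sub_eq_zero]
  refine eq_zero_of_ebasis (F := fun u => fderiv ℝ (fun z => gmet e z v w) y u
    - (gmet e y (Gam e y u v) w + gmet e y v (Gam e y u w)))
    ⟨fun a b => by simp; ring, fun a b => by simp; ring⟩ (fun i => ?_) u
  refine eq_zero_of_ebasis (F := fun v => fderiv ℝ (fun z => gmet e z v w) y (ebasis i)
    - (gmet e y (Gam e y (ebasis i) v) w + gmet e y v (Gam e y (ebasis i) w)))
    ⟨fun a b => ?_, fun a b => ?_⟩ (fun j => ?_) v
  · simp only [map_add, LinearMap.add_apply]
    rw [fderiv_fun_add (hd _ _) (hd _ _)]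
    simp; ring
  · simp only [map_smul, LinearMap.smul_apply, smul_eq_mul]
    rw [fderiv_const_mul (hd _ _)]
    simp; ring
  refine eq_zero_of_ebasis (F := fun w => fderiv ℝ (fun z => gmet e z (ebasis j) w) y (ebasis i)
    - (gmet e y (Gam e y (ebasis i) (ebasis j)) w + gmet e y (ebasis j) (Gam e y (ebasis i) w)))
    ⟨fun a b => ?_, fun a b => ?_⟩ (fun k => ?_) w
  · simp only [map_add]
    rw [fderiv_fun_add (hd _ _) (hd _ _)]
    simp; ring
  · simp only [map_smul, smul_eq_mul]
    rw [fderiv_const_mul (hd _ _)]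
    simp; ring
  rw [gmet_symm e y _ (ebasis k), gmet_Gam_ebasis, gmet_Gam_ebasis,
    sum_metricComp_christoffel he hy, sum_metricComp_christoffel he hy]
  have h1 := fun i j : Fin n => (funext fun z => metricComp_symm e z i j :
    (fun z => metricComp e z i j) = fun z => metricComp e z j i)
  simp only [pderiv, h1 k j, ← metricComp_eq_gmet]
  ring

/-- The Ricci identity for the metric, whose covariant derivative vanishes. -/
lemma gmet_curv_antisymm {e : OpenPartialHomeomorph M (E n)} (he : e ∈ atlas (E n) M)
    {y : E n} (hy : y ∈ e.target) (u v w z : E n) :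
    gmet e y (curv (Gam e) y u v w) z = - gmet e y (curv (Gam e) y u v z) w := by
  have := ricci_identity (T := gmetMultilinear e) (S := fun _ _ _ => 0) (S₂ := fun _ _ _ => 0)
    e.open_target (differentiableOn_Gam he) (Gam_symm e)
    (fun v => (contDiffOn_gmet he _ _).of_le ENat.LEInfty.out)
    (fun y hy u v => by simp [gmetMultilinear, fderiv_gmet he hy, Function.update]) hy
    (by simp) u v ![w, z]
  simp only [sub_zero, gmetMultilinear, MultilinearMap.coe_mk, Fin.sum_univ_two] at this
  simp [Function.update, gmet_symm e y w] at this
  linarith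

/-- The pair symmetry follows from the two skew symmetries and the Bianchi identity. -/
lemma gmet_curv_pair_symm {e : OpenPartialHomeomorph M (E n)} (he : e ∈ atlas (E n) M)
    {y : E n} (hy : y ∈ e.target) (u v w z : E n) :
    gmet e y (curv (Gam e) y u v w) z = gmet e y (curv (Gam e) y w z u) v := by
  have ha := gmet_curv_antisymm he hy
  have hs : ∀ u v w z, gmet e y (curv (Gam e) y u v w) z = - gmet e y (curv (Gam e) y v u w) z := by
    intro u v w z
    rw [show curv (Gam e) y u v w = - curv (Gam e) y v u w by simp only [curv]; abel]
    simp
  have hb : ∀ u v w z, gmet e y (curv (Gam e) y u v w) z + gmet e y (curv (Gam e) y v w u) z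
      + gmet e y (curv (Gam e) y w u v) z = 0 := by
    intro u v w z
    rw [← LinearMap.add_apply, ← LinearMap.add_apply, ← map_add, ← map_add,
      curv_cyclic (Gam_symm e)]
    simp
  linarith [hb u v w z, hb v w z u, hb w z u v, hb z u v w, ha u v w z, ha v w u z, ha w u v z,
    ha v w z u, ha w z v u, ha z v w u, ha w z u v, ha z u w v, ha u w z v, ha z u v w, ha u v z w,
    ha v z u w, hs u v w z, hs v w u z, hs w u v z, hs v w z u, hs w z v u, hs z v w u, hs w z u v,
    hs z u w v, hs u w z v, hs z u v w, hs u v z w, hs v z u w]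

end ChartCalculus

/-! ### Differential forms as multilinear maps -/

section Currying

variable {V : Type*} [AddCommGroup V] [Module ℝ V]

/-- A `1`-form as a linear map. -/
def cur₁ : (V [⋀^Fin 1]→ₗ[ℝ] ℝ) →ₗ[ℝ] V →ₗ[ℝ] ℝ where
  toFun α :=
    { toFun := fun a => α ![a]
      map_add' := fun a b => α.map_vecCons_add ![] a b
      map_smul' := fun c a => α.map_vecCons_smul ![] c a }
  map_add' _ _ := rfl
  map_smul' _ _ := rfl

/-- An alternating `2`-form as a bilinear map. -/
def cur₂ : (V [⋀^Fin 2]→ₗ[ℝ] ℝ) →ₗ[ℝ] V →ₗ[ℝ] V →ₗ[ℝ] ℝ where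
  toFun α := cur₁ ∘ₗ α.curryLeft
  map_add' _ _ := rfl
  map_smul' _ _ := rfl

/-- An alternating `3`-form as a trilinear map. -/
def cur₃ : (V [⋀^Fin 3]→ₗ[ℝ] ℝ) →ₗ[ℝ] V →ₗ[ℝ] V →ₗ[ℝ] V →ₗ[ℝ] ℝ where
  toFun α := cur₂ ∘ₗ α.curryLeft
  map_add' _ _ := rfl
  map_smul' _ _ := rfl

/-- An alternating `4`-form as a quadrilinear map. -/
def cur₄ : (V [⋀^Fin 4]→ₗ[ℝ] ℝ) →ₗ[ℝ] V →ₗ[ℝ] V →ₗ[ℝ] V →ₗ[ℝ] V →ₗ[ℝ] ℝ where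
  toFun α := cur₃ ∘ₗ α.curryLeft
  map_add' _ _ := rfl
  map_smul' _ _ := rfl

lemma cur₂_apply (α : V [⋀^Fin 2]→ₗ[ℝ] ℝ) (a b : V) : cur₂ α a b = α ![a, b] := rfl

lemma cur₃_apply (α : V [⋀^Fin 3]→ₗ[ℝ] ℝ) (a b c : V) : cur₃ α a b c = α ![a, b, c] := rfl

end Currying

section Update

variable {X : Type*}

lemma update_two_zero (a b x : X) : Function.update ![a, b] 0 x = ![x, b] := by
  ext i; fin_cases i <;> rfl

lemma update_two_one (a b x : X) : Function.update ![a, b] 1 x = ![a, x] := by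
  ext i; fin_cases i <;> rfl

lemma update_three_zero (a b c x : X) : Function.update ![a, b, c] 0 x = ![x, b, c] := by
  ext i; fin_cases i <;> rfl

lemma update_three_one (a b c x : X) : Function.update ![a, b, c] 1 x = ![a, x, c] := by
  ext i; fin_cases i <;> rfl

lemma update_three_two (a b c x : X) : Function.update ![a, b, c] 2 x = ![a, b, x] := by
  ext i; fin_cases i <;> rfl

lemma update_four_zero (a b c d x : X) : Function.update ![a, b, c, d] 0 x = ![x, b, c, d] := by
  ext i; fin_cases i <;> rfl

lemma update_four_one (a b c d x : X) : Function.update ![a, b, c, d] 1 x = ![a, x, c, d] := by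
  ext i; fin_cases i <;> rfl

lemma update_four_two (a b c d x : X) : Function.update ![a, b, c, d] 2 x = ![a, b, x, d] := by
  ext i; fin_cases i <;> rfl

lemma update_four_three (a b c d x : X) : Function.update ![a, b, c, d] 3 x = ![a, b, c, x] := by
  ext i; fin_cases i <;> rfl

lemma vec_two_eta (v : Fin 2 → X) : ![v 0, v 1] = v := by
  ext i; fin_cases i <;> rfl

lemma vec_three_eta (v : Fin 3 → X) : ![v 0, v 1, v 2] = v := by
  ext i; fin_cases i <;> rfl

end Update

/-! ### Covariant derivatives of forms in a chart -/

section ChartForms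

variable {n : ℕ} {M : Type*} [TopologicalSpace M] [ChartedSpace (E n) M]

/-- A `2`-form in the chart `e`, as a bilinear map. -/
noncomputable def chart₂ (e : OpenPartialHomeomorph M (E n))
    (α : ∀ x : M, TangentSpace (𝓡 n) x [⋀^Fin 2]→L[ℝ] ℝ) (y : E n) : E n →ₗ[ℝ] E n →ₗ[ℝ] ℝ :=
  cur₂ (chartForm e α y).toAlternatingMap

/-- A `3`-form in the chart `e`, as a trilinear map. -/
noncomputable def chart₃ (e : OpenPartialHomeomorph M (E n))
    (α : ∀ x : M, TangentSpace (𝓡 n) x [⋀^Fin 3]→L[ℝ] ℝ) (y : E n) :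
    E n →ₗ[ℝ] E n →ₗ[ℝ] E n →ₗ[ℝ] ℝ :=
  cur₃ (chartForm e α y).toAlternatingMap

/-- A `4`-form in the chart `e`, as a quadrilinear map. -/
noncomputable def chart₄ (e : OpenPartialHomeomorph M (E n))
    (α : ∀ x : M, TangentSpace (𝓡 n) x [⋀^Fin 4]→L[ℝ] ℝ) (y : E n) :
    E n →ₗ[ℝ] E n →ₗ[ℝ] E n →ₗ[ℝ] E n →ₗ[ℝ] ℝ :=
  cur₄ (chartForm e α y).toAlternatingMap

lemma chart₂_apply (e : OpenPartialHomeomorph M (E n))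
    (α : ∀ x : M, TangentSpace (𝓡 n) x [⋀^Fin 2]→L[ℝ] ℝ) (y a b : E n) :
    chart₂ e α y a b = chartForm e α y ![a, b] := rfl

lemma chart₃_apply (e : OpenPartialHomeomorph M (E n))
    (α : ∀ x : M, TangentSpace (𝓡 n) x [⋀^Fin 3]→L[ℝ] ℝ) (y a b c : E n) :
    chart₃ e α y a b c = chartForm e α y ![a, b, c] := rfl

lemma chart₄_apply (e : OpenPartialHomeomorph M (E n))
    (α : ∀ x : M, TangentSpace (𝓡 n) x [⋀^Fin 4]→L[ℝ] ℝ) (y a b c d : E n) :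
    chart₄ e α y a b c d = chartForm e α y ![a, b, c, d] := rfl

lemma formComp_two (e : OpenPartialHomeomorph M (E n))
    (α : ∀ x : M, TangentSpace (𝓡 n) x [⋀^Fin 2]→L[ℝ] ℝ) (i j : Fin n) (y : E n) :
    formComp e α ![i, j] y = chart₂ e α y (ebasis i) (ebasis j) := by
  rw [chart₂_apply, formComp]
  congr 1
  ext s; fin_cases s <;> rfl

lemma formComp_three (e : OpenPartialHomeomorph M (E n))
    (α : ∀ x : M, TangentSpace (𝓡 n) x [⋀^Fin 3]→L[ℝ] ℝ) (i j k : Fin n) (y : E n) :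
    formComp e α ![i, j, k] y = chart₃ e α y (ebasis i) (ebasis j) (ebasis k) := by
  rw [chart₃_apply, formComp]
  congr 1
  ext s; fin_cases s <;> rfl

lemma contDiffOn_chartForm_apply {k : ℕ} {e : OpenPartialHomeomorph M (E n)}
    (he : e ∈ atlas (E n) M)
    {α : ∀ x : M, TangentSpace (𝓡 n) x [⋀^Fin k]→L[ℝ] ℝ} (hα : IsSmoothForm α) (v : Fin k → E n) :
    ContDiffOn ℝ ∞ (fun y => chartForm e α y v) e.target :=
  (ContinuousAlternatingMap.apply ℝ (E n) ℝ v).contDiff.comp_contDiffOn (hα e he)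

lemma differentiableAt_chartForm_apply {k : ℕ} {e : OpenPartialHomeomorph M (E n)}
    (he : e ∈ atlas (E n) M)
    {α : ∀ x : M, TangentSpace (𝓡 n) x [⋀^Fin k]→L[ℝ] ℝ} (hα : IsSmoothForm α) (v : Fin k → E n)
    {y : E n} (hy : y ∈ e.target) : DifferentiableAt ℝ (fun y => chartForm e α y v) y :=
  ((contDiffOn_chartForm_apply he hα v).contDiffAt (e.open_target.mem_nhds hy)).differentiableAt
    (by simp)

/-- The derivative of a `2`-form in the chart `e`; the first argument is the direction. -/
noncomputable def dchart₂ (e : OpenPartialHomeomorph M (E n))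
    (α : ∀ x : M, TangentSpace (𝓡 n) x [⋀^Fin 2]→L[ℝ] ℝ) (y : E n) :
    E n →ₗ[ℝ] E n →ₗ[ℝ] E n →ₗ[ℝ] ℝ :=
  cur₂ ∘ₗ (ContinuousAlternatingMap.toAlternatingMapLinear (R := ℝ)) ∘ₗ
    (fderiv ℝ (chartForm e α) y).toLinearMap

/-- The derivative of a `3`-form in the chart `e`; the first argument is the direction. -/
noncomputable def dchart₃ (e : OpenPartialHomeomorph M (E n))
    (α : ∀ x : M, TangentSpace (𝓡 n) x [⋀^Fin 3]→L[ℝ] ℝ) (y : E n) :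
    E n →ₗ[ℝ] E n →ₗ[ℝ] E n →ₗ[ℝ] E n →ₗ[ℝ] ℝ :=
  cur₃ ∘ₗ (ContinuousAlternatingMap.toAlternatingMapLinear (R := ℝ)) ∘ₗ
    (fderiv ℝ (chartForm e α) y).toLinearMap

/-- The derivative of a `4`-form in the chart `e`; the first argument is the direction. -/
noncomputable def dchart₄ (e : OpenPartialHomeomorph M (E n))
    (α : ∀ x : M, TangentSpace (𝓡 n) x [⋀^Fin 4]→L[ℝ] ℝ) (y : E n) :
    E n →ₗ[ℝ] E n →ₗ[ℝ] E n →ₗ[ℝ] E n →ₗ[ℝ] E n →ₗ[ℝ] ℝ :=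
  cur₄ ∘ₗ (ContinuousAlternatingMap.toAlternatingMapLinear (R := ℝ)) ∘ₗ
    (fderiv ℝ (chartForm e α) y).toLinearMap

lemma differentiableAt_chartForm {k : ℕ} {e : OpenPartialHomeomorph M (E n)}
    (he : e ∈ atlas (E n) M)
    {α : ∀ x : M, TangentSpace (𝓡 n) x [⋀^Fin k]→L[ℝ] ℝ} (hα : IsSmoothForm α)
    {y : E n} (hy : y ∈ e.target) : DifferentiableAt ℝ (chartForm e α) y :=
  ((hα e he).contDiffAt (e.open_target.mem_nhds hy)).differentiableAt (by simp)

lemma fderiv_chartForm_apply {k : ℕ} {e : OpenPartialHomeomorph M (E n)} (he : e ∈ atlas (E n) M)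
    {α : ∀ x : M, TangentSpace (𝓡 n) x [⋀^Fin k]→L[ℝ] ℝ} (hα : IsSmoothForm α) (v : Fin k → E n)
    {y : E n} (hy : y ∈ e.target) (u : E n) :
    fderiv ℝ (fun z => chartForm e α z v) y u = fderiv ℝ (chartForm e α) y u v :=
  congrArg (fun L => L u) ((differentiableAt_chartForm he hα hy).hasFDerivAt
    |>.continuousAlternatingMap_apply_const v).fderiv

lemma fderiv_chart₂ {e : OpenPartialHomeomorph M (E n)} (he : e ∈ atlas (E n) M)
    {α : ∀ x : M, TangentSpace (𝓡 n) x [⋀^Fin 2]→L[ℝ] ℝ} (hα : IsSmoothForm α)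
    {y : E n} (hy : y ∈ e.target) (u a b : E n) :
    fderiv ℝ (fun z => chart₂ e α z a b) y u = dchart₂ e α y u a b :=
  fderiv_chartForm_apply he hα ![a, b] hy u

lemma fderiv_chart₃ {e : OpenPartialHomeomorph M (E n)} (he : e ∈ atlas (E n) M)
    {α : ∀ x : M, TangentSpace (𝓡 n) x [⋀^Fin 3]→L[ℝ] ℝ} (hα : IsSmoothForm α)
    {y : E n} (hy : y ∈ e.target) (u a b c : E n) :
    fderiv ℝ (fun z => chart₃ e α z a b c) y u = dchart₃ e α y u a b c :=
  fderiv_chartForm_apply he hα ![a, b, c] hy u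

lemma fderiv_chart₄ {e : OpenPartialHomeomorph M (E n)} (he : e ∈ atlas (E n) M)
    {α : ∀ x : M, TangentSpace (𝓡 n) x [⋀^Fin 4]→L[ℝ] ℝ} (hα : IsSmoothForm α)
    {y : E n} (hy : y ∈ e.target) (u a b c d : E n) :
    fderiv ℝ (fun z => chart₄ e α z a b c d) y u = dchart₄ e α y u a b c d :=
  fderiv_chartForm_apply he hα ![a, b, c, d] hy u

variable [Bundle.RiemannianBundle (fun x : M => TangentSpace (𝓡 n) x)]

/-- The component `(∇_u α)(a, b)` of the covariant derivative of a `2`-form in the chart `e`. -/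
noncomputable def cov₂ (e : OpenPartialHomeomorph M (E n))
    (α : ∀ x : M, TangentSpace (𝓡 n) x [⋀^Fin 2]→L[ℝ] ℝ) (y u a b : E n) : ℝ :=
  dchart₂ e α y u a b - (chart₂ e α y (Gam e y u a) b + chart₂ e α y a (Gam e y u b))

/-- The component `(∇_u α)(a, b, c)` of the covariant derivative of a `3`-form in the chart `e`. -/
noncomputable def cov₃ (e : OpenPartialHomeomorph M (E n))
    (α : ∀ x : M, TangentSpace (𝓡 n) x [⋀^Fin 3]→L[ℝ] ℝ) (y u a b c : E n) : ℝ :=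
  dchart₃ e α y u a b c - (chart₃ e α y (Gam e y u a) b c + chart₃ e α y a (Gam e y u b) c
      + chart₃ e α y a b (Gam e y u c))

/-- The component `(∇_u α)(a, b, c, d)` of the covariant derivative of a `4`-form in the chart
`e`. -/
noncomputable def cov₄ (e : OpenPartialHomeomorph M (E n))
    (α : ∀ x : M, TangentSpace (𝓡 n) x [⋀^Fin 4]→L[ℝ] ℝ) (y u a b c d : E n) : ℝ :=
  dchart₄ e α y u a b c d
    - (chart₄ e α y (Gam e y u a) b c d + chart₄ e α y a (Gam e y u b) c d
      + chart₄ e α y a b (Gam e y u c) d + chart₄ e α y a b c (Gam e y u d))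

lemma covDerivComp_two {e : OpenPartialHomeomorph M (E n)} (he : e ∈ atlas (E n) M)
    {α : ∀ x : M, TangentSpace (𝓡 n) x [⋀^Fin 2]→L[ℝ] ℝ} (hα : IsSmoothForm α)
    {y : E n} (hy : y ∈ e.target) (i j k : Fin n) :
    covDerivComp e α i ![j, k] y = cov₂ e α y (ebasis i) (ebasis j) (ebasis k) := by
  rw [covDerivComp, pderiv, Fin.sum_univ_two, cov₂, ← fderiv_chart₂ he hα hy,
    show formComp e α ![j, k] = fun z => chart₂ e α z (ebasis j) (ebasis k) from
      funext fun z => formComp_two e α j k z]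
  simp [update_two_zero, update_two_one, formComp_two, Gam_ebasis]

lemma covDerivComp_three {e : OpenPartialHomeomorph M (E n)} (he : e ∈ atlas (E n) M)
    {α : ∀ x : M, TangentSpace (𝓡 n) x [⋀^Fin 3]→L[ℝ] ℝ} (hα : IsSmoothForm α)
    {y : E n} (hy : y ∈ e.target) (i j k l : Fin n) :
    covDerivComp e α i ![j, k, l] y = cov₃ e α y (ebasis i) (ebasis j) (ebasis k) (ebasis l) := by
  rw [covDerivComp, pderiv, Fin.sum_univ_three, cov₃, ← fderiv_chart₃ he hα hy,
    show formComp e α ![j, k, l] = fun z => chart₃ e α z (ebasis j) (ebasis k) (ebasis l) from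
      funext fun z => formComp_three e α j k l z]
  simp [update_three_zero, update_three_one, update_three_two, formComp_three, Gam_ebasis]

variable [IsManifold (𝓡 n) ∞ M]
  [IsContMDiffRiemannianBundle (𝓡 n) ∞ (E n) (fun x : M => TangentSpace (𝓡 n) x)]

/-- The Ricci identity for `2`-forms. Here `S` is a formula for `∇α`, and `S₂` is the covariant
derivative of that formula. -/
theorem ricci_identity_two {e : OpenPartialHomeomorph M (E n)} (he : e ∈ atlas (E n) M)
    {α : ∀ x : M, TangentSpace (𝓡 n) x [⋀^Fin 2]→L[ℝ] ℝ} (hα : IsSmoothForm α)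
    {S : E n → E n → E n → E n → ℝ} (hS : ∀ y ∈ e.target, ∀ u a b, cov₂ e α y u a b = S y u a b)
    {y : E n} (hy : y ∈ e.target) {S₂ : E n → E n → E n → E n → ℝ}
    (hS₂ : ∀ w u a b, fderiv ℝ (fun z => S z u a b) y w = S₂ w u a b + S y (Gam e y w u) a b
      + (S y u (Gam e y w a) b + S y u a (Gam e y w b)))
    (w u a b : E n) :
    S₂ w u a b - S₂ u w a b =
      - (chart₂ e α y (curv (Gam e) y w u a) b + chart₂ e α y a (curv (Gam e) y w u b)) := by
  have := ricci_identity (T := fun y => (chartForm e α y).toMultilinearMap)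
    (S := fun y u v => S y u (v 0) (v 1)) (S₂ := fun w u v => S₂ w u (v 0) (v 1))
    e.open_target (differentiableOn_Gam he) (Gam_symm e)
    (fun v => (contDiffOn_chartForm_apply he hα v).of_le ENat.LEInfty.out)
    (fun y hy u v => by
      have h := fderiv_chart₂ he hα hy u (v 0) (v 1)
      simp only [chart₂_apply, vec_two_eta] at h
      rw [← hS y hy, cov₂, Fin.sum_univ_two, ← h]
      conv_rhs => rw [← vec_two_eta v]
      simp only [update_two_zero, update_two_one]
      simp [chart₂_apply, vec_two_eta])
    hy (fun w u v => by
      rw [hS₂]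
      conv_rhs => rw [← vec_two_eta v]
      rw [Fin.sum_univ_two]
      simp) w u ![a, b]
  rw [Fin.sum_univ_two] at this
  simpa [update_two_zero, update_two_one, chart₂_apply] using this

/-- The Ricci identity for `3`-forms. Here `S` is a formula for `∇α`, and `S₂` is the covariant
derivative of that formula. -/
theorem ricci_identity_three {e : OpenPartialHomeomorph M (E n)} (he : e ∈ atlas (E n) M)
    {α : ∀ x : M, TangentSpace (𝓡 n) x [⋀^Fin 3]→L[ℝ] ℝ} (hα : IsSmoothForm α)
    {S : E n → E n → E n → E n → E n → ℝ}
    (hS : ∀ y ∈ e.target, ∀ u a b c, cov₃ e α y u a b c = S y u a b c)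
    {y : E n} (hy : y ∈ e.target) {S₂ : E n → E n → E n → E n → E n → ℝ}
    (hS₂ : ∀ w u a b c, fderiv ℝ (fun z => S z u a b c) y w = S₂ w u a b c
      + S y (Gam e y w u) a b c
      + (S y u (Gam e y w a) b c + S y u a (Gam e y w b) c + S y u a b (Gam e y w c)))
    (w u a b c : E n) :
    S₂ w u a b c - S₂ u w a b c =
      - (chart₃ e α y (curv (Gam e) y w u a) b c + chart₃ e α y a (curv (Gam e) y w u b) c
        + chart₃ e α y a b (curv (Gam e) y w u c)) := by
  have := ricci_identity (T := fun y => (chartForm e α y).toMultilinearMap)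
    (S := fun y u v => S y u (v 0) (v 1) (v 2))
    (S₂ := fun w u v => S₂ w u (v 0) (v 1) (v 2))
    e.open_target (differentiableOn_Gam he) (Gam_symm e)
    (fun v => (contDiffOn_chartForm_apply he hα v).of_le ENat.LEInfty.out)
    (fun y hy u v => by
      have h := fderiv_chart₃ he hα hy u (v 0) (v 1) (v 2)
      simp only [chart₃_apply, vec_three_eta] at h
      rw [← hS y hy, cov₃, Fin.sum_univ_three, ← h]
      conv_rhs => rw [← vec_three_eta v]
      simp only [update_three_zero, update_three_one, update_three_two]
      simp [chart₃_apply, vec_three_eta])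
    hy (fun w u v => by
      rw [hS₂]
      conv_rhs => rw [← vec_three_eta v]
      rw [Fin.sum_univ_three]
      simp) w u ![a, b, c]
  rw [Fin.sum_univ_three] at this
  simpa [update_three_zero, update_three_one, update_three_two, chart₃_apply] using this

end ChartForms

/-! ### The curvature tensor in a chart -/

section Curvature

variable {n : ℕ} {M : Type*} [TopologicalSpace M] [ChartedSpace (E n) M]
  [Bundle.RiemannianBundle (fun x : M => TangentSpace (𝓡 n) x)]

lemma curv_antisymm (Γ : E n → E n →ₗ[ℝ] E n →ₗ[ℝ] E n) (y u v w : E n) :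
    curv Γ y u v w = - curv Γ y v u w := by
  simp only [curv]; abel

variable [IsManifold (𝓡 n) ∞ M]
  [IsContMDiffRiemannianBundle (𝓡 n) ∞ (E n) (fun x : M => TangentSpace (𝓡 n) x)]

lemma differentiableAt_Gam {e : OpenPartialHomeomorph M (E n)} (he : e ∈ atlas (E n) M)
    {y : E n} (hy : y ∈ e.target) (u v : E n) : DifferentiableAt ℝ (fun y => Gam e y u v) y :=
  (differentiableOn_Gam he u v).differentiableAt (e.open_target.mem_nhds hy)

lemma isLinearMap_curv₁ {e : OpenPartialHomeomorph M (E n)} (he : e ∈ atlas (E n) M)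
    {y : E n} (hy : y ∈ e.target) (v w : E n) :
    IsLinearMap ℝ (fun u => curv (Gam e) y u v w) := by
  have hd := differentiableAt_Gam he hy
  constructor
  · intro a b
    simp only [curv, map_add, LinearMap.add_apply]
    rw [fderiv_fun_add (hd _ _) (hd _ _)]
    simp; abel
  · intro c a
    simp only [curv, map_smul, LinearMap.smul_apply]
    rw [fderiv_fun_const_smul (hd _ _)]
    simp [smul_add, smul_sub]

lemma isLinearMap_curv₂ {e : OpenPartialHomeomorph M (E n)} (he : e ∈ atlas (E n) M)
    {y : E n} (hy : y ∈ e.target) (u w : E n) :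
    IsLinearMap ℝ (fun v => curv (Gam e) y u v w) := by
  have h := isLinearMap_curv₁ he hy u w
  constructor
  · intro a b
    simp only [curv_antisymm _ _ u, h.map_add]; abel
  · intro c a
    simp only [curv_antisymm _ _ u, h.map_smul, smul_neg]

lemma isLinearMap_curv₃ {e : OpenPartialHomeomorph M (E n)} (he : e ∈ atlas (E n) M)
    {y : E n} (hy : y ∈ e.target) (u v : E n) :
    IsLinearMap ℝ (fun w => curv (Gam e) y u v w) := by
  have hd := differentiableAt_Gam he hy
  constructor
  · intro a b
    simp only [curv, map_add]
    rw [fderiv_fun_add (hd _ _) (hd _ _), fderiv_fun_add (hd _ _) (hd _ _)]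
    simp; abel
  · intro c a
    simp only [curv, map_smul]
    rw [fderiv_fun_const_smul (hd _ _), fderiv_fun_const_smul (hd _ _)]
    simp [smul_add, smul_sub]

lemma curv_ebasis {e : OpenPartialHomeomorph M (E n)} (he : e ∈ atlas (E n) M)
    {y : E n} (hy : y ∈ e.target) (i j k : Fin n) :
    curv (Gam e) y (ebasis i) (ebasis j) (ebasis k) = ∑ l, riemannUp e i j k l y • ebasis l := by
  have hd := differentiableAt_christoffel he hy
  have hf : ∀ i j k, fderiv ℝ (fun z => Gam e z (ebasis j) (ebasis k)) y (ebasis i) =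
      ∑ l, pderiv i (christoffel e l j k) y • ebasis l := by
    intro i j k
    simp only [Gam_ebasis]
    rw [fderiv_fun_sum fun l _ => (hd l j k).smul_const (ebasis l)]
    simp only [sum_apply]
    refine Finset.sum_congr rfl fun l _ => ?_
    rw [fderiv_smul_const (hd l j k)]
    rfl
  have hq : ∀ i j k, Gam e y (ebasis i) (Gam e y (ebasis j) (ebasis k)) =
      ∑ l, (∑ m, christoffel e l i m y * christoffel e m j k y) • ebasis l := by
    intro i j k
    rw [Gam_ebasis, map_sum]
    simp only [map_smul, Gam_ebasis, Finset.smul_sum, smul_smul, Finset.sum_smul]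
    rw [Finset.sum_comm]
    refine Finset.sum_congr rfl fun l _ => Finset.sum_congr rfl fun m _ => by rw [mul_comm]
  simp only [curv, hf, hq, riemannUp, ← Finset.sum_sub_distrib, ← Finset.sum_add_distrib,
    ← sub_smul, ← add_smul]
  refine Finset.sum_congr rfl fun l _ => ?_
  rw [Finset.sum_sub_distrib, add_sub_assoc]

lemma riemannComp_eq {e : OpenPartialHomeomorph M (E n)} (he : e ∈ atlas (E n) M)
    {y : E n} (hy : y ∈ e.target) (i j k l : Fin n) :
    riemannComp e i j k l y =
      gmet e y (curv (Gam e) y (ebasis i) (ebasis j) (ebasis k)) (ebasis l) := by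
  rw [curv_ebasis he hy, gmet_symm]
  simp [riemannComp, metricComp_eq_gmet, mul_comm]

lemma gmet_curv_eq_sum {e : OpenPartialHomeomorph M (E n)} (he : e ∈ atlas (E n) M)
    {y : E n} (hy : y ∈ e.target) (u v w z : E n) :
    gmet e y (curv (Gam e) y u v w) z =
      ∑ i, ∑ j, ∑ k, ∑ l, riemannComp e i j k l y * (u i * v j * w k * z l) := by
  have e1 : ∀ {F : E n → E n}, IsLinearMap ℝ F → ∀ u, F u = ∑ i, u i • F (ebasis i) := by
    intro F hF u
    conv_lhs => rw [← sum_coord_smul_ebasis u]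
    change hF.mk' F _ = _
    simp
  rw [e1 (isLinearMap_curv₁ he hy v w) u, map_sum, LinearMap.sum_apply]
  refine Finset.sum_congr rfl fun i _ => ?_
  rw [e1 (isLinearMap_curv₂ he hy (ebasis i) w) v, Finset.smul_sum, map_sum, LinearMap.sum_apply]
  refine Finset.sum_congr rfl fun j _ => ?_
  rw [e1 (isLinearMap_curv₃ he hy (ebasis i) (ebasis j)) w, Finset.smul_sum, Finset.smul_sum,
    map_sum, LinearMap.sum_apply]
  refine Finset.sum_congr rfl fun k _ => ?_
  conv_lhs => rw [← sum_coord_smul_ebasis z]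
  rw [map_sum]
  refine Finset.sum_congr rfl fun l _ => ?_
  rw [riemannComp_eq he hy]
  simp only [map_smul, LinearMap.smul_apply, smul_eq_mul]
  ring

end Curvature

/-! ### The curvature of a nearly Kähler manifold in a chart -/

section NearlyKahler

variable {M : Type*} [TopologicalSpace M] [ChartedSpace (E 6) M]
  [Bundle.RiemannianBundle (fun x : M => TangentSpace (𝓡 6) x)]
  {om : ∀ x : M, TangentSpace (𝓡 6) x [⋀^Fin 2]→L[ℝ] ℝ}
  {ψp ψm : ∀ x : M, TangentSpace (𝓡 6) x [⋀^Fin 3]→L[ℝ] ℝ}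

lemma IsNearlyKahler6.cov_om (h : IsNearlyKahler6 om ψp ψm)
    {e : OpenPartialHomeomorph M (E 6)} (he : e ∈ atlas (E 6) M) {y : E 6} (hy : y ∈ e.target)
    (u a b : E 6) : cov₂ e om y u a b = - chart₃ e ψp y u a b := by
  rw [← sub_eq_zero]
  refine eq_zero_of_ebasis (F := fun u => cov₂ e om y u a b - - chart₃ e ψp y u a b)
    ⟨fun _ _ => by simp [cov₂]; ring, fun _ _ => by simp [cov₂]; ring⟩ (fun i => ?_) u
  refine eq_zero_of_ebasis (F := fun a => cov₂ e om y _ a b - - chart₃ e ψp y _ a b)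
    ⟨fun _ _ => by simp [cov₂]; ring, fun _ _ => by simp [cov₂]; ring⟩ (fun j => ?_) a
  refine eq_zero_of_ebasis (F := fun b => cov₂ e om y _ _ b - - chart₃ e ψp y _ _ b)
    ⟨fun _ _ => by simp [cov₂]; ring, fun _ _ => by simp [cov₂]; ring⟩ (fun k => ?_) b
  rw [← covDerivComp_two he h.smooth_om hy, h.nabla_om e he y hy, formComp_three, sub_self]

lemma IsNearlyKahler6.cov_ψp (h : IsNearlyKahler6 om ψp ψm)
    {e : OpenPartialHomeomorph M (E 6)} (he : e ∈ atlas (E 6) M) {y : E 6} (hy : y ∈ e.target)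
    (u a b c : E 6) : cov₃ e ψp y u a b c = gmet e y u a * chart₂ e om y b c
      + gmet e y u b * chart₂ e om y c a + gmet e y u c * chart₂ e om y a b := by
  rw [← sub_eq_zero]
  refine eq_zero_of_ebasis (F := fun u => cov₃ e ψp y u a b c - (gmet e y u a * chart₂ e om y b c
      + gmet e y u b * chart₂ e om y c a + gmet e y u c * chart₂ e om y a b))
    ⟨fun _ _ => by simp [cov₃]; ring, fun _ _ => by simp [cov₃]; ring⟩ (fun i => ?_) u
  refine eq_zero_of_ebasis (F := fun a => cov₃ e ψp y _ a b c - (gmet e y _ a * chart₂ e om y b c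
      + gmet e y _ b * chart₂ e om y c a + gmet e y _ c * chart₂ e om y a b))
    ⟨fun _ _ => by simp [cov₃]; ring, fun _ _ => by simp [cov₃]; ring⟩ (fun j => ?_) a
  refine eq_zero_of_ebasis (F := fun b => cov₃ e ψp y _ _ b c - (gmet e y _ _ * chart₂ e om y b c
      + gmet e y _ b * chart₂ e om y c _ + gmet e y _ c * chart₂ e om y _ b))
    ⟨fun _ _ => by simp [cov₃]; ring, fun _ _ => by simp [cov₃]; ring⟩ (fun k => ?_) b
  refine eq_zero_of_ebasis (F := fun c => cov₃ e ψp y _ _ _ c - (gmet e y _ _ * chart₂ e om y _ c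
      + gmet e y _ _ * chart₂ e om y c _ + gmet e y _ c * chart₂ e om y _ _))
    ⟨fun _ _ => by simp [cov₃]; ring, fun _ _ => by simp [cov₃]; ring⟩ (fun l => ?_) c
  rw [← covDerivComp_three he h.smooth_ψp hy, h.nabla_ψp e he y hy, formComp_two, formComp_two,
    formComp_two, sub_eq_zero]
  rfl

variable [IsManifold (𝓡 6) ∞ M]
  [IsContMDiffRiemannianBundle (𝓡 6) ∞ (E 6) (fun x : M => TangentSpace (𝓡 6) x)]

/-- On a nearly Kähler manifold the curvature acts on `ω` as if the sectional curvature were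
constant and equal to `1`. -/
lemma IsNearlyKahler6.curv_om (h : IsNearlyKahler6 om ψp ψm)
    {e : OpenPartialHomeomorph M (E 6)} (he : e ∈ atlas (E 6) M) {y : E 6} (hy : y ∈ e.target)
    (w u a b : E 6) :
    chart₂ e om y (curv (Gam e) y w u a) b + chart₂ e om y a (curv (Gam e) y w u b) =
      gmet e y u a * chart₂ e om y w b - gmet e y w a * chart₂ e om y u b
      + (gmet e y u b * chart₂ e om y a w - gmet e y w b * chart₂ e om y a u) := by
  have hneg : ∀ a b, chart₂ e om y a b = - chart₂ e om y b a := by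
    intro a b
    have := (chartForm e om y).toAlternatingMap.map_swap ![a, b] (i := 0) (j := 1) (by decide)
    have h2 : ![a, b] ∘ Equiv.swap (0 : Fin 2) 1 = ![b, a] := by
      ext i; fin_cases i <;> rfl
    rw [h2] at this
    rw [chart₂_apply, chart₂_apply, eq_neg_iff_add_eq_zero, add_comm, ← eq_neg_iff_add_eq_zero]
    exact this
  have := ricci_identity_two he h.smooth_om (S := fun y u a b => - chart₃ e ψp y u a b)
    (fun y hy u a b => h.cov_om he hy u a b) hy
    (S₂ := fun w u a b => - cov₃ e ψp y w u a b) (fun w u a b => by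
      rw [fderiv_fun_neg, neg_apply, fderiv_chart₃ he h.smooth_ψp hy, cov₃]
      ring) w u a b
  simp only [h.cov_ψp he hy] at this
  rw [gmet_symm e y u w, hneg b w, hneg b u] at this
  rw [hneg a w, hneg a u]
  linarith

/-- On a nearly Kähler manifold the curvature acts on `ψ⁺` as if the sectional curvature were
constant and equal to `1`. -/
lemma IsNearlyKahler6.curv_ψp (h : IsNearlyKahler6 om ψp ψm)
    {e : OpenPartialHomeomorph M (E 6)} (he : e ∈ atlas (E 6) M) {y : E 6} (hy : y ∈ e.target)
    (w u a b c : E 6) :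
    chart₃ e ψp y (curv (Gam e) y w u a) b c + chart₃ e ψp y a (curv (Gam e) y w u b) c
        + chart₃ e ψp y a b (curv (Gam e) y w u c) =
      gmet e y u a * chart₃ e ψp y w b c - gmet e y w a * chart₃ e ψp y u b c
      + (gmet e y u b * chart₃ e ψp y a w c - gmet e y w b * chart₃ e ψp y a u c)
      + (gmet e y u c * chart₃ e ψp y a b w - gmet e y w c * chart₃ e ψp y a b u) := by
  have hcyc : ∀ a b c, chart₃ e ψp y a b c = chart₃ e ψp y b c a := by
    intro a b c
    have := (chartForm e ψp y).toAlternatingMap.map_perm ![a, b, c] (finRotate 3)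
    have h2 : ![a, b, c] ∘ finRotate 3 = ![b, c, a] := by
      ext i; fin_cases i <;> rfl
    rw [h2] at this
    simp [sign_finRotate] at this
    exact this.symm
  have hg := fun a b => (contDiffAt_gmet he a b hy).differentiableAt (by simp)
  have ho : ∀ a b, DifferentiableAt ℝ (fun z => chart₂ e om z a b) y :=
    fun a b => differentiableAt_chartForm_apply he h.smooth_om ![a, b] hy
  have := ricci_identity_three he h.smooth_ψp (S := fun y u a b c =>
      gmet e y u a * chart₂ e om y b c + gmet e y u b * chart₂ e om y c a
      + gmet e y u c * chart₂ e om y a b)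
    (fun y hy u a b => h.cov_ψp he hy u a b) hy
    (S₂ := fun w u a b c => gmet e y u a * cov₂ e om y w b c
      + gmet e y u b * cov₂ e om y w c a + gmet e y u c * cov₂ e om y w a b) (fun w u a b c => by
      rw [fderiv_fun_add (((hg _ _).fun_mul (ho _ _)).fun_add ((hg _ _).fun_mul (ho _ _)))
        ((hg _ _).fun_mul (ho _ _)), fderiv_fun_add ((hg _ _).fun_mul (ho _ _))
        ((hg _ _).fun_mul (ho _ _)), fderiv_fun_mul (hg _ _) (ho _ _),
        fderiv_fun_mul (hg _ _) (ho _ _), fderiv_fun_mul (hg _ _) (ho _ _)]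
      simp only [add_apply, smul_apply, smul_eq_mul, fderiv_gmet he hy,
        fderiv_chart₂ he h.smooth_om hy, cov₂]
      ring) w u a b c
  simp only [h.cov_om he hy] at this
  rw [hcyc a w c, hcyc a u c, hcyc w c a, hcyc u c a, hcyc a b w, hcyc b w a, hcyc a b u,
    hcyc b u a] at *
  linarith [hcyc w c a, hcyc u c a, hcyc w a b, hcyc u a b, hcyc c a w, hcyc c a u]

end NearlyKahler

/-! ### The standard `G₂` form -/

/-- The index of `eᵢ × eⱼ = ± e_{fanoMul i j}` for the cross product of `ℝ⁷` attached to the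
standard `G₂` form. -/
def fanoMul : Fin 7 → Fin 7 → Fin 7 :=
  ![![0, 2, 1, 4, 3, 6, 5], ![2, 0, 0, 5, 6, 3, 4], ![1, 0, 0, 6, 5, 4, 3],
    ![4, 5, 6, 0, 0, 1, 2], ![3, 6, 5, 0, 0, 2, 1], ![6, 3, 4, 1, 2, 0, 0],
    ![5, 4, 3, 2, 1, 0, 0]]

/-- The sign in `eᵢ × eⱼ = ± e_{fanoMul i j}`, which is `0` for `i = j`. -/
def fanoSgn : Fin 7 → Fin 7 → ℤ :=
  ![![0, 1, -1, 1, -1, -1, 1], ![-1, 0, 1, 1, 1, -1, -1], ![1, -1, 0, 1, -1, 1, -1],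
    ![-1, -1, -1, 0, 1, 1, 1], ![1, -1, 1, -1, 0, -1, 1], ![1, 1, -1, -1, 1, 0, -1],
    ![-1, 1, 1, -1, -1, 1, 0]]

/-- The components of the standard `G₂` form. They are integers, so that the identities between them
are decidable. -/
def phi₀ (i j k : Fin 7) : ℤ := if k = fanoMul i j then fanoSgn i j else 0

/-- The Kronecker symbol. -/
def kron {n : ℕ} (i j : Fin n) : ℤ := if i = j then 1 else 0

/-- The components of the Hodge dual of the standard `G₂` form, through
`ψᵢⱼₖₗ = δᵢₖ δⱼₗ - δᵢₗ δⱼₖ - ∑ₘ φᵢⱼₘ φₖₗₘ`. -/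
def psi₀ (i j k l : Fin 7) : ℤ :=
  kron i k * kron j l - kron i l * kron j k
    - fanoSgn i j * fanoSgn k l * kron (fanoMul i j) (fanoMul k l)

/-- A `3 × 3` minor of the identity matrix: the components of `e^{I₁} ∧ e^{I₂} ∧ e^{I₃}`. -/
def minor₃ {n : ℕ} (I : Fin 3 → Fin n) (i j k : Fin n) : ℤ :=
  kron (I 0) i * (kron (I 1) j * kron (I 2) k - kron (I 1) k * kron (I 2) j)
  - kron (I 0) j * (kron (I 1) i * kron (I 2) k - kron (I 1) k * kron (I 2) i)
  + kron (I 0) k * (kron (I 1) i * kron (I 2) j - kron (I 1) j * kron (I 2) i)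

/-- A `4 × 4` minor of the identity matrix: the components of
`e^{I₁} ∧ e^{I₂} ∧ e^{I₃} ∧ e^{I₄}`. -/
def minor₄ {n : ℕ} (I : Fin 4 → Fin n) (i j k l : Fin n) : ℤ :=
  kron (I 0) i * minor₃ ![I 1, I 2, I 3] j k l - kron (I 0) j * minor₃ ![I 1, I 2, I 3] i k l
  + kron (I 0) k * minor₃ ![I 1, I 2, I 3] i j l - kron (I 0) l * minor₃ ![I 1, I 2, I 3] i j k

lemma minor₃_eq_phi₀ (i j k : Fin 7) :
    minor₃ ![0, 1, 2] i j k - minor₃ ![0, 5, 6] i j k - minor₃ ![4, 1, 6] i j k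
      - minor₃ ![4, 5, 2] i j k - minor₃ ![3, 0, 4] i j k - minor₃ ![3, 1, 5] i j k
      - minor₃ ![3, 2, 6] i j k = phi₀ i j k := by
  revert i j k; decide +kernel

lemma minor₄_eq_psi₀ (i j k l : Fin 7) :
    minor₄ ![3, 4, 5, 6] i j k l - minor₄ ![3, 4, 1, 2] i j k l - minor₄ ![3, 0, 5, 2] i j k l
      - minor₄ ![3, 0, 1, 6] i j k l - minor₄ ![1, 5, 2, 6] i j k l - minor₄ ![0, 4, 2, 6] i j k l
      - minor₄ ![0, 4, 1, 5] i j k l = psi₀ i j k l := by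
  revert i j k l; decide +kernel

section Wedge

variable {V : Type*} [NormedAddCommGroup V] [InnerProductSpace ℝ V] {n : ℕ}

lemma inner_basis_eq_kron (b : OrthonormalBasis (Fin n) ℝ V) (i j : Fin n) :
    inner ℝ (b i) (b j) = (kron i j : ℝ) := by
  rw [b.inner_eq_ite, kron]; split_ifs <;> simp

lemma wedge_two_basis (b : OrthonormalBasis (Fin n) ℝ V) (I : Fin 2 → Fin n) (i j : Fin n) :
    wedge b I ![b i, b j] = ((kron (I 0) i * kron (I 1) j - kron (I 0) j * kron (I 1) i : ℤ) : ℝ)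
    := by
  simp [wedge, Matrix.det_fin_two, inner_basis_eq_kron]

lemma wedge_three_basis (b : OrthonormalBasis (Fin n) ℝ V) (I : Fin 3 → Fin n) (i j k : Fin n) :
    wedge b I ![b i, b j, b k] = (minor₃ I i j k : ℝ) := by
  simp [wedge, Matrix.det_fin_three, inner_basis_eq_kron, minor₃]
  ring

lemma wedge_four_basis (b : OrthonormalBasis (Fin n) ℝ V) (I : Fin 4 → Fin n) (i j k l : Fin n) :
    wedge b I ![b i, b j, b k, b l] = (minor₄ I i j k l : ℝ) := by
  rw [wedge, Matrix.det_succ_row_zero]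
  simp [Fin.sum_univ_four, Matrix.det_fin_three, inner_basis_eq_kron, minor₄, minor₃,
    Fin.succAbove]
  ring

end Wedge

/-! ### Orthonormal frames and normal fields -/

section Frames

variable {n : ℕ} {M : Type*} [TopologicalSpace M] [ChartedSpace (E n) M]

lemma chartForm_apply {k : ℕ} (e : OpenPartialHomeomorph M (E n))
    (α : ∀ x : M, TangentSpace (𝓡 n) x [⋀^Fin k]→L[ℝ] ℝ) (y : E n) (v : Fin k → E n) :
    chartForm e α y v = α (e.symm y) (fun s => mfderiv (𝓡 n) (𝓡 n) e.symm y (v s)) := rfl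

variable [Bundle.RiemannianBundle (fun x : M => TangentSpace (𝓡 n) x)]

lemma exists_basis_mfderiv_symm [IsManifold (𝓡 n) ∞ M] {e : OpenPartialHomeomorph M (E n)}
    (he : e ∈ atlas (E n) M) {y : E n} (hy : y ∈ e.target)
    (b : OrthonormalBasis (Fin n) ℝ (TangentSpace (𝓡 n) (e.symm y))) :
    ∃ f : Module.Basis (Fin n) ℝ (E n), ∀ i, mfderiv (𝓡 n) (𝓡 n) e.symm y (f i) = b i := by
  let L : E n ≃ₗ[ℝ] TangentSpace (𝓡 n) (e.symm y) :=
    LinearEquiv.ofBijective (mfderiv (𝓡 n) (𝓡 n) e.symm y).toLinearMap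
      (mfderiv_symm_bijective he hy)
  refine ⟨b.toBasis.map L.symm, fun i => ?_⟩
  have : L (L.symm (b i)) = b i := L.apply_symm_apply _
  rw [Module.Basis.map_apply, OrthonormalBasis.coe_toBasis]
  exact this

/-- `f` is a basis of `ℝⁿ` which is orthonormal for the metric `g_y` of the chart `e`. -/
def IsOrthoFrame (e : OpenPartialHomeomorph M (E n)) (y : E n)
    (f : Module.Basis (Fin n) ℝ (E n)) : Prop :=
  ∀ i j, gmet e y (f i) (f j) = (kron i j : ℝ)

lemma IsOrthoFrame.sum_smul {e : OpenPartialHomeomorph M (E n)} {y : E n}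
    {f : Module.Basis (Fin n) ℝ (E n)} (hf : IsOrthoFrame e y f) (a : E n) :
    ∑ p, gmet e y a (f p) • f p = a := by
  conv_rhs => rw [← f.sum_repr a]
  refine Finset.sum_congr rfl fun p _ => ?_
  congr 1
  conv_lhs => rw [← f.sum_repr a]
  simp only [map_sum, map_smul, LinearMap.sum_apply, LinearMap.smul_apply, hf _ _, kron, smul_eq_mul]
  simp

lemma IsOrthoFrame.apply_eq_sum {e : OpenPartialHomeomorph M (E n)} {y : E n}
    {f : Module.Basis (Fin n) ℝ (E n)} (hf : IsOrthoFrame e y f) (α : E n →ₗ[ℝ] ℝ) (a : E n) :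
    α a = ∑ p, gmet e y a (f p) * α (f p) := by
  conv_lhs => rw [← hf.sum_smul a]
  simp

open Matrix in
/-- The contraction of two linear forms with the inverse of the metric, computed in the frame `f`
and in an arbitrary frame `F`. -/
lemma IsOrthoFrame.sum_inv_gram {e : OpenPartialHomeomorph M (E n)} {y : E n}
    {f : Module.Basis (Fin n) ℝ (E n)} (hf : IsOrthoFrame e y f) {F : Fin n → E n}
    (hF : (Matrix.of fun k l => gmet e y (F k) (F l)).det ≠ 0) (α β : E n →ₗ[ℝ] ℝ) :
    ∑ k, ∑ l, (Matrix.of fun k l => gmet e y (F k) (F l))⁻¹ k l * (α (F k) * β (F l)) =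
      ∑ p, α (f p) * β (f p) := by
  set B : Matrix (Fin n) (Fin n) ℝ := Matrix.of fun k p => gmet e y (F k) (f p) with hB
  have hG : (Matrix.of fun k l => gmet e y (F k) (F l)) = B * Bᵀ := by
    ext k l
    rw [Matrix.mul_apply, Matrix.of_apply, hf.apply_eq_sum (gmet e y (F k)) (F l)]
    exact Finset.sum_congr rfl fun p _ => mul_comm _ _
  rw [hG] at hF ⊢
  have hdet : IsUnit B.det := by
    rw [Matrix.det_mul] at hF
    exact isUnit_iff_ne_zero.2 (left_ne_zero_of_mul hF)
  have hone : Bᵀ * (B * Bᵀ)⁻¹ * B = 1 := by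
    rw [Matrix.mul_inv_rev, ← Matrix.mul_assoc, Matrix.mul_nonsing_inv _
      (by rwa [Matrix.det_transpose]), Matrix.one_mul, Matrix.nonsing_inv_mul _ hdet]
  have hα : ∀ (α : E n →ₗ[ℝ] ℝ), (fun k => α (F k)) = B *ᵥ fun p => α (f p) := by
    intro α
    ext k
    exact hf.apply_eq_sum α (F k)
  have h1 : ∑ k, ∑ l, (B * Bᵀ)⁻¹ k l * (α (F k) * β (F l)) =
      (fun k => α (F k)) ⬝ᵥ ((B * Bᵀ)⁻¹ *ᵥ fun l => β (F l)) := by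
    simp only [dotProduct, mulVec, Finset.mul_sum]
    exact Finset.sum_congr rfl fun k _ => Finset.sum_congr rfl fun l _ => by ring
  rw [h1, hα, hα, dotProduct_mulVec, dotProduct_mulVec, vecMul_mulVec, vecMul_vecMul, hone,
    vecMul_one]
  rfl

/-- The affine vector field with value `a` and vanishing covariant derivative at `y₀`. -/
noncomputable def normalField (e : OpenPartialHomeomorph M (E n)) (y₀ a z : E n) : E n :=
  a - Gam e y₀ (z - y₀) a

lemma normalField_self (e : OpenPartialHomeomorph M (E n)) (y₀ a : E n) :
    normalField e y₀ a y₀ = a := by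
  simp [normalField]

lemma hasFDerivAt_normalField (e : OpenPartialHomeomorph M (E n)) (y₀ a z : E n) :
    HasFDerivAt (normalField e y₀ a) (-((Gam e y₀).flip a).toContinuousLinearMap) z := by
  let L : E n →L[ℝ] E n := ((Gam e y₀).flip a).toContinuousLinearMap
  have h1 : HasFDerivAt (fun z => L z - L y₀) L z := L.hasFDerivAt.sub_const _
  have h2 : normalField e y₀ a = fun z => a - (L z - L y₀) := by
    ext1 z
    rw [← map_sub]
    rfl
  rw [h2]
  exact h1.const_sub a

lemma fderiv_normalField (e : OpenPartialHomeomorph M (E n)) (y₀ a u : E n) :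
    fderiv ℝ (normalField e y₀ a) y₀ u = - Gam e y₀ u a := by
  rw [(hasFDerivAt_normalField e y₀ a y₀).fderiv]
  rfl

/-- The derivative at `y` of the value of a form on fields which are normal at `y` is the value of
its covariant derivative. -/
lemma hasFDerivAt_chartForm_normalField {k : ℕ} {e : OpenPartialHomeomorph M (E n)}
    (he : e ∈ atlas (E n) M)
    {α : ∀ x : M, TangentSpace (𝓡 n) x [⋀^Fin k]→L[ℝ] ℝ} (hα : IsSmoothForm α) {y : E n}
    (hy : y ∈ e.target) (v : Fin k → E n) :
    DifferentiableAt ℝ (fun z => chartForm e α z (fun s => normalField e y (v s) z)) y ∧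
    ∀ u, fderiv ℝ (fun z => chartForm e α z (fun s => normalField e y (v s) z)) y u =
      fderiv ℝ (chartForm e α) y u v
        - ∑ s, chartForm e α y (Function.update v s (Gam e y u (v s))) := by
  have hd := differentiableAt_chartForm he hα hy
  have hF : ∀ s, DifferentiableAt ℝ (normalField e y (v s)) y :=
    fun s => (hasFDerivAt_normalField e y (v s) y).differentiableAt
  refine ⟨hd.continuousAlternatingMap_apply hF, fun u => ?_⟩
  rw [fderiv_continuousAlternatingMap_apply_apply hd hF]
  simp only [normalField_self, fderiv_normalField, sub_eq_add_neg, ← Finset.sum_neg_distrib]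
  congr 1
  refine Finset.sum_congr rfl fun s _ => ?_
  have := (chartForm e α y).map_update_smul v s (-1 : ℝ) (Gam e y u (v s))
  simpa using this

lemma hasFDerivAt_chart₃_normalField {e : OpenPartialHomeomorph M (E n)}
    (he : e ∈ atlas (E n) M)
    {α : ∀ x : M, TangentSpace (𝓡 n) x [⋀^Fin 3]→L[ℝ] ℝ} (hα : IsSmoothForm α) {y : E n}
    (hy : y ∈ e.target) (a b c : E n) :
    DifferentiableAt ℝ (fun z => chart₃ e α z (normalField e y a z) (normalField e y b z)
      (normalField e y c z)) y ∧
    ∀ u, fderiv ℝ (fun z => chart₃ e α z (normalField e y a z) (normalField e y b z)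
      (normalField e y c z)) y u = cov₃ e α y u a b c := by
  have h := hasFDerivAt_chartForm_normalField he hα hy ![a, b, c]
  have hfun : (fun z => chart₃ e α z (normalField e y a z) (normalField e y b z)
      (normalField e y c z)) =
      fun z => chartForm e α z (fun s => normalField e y (![a, b, c] s) z) := by
    ext z
    rw [chart₃_apply]
    congr 1
    ext s; fin_cases s <;> rfl
  rw [hfun]
  refine ⟨h.1, fun u => ?_⟩
  rw [h.2, Fin.sum_univ_three, cov₃]
  simp [update_three_zero, update_three_one, update_three_two, chart₃_apply]
  rfl

lemma hasFDerivAt_chart₄_normalField {e : OpenPartialHomeomorph M (E n)}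
    (he : e ∈ atlas (E n) M)
    {α : ∀ x : M, TangentSpace (𝓡 n) x [⋀^Fin 4]→L[ℝ] ℝ} (hα : IsSmoothForm α) {y : E n}
    (hy : y ∈ e.target) (a b c d : E n) :
    DifferentiableAt ℝ (fun z => chart₄ e α z (normalField e y a z) (normalField e y b z)
      (normalField e y c z) (normalField e y d z)) y ∧
    ∀ u, fderiv ℝ (fun z => chart₄ e α z (normalField e y a z) (normalField e y b z)
      (normalField e y c z) (normalField e y d z)) y u = cov₄ e α y u a b c d := by
  have h := hasFDerivAt_chartForm_normalField he hα hy ![a, b, c, d]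
  have hfun : (fun z => chart₄ e α z (normalField e y a z) (normalField e y b z)
      (normalField e y c z) (normalField e y d z)) =
      fun z => chartForm e α z (fun s => normalField e y (![a, b, c, d] s) z) := by
    ext z
    rw [chart₄_apply]
    congr 1
    ext s; fin_cases s <;> rfl
  rw [hfun]
  refine ⟨h.1, fun u => ?_⟩
  rw [h.2, Fin.sum_univ_four, cov₄]
  simp [update_four_zero, update_four_one, update_four_two, update_four_three, chart₄_apply]
  rfl

variable [IsManifold (𝓡 n) ∞ M]
  [IsContMDiffRiemannianBundle (𝓡 n) ∞ (E n) (fun x : M => TangentSpace (𝓡 n) x)]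

/-- The metric is constant to first order along normal fields. -/
lemma hasFDerivAt_gmet_normalField {e : OpenPartialHomeomorph M (E n)}
    (he : e ∈ atlas (E n) M) {y : E n} (hy : y ∈ e.target) (a b : E n) :
    HasFDerivAt (fun z => gmet e z (normalField e y a z) (normalField e y b z))
      (0 : E n →L[ℝ] ℝ) y := by
  have hA : ∀ a i, HasFDerivAt (fun z => normalField e y a z i)
      (-(EuclideanSpace.proj i ∘L ((Gam e y).flip a).toContinuousLinearMap)) y := by
    intro a i
    have := (EuclideanSpace.proj i : E n →L[ℝ] ℝ).hasFDerivAt.comp y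
      (hasFDerivAt_normalField e y a y)
    rw [ContinuousLinearMap.comp_neg] at this
    exact this
  have hg : ∀ i j, HasFDerivAt (fun z => metricComp e z i j)
      (fderiv ℝ (fun z => metricComp e z i j) y) y :=
    fun i j => ((contDiffAt_gmet he _ _ hy).differentiableAt (by simp)).hasFDerivAt
  have h1 := HasFDerivAt.fun_sum (u := Finset.univ) fun i _ =>
    HasFDerivAt.fun_sum (u := Finset.univ) fun j _ =>
      ((hA a i).fun_mul (hA b j)).fun_mul (hg i j)
  have h2 := HasFDerivAt.fun_sum (u := Finset.univ) fun i _ =>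
    HasFDerivAt.fun_sum (u := Finset.univ) fun j _ => (hg i j).const_mul (a i * b j)
  have hfun : (fun z => gmet e z (normalField e y a z) (normalField e y b z)) = fun z =>
      ∑ i, ∑ j, normalField e y a z i * normalField e y b z j * metricComp e z i j :=
    funext fun z => gmet_eq_dotProduct e z _ _
  rw [hfun]
  refine h1.congr_fderiv (ContinuousLinearMap.ext fun u => ?_)
  have h3 := fderiv_gmet he hy u a b
  rw [show (fun z => gmet e z a b) = fun z => ∑ i, ∑ j, a i * b j * metricComp e z i j from
    funext fun z => gmet_eq_dotProduct e z a b, h2.fderiv, gmet_eq_dotProduct,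
    gmet_eq_dotProduct] at h3
  simp only [sum_apply, smul_apply, smul_eq_mul, add_apply, neg_apply, zero_apply,
    ContinuousLinearMap.comp_apply, PiLp.proj_apply, LinearMap.coe_toContinuousLinearMap',
    LinearMap.flip_apply, normalField_self] at h3 ⊢
  rw [← sub_eq_zero, ← Finset.sum_add_distrib, ← Finset.sum_sub_distrib] at h3
  rw [← h3]
  refine Finset.sum_congr rfl fun i _ => ?_
  rw [← Finset.sum_add_distrib, ← Finset.sum_sub_distrib]
  refine Finset.sum_congr rfl fun j _ => ?_
  ring

end Frames

/-! ### The covariant derivative of `ψ` in terms of that of `φ` -/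

lemma sum_phi₀_mul_phi₀ (i j k l : Fin 7) :
    ∑ p, phi₀ i j p * phi₀ k l p = kron i k * kron j l - kron i l * kron j k - psi₀ i j k l := by
  revert i j k l; decide +kernel

section G2Frames

variable {M : Type*} [TopologicalSpace M] [ChartedSpace (E 7) M]
  [Bundle.RiemannianBundle (fun x : M => TangentSpace (𝓡 7) x)]
  {φ : ∀ x : M, TangentSpace (𝓡 7) x [⋀^Fin 3]→L[ℝ] ℝ}
  {ψ : ∀ x : M, TangentSpace (𝓡 7) x [⋀^Fin 4]→L[ℝ] ℝ}

/-- `f` is a basis of `ℝ⁷` which is adapted to the `G₂`-structure in the chart `e` at `y`. -/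
structure IsG2Frame (e : OpenPartialHomeomorph M (E 7))
    (φ : ∀ x : M, TangentSpace (𝓡 7) x [⋀^Fin 3]→L[ℝ] ℝ)
    (ψ : ∀ x : M, TangentSpace (𝓡 7) x [⋀^Fin 4]→L[ℝ] ℝ) (y : E 7)
    (f : Module.Basis (Fin 7) ℝ (E 7)) : Prop where
  ortho : IsOrthoFrame e y f
  phi : ∀ i j k, chart₃ e φ y (f i) (f j) (f k) = (phi₀ i j k : ℝ)
  psi : ∀ i j k l, chart₄ e ψ y (f i) (f j) (f k) (f l) = (psi₀ i j k l : ℝ)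

lemma IsG2Structure.exists_orthonormalBasis (h : IsG2Structure φ ψ) (x : M) :
    ∃ b : OrthonormalBasis (Fin 7) ℝ (TangentSpace (𝓡 7) x),
      (∀ i j k, φ x ![b i, b j, b k] = (phi₀ i j k : ℝ)) ∧
      ∀ i j k l, ψ x ![b i, b j, b k, b l] = (psi₀ i j k l : ℝ) := by
  obtain ⟨b, hφ, hψ⟩ := h.adapted x
  refine ⟨b, fun i j k => ?_, fun i j k l => ?_⟩
  · rw [hφ, ← minor₃_eq_phi₀]
    simp only [wedge_three_basis]
    push_cast
    rfl
  · rw [hψ, ← minor₄_eq_psi₀]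
    simp only [wedge_four_basis]
    push_cast
    rfl

variable [IsManifold (𝓡 7) ∞ M]

lemma IsG2Structure.exists_frame (h : IsG2Structure φ ψ) {e : OpenPartialHomeomorph M (E 7)}
    (he : e ∈ atlas (E 7) M) {y : E 7} (hy : y ∈ e.target) : ∃ f, IsG2Frame e φ ψ y f := by
  obtain ⟨b, hφ, hψ⟩ := h.exists_orthonormalBasis (e.symm y)
  obtain ⟨f, hf⟩ := exists_basis_mfderiv_symm he hy b
  refine ⟨f, fun i j => ?_, fun i j k => ?_, fun i j k l => ?_⟩
  · rw [gmet_apply, hf, hf, inner_basis_eq_kron]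
  · rw [chart₃_apply, chartForm_apply, ← hφ]
    congr 1
    ext s; fin_cases s <;> [exact hf i; exact hf j; exact hf k]
  · rw [chart₄_apply, chartForm_apply, ← hψ]
    congr 1
    ext s; fin_cases s <;> [exact hf i; exact hf j; exact hf k; exact hf l]

omit [IsManifold (𝓡 7) ∞ M] in
/-- The contraction identity for `φ ⊗ φ`. -/
lemma IsG2Frame.sum_phi_mul_phi {e : OpenPartialHomeomorph M (E 7)} {y : E 7}
    {f : Module.Basis (Fin 7) ℝ (E 7)} (hf : IsG2Frame e φ ψ y f) (a b c d : E 7) :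
    ∑ p, chart₃ e φ y a b (f p) * chart₃ e φ y c d (f p) =
      gmet e y a c * gmet e y b d - gmet e y a d * gmet e y b c - chart₄ e ψ y a b c d := by
  rw [← sub_eq_zero]
  refine eq_zero_of_basis f (F := fun a => ∑ p, chart₃ e φ y a b (f p) * chart₃ e φ y c d (f p) -
      (gmet e y a c * gmet e y b d - gmet e y a d * gmet e y b c - chart₄ e ψ y a b c d))
    ⟨fun _ _ => by simp [add_mul, Finset.sum_add_distrib]; ring,
      fun _ _ => by simp [mul_assoc, ← Finset.mul_sum]; ring⟩ (fun i => ?_) a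
  refine eq_zero_of_basis f (F := fun b => ∑ p, chart₃ e φ y _ b (f p) * chart₃ e φ y c d (f p) -
      (gmet e y _ c * gmet e y b d - gmet e y _ d * gmet e y b c - chart₄ e ψ y _ b c d))
    ⟨fun _ _ => by simp [add_mul, Finset.sum_add_distrib]; ring,
      fun _ _ => by simp [mul_assoc, ← Finset.mul_sum]; ring⟩ (fun j => ?_) b
  refine eq_zero_of_basis f (F := fun c => ∑ p, chart₃ e φ y _ _ (f p) * chart₃ e φ y c d (f p) -
      (gmet e y _ c * gmet e y _ d - gmet e y _ d * gmet e y _ c - chart₄ e ψ y _ _ c d))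
    ⟨fun _ _ => by simp [mul_add, Finset.sum_add_distrib]; ring,
      fun _ _ => by simp [mul_left_comm, ← Finset.mul_sum]; ring⟩ (fun k => ?_) c
  refine eq_zero_of_basis f (F := fun d => ∑ p, chart₃ e φ y _ _ (f p) * chart₃ e φ y _ d (f p) -
      (gmet e y _ _ * gmet e y _ d - gmet e y _ d * gmet e y _ _ - chart₄ e ψ y _ _ _ d))
    ⟨fun _ _ => by simp [mul_add, Finset.sum_add_distrib]; ring,
      fun _ _ => by simp [mul_left_comm, ← Finset.mul_sum]; ring⟩ (fun l => ?_) d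
  simp only [hf.phi, hf.psi, hf.ortho _ _]
  rw [sub_eq_zero]
  exact_mod_cast sum_phi₀_mul_phi₀ i j k l

variable [IsContMDiffRiemannianBundle (𝓡 7) ∞ (E 7) (fun x : M => TangentSpace (𝓡 7) x)]

/-- The covariant derivative of `ψ = ⋆φ` is determined by that of `φ`, through the contraction
identity for `φ ⊗ φ`, which is differentiated here along normal fields. -/
theorem IsG2Structure.cov_psi (h : IsG2Structure φ ψ) {e : OpenPartialHomeomorph M (E 7)}
    (he : e ∈ atlas (E 7) M) {y : E 7} (hy : y ∈ e.target) {f : Module.Basis (Fin 7) ℝ (E 7)}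
    (hf : IsG2Frame e φ ψ y f) (u : E 7) (i j k l : Fin 7) :
    ∑ p, (cov₃ e φ y u (f i) (f j) (f p) * phi₀ k l p
      + phi₀ i j p * cov₃ e φ y u (f k) (f l) (f p)) =
      - cov₄ e ψ y u (f i) (f j) (f k) (f l) := by
  set F : Fin 7 → E 7 → E 7 := fun i => normalField e y (f i) with hF
  have hFy : ∀ i, F i y = f i := fun i => normalField_self e y (f i)
  set G : E 7 → Matrix (Fin 7) (Fin 7) ℝ := fun z =>
    Matrix.of fun k l => gmet e z (F k z) (F l z) with hG
  have hGd : ∀ k l, HasFDerivAt (fun z => G z k l) (0 : E 7 →L[ℝ] ℝ) y := fun k l =>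
    hasFDerivAt_gmet_normalField he hy (f k) (f l)
  have hGy : G y = 1 := by
    ext k l
    simp only [hG, Matrix.of_apply, hFy, hf.ortho k l, kron, Matrix.one_apply]
    split_ifs <;> simp
  have hdet : (G y).det ≠ 0 := by rw [hGy]; simp
  have hHd : ∀ k l, DifferentiableAt ℝ (fun z => (G z)⁻¹ k l) y :=
    differentiableAt_matrix_inv (fun k l => (hGd k l).differentiableAt) hdet
  have hdetn : ∀ᶠ z in nhds y, (G z).det ≠ 0 :=
    (differentiableAt_det fun k l => (hGd k l).differentiableAt).continuousAt.eventually_ne hdet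
  -- The Gram matrix of the normal fields is constant to first order, hence so is its inverse.
  have hHd0 : ∀ k l, HasFDerivAt (fun z => (G z)⁻¹ k l) (0 : E 7 →L[ℝ] ℝ) y := by
    intro k l
    have h1 := HasFDerivAt.fun_sum (u := Finset.univ) fun m _ =>
      (hGd k m).fun_mul (hHd m l).hasFDerivAt
    have h2 : (fun z => ∑ m, G z k m * (G z)⁻¹ m l) =ᶠ[nhds y]
        fun _ => (1 : Matrix (Fin 7) (Fin 7) ℝ) k l := by
      filter_upwards [hdetn] with z hz
      rw [← Matrix.mul_nonsing_inv (G z) (isUnit_iff_ne_zero.2 hz), Matrix.mul_apply]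
    have h3 := (h1.congr_of_eventuallyEq h2.symm).unique (hasFDerivAt_const _ _)
    simp only [hGy, Matrix.one_apply, smul_zero, add_zero, ite_smul, one_smul, zero_smul,
      Finset.sum_ite_eq, Finset.mem_univ, if_true] at h3
    rw [← h3]
    exact (hHd k l).hasFDerivAt
  have hP := fun i j k => hasFDerivAt_chart₃_normalField he h.smooth_φ hy (f i) (f j) (f k)
  have hQ := hasFDerivAt_chart₄_normalField he h.smooth_ψ hy (f i) (f j) (f k) (f l)
  have hident : (fun z => ∑ p, ∑ q, (G z)⁻¹ p q * (chart₃ e φ z (F i z) (F j z) (F p z)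
      * chart₃ e φ z (F k z) (F l z) (F q z))) =ᶠ[nhds y]
      fun z => G z i k * G z j l - G z i l * G z j k
        - chart₄ e ψ z (F i z) (F j z) (F k z) (F l z) := by
    filter_upwards [hdetn, e.open_target.mem_nhds hy] with z hz hze
    obtain ⟨f', hf'⟩ := h.exists_frame he hze
    rw [hf'.ortho.sum_inv_gram hz, hf'.sum_phi_mul_phi]
    rfl
  have hl := HasFDerivAt.fun_sum (u := Finset.univ) fun p _ =>
    HasFDerivAt.fun_sum (u := Finset.univ) fun q _ => (hHd0 p q).fun_mul
      ((hP i j p).1.hasFDerivAt.fun_mul (hP k l q).1.hasFDerivAt)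
  have hr := (((hGd i k).fun_mul (hGd j l)).fun_sub ((hGd i l).fun_mul (hGd j k))).fun_sub
    hQ.1.hasFDerivAt
  have heq := (hl.congr_of_eventuallyEq hident.symm).unique hr
  have := congrArg (fun L : E 7 →L[ℝ] ℝ => L u) heq
  simp only [sum_apply, add_apply, smul_apply, smul_eq_mul, sub_apply, zero_apply, (hP _ _ _).2 u,
    hQ.2 u, hGy, inv_one, mul_zero, add_zero, sub_self, zero_sub, Matrix.one_apply, ite_mul, one_mul,
    zero_mul, Finset.sum_ite_eq, Finset.mem_univ, if_true, normalField_self, hf.phi] at this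
  rw [← this]
  exact Finset.sum_congr rfl fun p _ => by ring

end G2Frames

/-! ### The torsion of a `G₂`-structure -/

section Algebra

lemma forall_sorted_three {P : Fin 7 → Fin 7 → Fin 7 → Prop}
    (h012 : P 0 1 2) (h013 : P 0 1 3) (h014 : P 0 1 4) (h015 : P 0 1 5) (h016 : P 0 1 6)
    (h023 : P 0 2 3) (h024 : P 0 2 4) (h025 : P 0 2 5) (h026 : P 0 2 6) (h034 : P 0 3 4)
    (h035 : P 0 3 5) (h036 : P 0 3 6) (h045 : P 0 4 5) (h046 : P 0 4 6) (h056 : P 0 5 6)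
    (h123 : P 1 2 3) (h124 : P 1 2 4) (h125 : P 1 2 5) (h126 : P 1 2 6) (h134 : P 1 3 4)
    (h135 : P 1 3 5) (h136 : P 1 3 6) (h145 : P 1 4 5) (h146 : P 1 4 6) (h156 : P 1 5 6)
    (h234 : P 2 3 4) (h235 : P 2 3 5) (h236 : P 2 3 6) (h245 : P 2 4 5) (h246 : P 2 4 6)
    (h256 : P 2 5 6) (h345 : P 3 4 5) (h346 : P 3 4 6) (h356 : P 3 5 6) (h456 : P 4 5 6)
    (i j k : Fin 7) (hij : i < j) (hjk : j < k) : P i j k := by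
  fin_cases i <;> fin_cases j <;> first
    | exact absurd hij (by decide)
    | (fin_cases k <;> first | exact absurd hjk (by decide) | assumption)

/-- Two alternating functions of three indices agree if they agree on increasing indices. -/
lemma alternating_three_ext {n : ℕ} {p q : Fin n → Fin n → Fin n → ℝ}
    (hp₁ : ∀ a b c, p a b c = - p b a c) (hp₂ : ∀ a b c, p a b c = - p a c b)
    (hq₁ : ∀ a b c, q a b c = - q b a c) (hq₂ : ∀ a b c, q a b c = - q a c b)
    (h : ∀ a b c, a < b → b < c → p a b c = q a b c) (a b c : Fin n) : p a b c = q a b c := by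
  have hp0 : ∀ a c, p a a c = 0 := fun a c => by linarith [hp₁ a a c]
  have hq0 : ∀ a c, q a a c = 0 := fun a c => by linarith [hq₁ a a c]
  have hp0' : ∀ a c, p a c c = 0 := fun a c => by linarith [hp₂ a c c]
  have hq0' : ∀ a c, q a c c = 0 := fun a c => by linarith [hq₂ a c c]
  rcases lt_trichotomy a b with h1 | rfl | h1
  · rcases lt_trichotomy b c with h2 | rfl | h2
    · exact h a b c h1 h2
    · rw [hp0', hq0']
    · rcases lt_trichotomy a c with h3 | rfl | h3
      · rw [hp₂, hq₂, h a c b h3 h2]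
      · rw [hp₂, hq₂, hp0, hq0]
      · rw [hp₂, hq₂, hp₁, hq₁, h c a b h3 h1]
  · rw [hp0, hq0]
  · rcases lt_trichotomy b c with h2 | rfl | h2
    · rcases lt_trichotomy a c with h3 | rfl | h3
      · rw [hp₁, hq₁, h b a c h1 h3]
      · rw [hp₁, hq₁, hp0', hq0']
      · rw [hp₁, hq₁, hp₂, hq₂, h b c a h2 h3]
    · rw [hp0', hq0']
    · rw [hp₁, hq₁, hp₂, hq₂, hp₁ b c a, hq₁ b c a, h c b a h2 h1]

lemma psi₀_antisymm₁ (n i j k : Fin 7) : psi₀ n i j k = - psi₀ n j i k := by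
  revert n i j k; decide +kernel

lemma psi₀_antisymm₂ (n i j k : Fin 7) : psi₀ n i j k = - psi₀ n i k j := by
  revert n i j k; decide +kernel

set_option linter.unusedSimpArgs false in
/-- The derivatives of `φ` compatible with the metric are the contractions of `ψ` with a vector. The
hypothesis `h` says that the derivative of `g(eₐ × e_b, e_c × e_b)` is that of the metric side of
the contraction identity of `φ`. -/
lemma exists_contraction_psi {p : Fin 7 → Fin 7 → Fin 7 → ℝ}
    (hp₁ : ∀ a b c, p a b c = - p b a c) (hp₂ : ∀ a b c, p a b c = - p a c b)
    (h : ∀ a b c, fanoSgn c b * p a b (fanoMul c b) + fanoSgn a b * p c b (fanoMul a b) = 0) :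
    ∃ T : Fin 7 → ℝ, ∀ a b c, p a b c = ∑ n, T n * psi₀ n a b c := by
  have s₁ : ∀ a b c, b < a → p a b c = - p b a c := fun a b c _ => hp₁ a b c
  have s₂ : ∀ a b c, c < b → p a b c = - p a c b := fun a b c _ => hp₂ a b c
  have z₁ : ∀ a c, p a a c = 0 := fun a c => by linarith [hp₁ a a c]
  have z₂ : ∀ a c, p a c c = 0 := fun a c => by linarith [hp₂ a c c]
  -- For each `n` there is an increasing triple `a, b, c` with `psi₀ n a b c = ± 1`; as
  -- `psi₀ m a b c` vanishes for `m ≠ n`, the component `T n` can be read off from `p a b c`.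
  let T : Fin 7 → ℝ := ![-p 1 3 6, p 0 3 6, -p 0 3 5, -p 0 1 6, p 0 1 5, -p 0 1 4, p 0 1 3]
  refine ⟨T, alternating_three_ext (q := fun a b c => ∑ n, T n * psi₀ n a b c) hp₁ hp₂
    (fun a b c => ?_) (fun a b c => ?_) ?_⟩
  · simp only [psi₀_antisymm₁ _ a b c, Int.cast_neg, mul_neg, Finset.sum_neg_distrib]
  · simp only [psi₀_antisymm₂ _ a b c, Int.cast_neg, mul_neg, Finset.sum_neg_distrib]
  -- On every other increasing triple a single instance of `h` shows that `p` vanishes, or that it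
  -- agrees with one of these components up to sign.
  apply forall_sorted_three
  · have e := h 0 1 0
    simp [fanoMul, fanoSgn, s₁, s₂, z₁, z₂] at e
    simp [T, Fin.sum_univ_seven, psi₀, kron, fanoMul, fanoSgn]
    linarith
  · simp [T, Fin.sum_univ_seven, psi₀, kron, fanoMul, fanoSgn]
  · simp [T, Fin.sum_univ_seven, psi₀, kron, fanoMul, fanoSgn]
  · simp [T, Fin.sum_univ_seven, psi₀, kron, fanoMul, fanoSgn]
  · simp [T, Fin.sum_univ_seven, psi₀, kron, fanoMul, fanoSgn]
  · have e := h 1 0 3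
    simp [fanoMul, fanoSgn, s₁, s₂, z₁, z₂] at e
    simp [T, Fin.sum_univ_seven, psi₀, kron, fanoMul, fanoSgn]
    linarith
  · have e := h 1 0 4
    simp [fanoMul, fanoSgn, s₁, s₂, z₁, z₂] at e
    simp [T, Fin.sum_univ_seven, psi₀, kron, fanoMul, fanoSgn]
    linarith
  · have e := h 1 0 5
    simp [fanoMul, fanoSgn, s₁, s₂, z₁, z₂] at e
    simp [T, Fin.sum_univ_seven, psi₀, kron, fanoMul, fanoSgn]
    linarith
  · have e := h 1 0 6
    simp [fanoMul, fanoSgn, s₁, s₂, z₁, z₂] at e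
    simp [T, Fin.sum_univ_seven, psi₀, kron, fanoMul, fanoSgn]
    linarith
  · have e := h 0 3 0
    simp [fanoMul, fanoSgn, s₁, s₂, z₁, z₂] at e
    simp [T, Fin.sum_univ_seven, psi₀, kron, fanoMul, fanoSgn]
    linarith
  · simp [T, Fin.sum_univ_seven, psi₀, kron, fanoMul, fanoSgn]
  · simp [T, Fin.sum_univ_seven, psi₀, kron, fanoMul, fanoSgn]
  · have e := h 3 0 5
    simp [fanoMul, fanoSgn, s₁, s₂, z₁, z₂] at e
    simp [T, Fin.sum_univ_seven, psi₀, kron, fanoMul, fanoSgn]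
    linarith
  · have e := h 3 0 6
    simp [fanoMul, fanoSgn, s₁, s₂, z₁, z₂] at e
    simp [T, Fin.sum_univ_seven, psi₀, kron, fanoMul, fanoSgn]
    linarith
  · have e := h 0 5 0
    simp [fanoMul, fanoSgn, s₁, s₂, z₁, z₂] at e
    simp [T, Fin.sum_univ_seven, psi₀, kron, fanoMul, fanoSgn]
    linarith
  · have e := h 0 1 3
    simp [fanoMul, fanoSgn, s₁, s₂, z₁, z₂] at e
    simp [T, Fin.sum_univ_seven, psi₀, kron, fanoMul, fanoSgn]
    linarith
  · have e := h 0 1 4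
    simp [fanoMul, fanoSgn, s₁, s₂, z₁, z₂] at e
    simp [T, Fin.sum_univ_seven, psi₀, kron, fanoMul, fanoSgn]
    linarith
  · have e := h 0 1 5
    simp [fanoMul, fanoSgn, s₁, s₂, z₁, z₂] at e
    simp [T, Fin.sum_univ_seven, psi₀, kron, fanoMul, fanoSgn]
    linarith
  · have e := h 0 1 6
    simp [fanoMul, fanoSgn, s₁, s₂, z₁, z₂] at e
    simp [T, Fin.sum_univ_seven, psi₀, kron, fanoMul, fanoSgn]
    linarith
  · have e := h 0 3 1
    simp [fanoMul, fanoSgn, s₁, s₂, z₁, z₂] at e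
    simp [T, Fin.sum_univ_seven, psi₀, kron, fanoMul, fanoSgn]
    linarith
  · have e := h 1 3 1
    simp [fanoMul, fanoSgn, s₁, s₂, z₁, z₂] at e
    simp [T, Fin.sum_univ_seven, psi₀, kron, fanoMul, fanoSgn]
    linarith
  · simp [T, Fin.sum_univ_seven, psi₀, kron, fanoMul, fanoSgn]
  · have e := h 3 1 4
    simp [fanoMul, fanoSgn, s₁, s₂, z₁, z₂] at e
    simp [T, Fin.sum_univ_seven, psi₀, kron, fanoMul, fanoSgn]
    linarith
  · have e := h 1 4 1
    simp [fanoMul, fanoSgn, s₁, s₂, z₁, z₂] at e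
    simp [T, Fin.sum_univ_seven, psi₀, kron, fanoMul, fanoSgn]
    linarith
  · have e := h 0 5 1
    simp [fanoMul, fanoSgn, s₁, s₂, z₁, z₂] at e
    simp [T, Fin.sum_univ_seven, psi₀, kron, fanoMul, fanoSgn]
    linarith
  · have e := h 0 3 2
    simp [fanoMul, fanoSgn, s₁, s₂, z₁, z₂] at e
    simp [T, Fin.sum_univ_seven, psi₀, kron, fanoMul, fanoSgn]
    linarith
  · have e := h 1 3 2
    simp [fanoMul, fanoSgn, s₁, s₂, z₁, z₂] at e
    simp [T, Fin.sum_univ_seven, psi₀, kron, fanoMul, fanoSgn]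
    linarith
  · have e := h 2 3 2
    simp [fanoMul, fanoSgn, s₁, s₂, z₁, z₂] at e
    simp [T, Fin.sum_univ_seven, psi₀, kron, fanoMul, fanoSgn]
    linarith
  · have e := h 2 4 2
    simp [fanoMul, fanoSgn, s₁, s₂, z₁, z₂] at e
    simp [T, Fin.sum_univ_seven, psi₀, kron, fanoMul, fanoSgn]
    linarith
  · have e := h 1 6 2
    simp [fanoMul, fanoSgn, s₁, s₂, z₁, z₂] at e
    simp [T, Fin.sum_univ_seven, psi₀, kron, fanoMul, fanoSgn]
    linarith
  · have e := h 0 6 2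
    simp [fanoMul, fanoSgn, s₁, s₂, z₁, z₂] at e
    simp [T, Fin.sum_univ_seven, psi₀, kron, fanoMul, fanoSgn]
    linarith
  · have e := h 0 3 5
    simp [fanoMul, fanoSgn, s₁, s₂, z₁, z₂] at e
    simp [T, Fin.sum_univ_seven, psi₀, kron, fanoMul, fanoSgn]
    linarith
  · have e := h 0 4 6
    simp [fanoMul, fanoSgn, s₁, s₂, z₁, z₂] at e
    simp [T, Fin.sum_univ_seven, psi₀, kron, fanoMul, fanoSgn]
    linarith
  · have e := h 0 5 3
    simp [fanoMul, fanoSgn, s₁, s₂, z₁, z₂] at e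
    simp [T, Fin.sum_univ_seven, psi₀, kron, fanoMul, fanoSgn]
    linarith
  · have e := h 0 6 4
    simp [fanoMul, fanoSgn, s₁, s₂, z₁, z₂] at e
    simp [T, Fin.sum_univ_seven, psi₀, kron, fanoMul, fanoSgn]
    linarith

end Algebra

section Torsion

/-- The contraction of `φ` with `ψ`, which turns `∇φ = T ⌟ ψ` into the formula `∇ψ = - T ∧ φ`. -/
lemma contract_phi₀_psi₀ (n a b c d : Fin 7) :
    fanoSgn c d * psi₀ n a b (fanoMul c d) + fanoSgn a b * psi₀ n c d (fanoMul a b) =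
      kron n a * phi₀ b c d - kron n b * phi₀ a c d + kron n c * phi₀ a b d
        - kron n d * phi₀ a b c := by
  revert n a b c d; decide +kernel

lemma fin_seven_cases {P : Fin 7 → Prop} (h : P 0 ∧ P 1 ∧ P 2 ∧ P 3 ∧ P 4 ∧ P 5 ∧ P 6) (i : Fin 7) :
    P i := by
  obtain ⟨h0, h1, h2, h3, h4, h5, h6⟩ := h
  fin_cases i <;> assumption

set_option maxHeartbeats 1000000 in
set_option linter.unusedSimpArgs false in
/-- The equations `dφ = τ ψ` and `dψ = 0` force the torsion `T`, where `∇ₘφ = ∑ₙ Tₘₙ eₙ ⌟ ψ`, to be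
the multiple `τ / 4` of the identity. The linear system decouples: one block for the diagonal
entries of `T`, and one for the entries `Tₘₙ` with `eₘ × eₙ = ± eₚ`, for each `p`. In `h₅` the
function `X` stands for the components of `- ∇ψ`. -/
lemma torsion_eq {T : Fin 7 → Fin 7 → ℝ} {τ : ℝ}
    (h₄ : ∀ a b c d, ∑ n, (T a n * psi₀ n b c d - T b n * psi₀ n a c d + T c n * psi₀ n a b d
      - T d n * psi₀ n a b c) = τ * psi₀ a b c d)
    (h₅ : ∀ {X : Fin 7 → Fin 7 → Fin 7 → Fin 7 → Fin 7 → ℝ},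
      (∀ m a b c d, X m a b c d = T m a * phi₀ b c d - T m b * phi₀ a c d + T m c * phi₀ a b d
        - T m d * phi₀ a b c) →
      ∀ m a b c d, X m a b c d - X a m b c d + X b m a c d - X c m a b d + X d m a b c = 0)
    (m n : Fin 7) : T m n = τ / 4 * kron m n := by
  replace h₅ := h₅ (fun _ _ _ _ _ => rfl)
  have hd : T 0 0 = τ / 4 ∧ T 1 1 = τ / 4 ∧ T 2 2 = τ / 4 ∧ T 3 3 = τ / 4 ∧ T 4 4 = τ / 4 ∧
      T 5 5 = τ / 4 ∧ T 6 6 = τ / 4 := by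
    have e0 := h₄ 0 1 3 6
    have e1 := h₄ 0 1 4 5
    have e2 := h₄ 0 2 3 5
    have e3 := h₄ 0 2 4 6
    have e4 := h₄ 1 2 3 4
    have e5 := h₄ 1 2 5 6
    have e6 := h₄ 3 4 5 6
    simp [Fin.sum_univ_seven, psi₀, phi₀, kron, fanoMul, fanoSgn] at e0 e1 e2 e3 e4 e5 e6
    refine ⟨?_, ?_, ?_, ?_, ?_, ?_, ?_⟩ <;> linarith
  have h0 : T 1 2 = 0 ∧ T 2 1 = 0 ∧ T 3 4 = 0 ∧ T 4 3 = 0 ∧ T 5 6 = 0 ∧ T 6 5 = 0 := by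
    have e0 := h₄ 0 1 3 5
    have e1 := h₄ 0 1 4 6
    have e2 := h₄ 0 2 3 6
    have e3 := h₄ 0 2 4 5
    have e4 := h₅ 0 1 2 3 4
    have e5 := h₅ 0 1 2 5 6
    have e6 := h₅ 0 3 4 5 6
    simp [Fin.sum_univ_seven, psi₀, phi₀, kron, fanoMul, fanoSgn] at e0 e1 e2 e3 e4 e5 e6
    refine ⟨?_, ?_, ?_, ?_, ?_, ?_⟩ <;> linarith
  have h1 : T 0 2 = 0 ∧ T 2 0 = 0 ∧ T 3 5 = 0 ∧ T 4 6 = 0 ∧ T 5 3 = 0 ∧ T 6 4 = 0 := by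
    have e0 := h₄ 0 1 3 4
    have e1 := h₄ 0 1 5 6
    have e2 := h₄ 1 2 3 6
    have e3 := h₄ 1 2 4 5
    have e4 := h₅ 0 1 2 3 5
    have e5 := h₅ 0 1 2 4 6
    have e6 := h₅ 1 3 4 5 6
    simp [Fin.sum_univ_seven, psi₀, phi₀, kron, fanoMul, fanoSgn] at e0 e1 e2 e3 e4 e5 e6
    refine ⟨?_, ?_, ?_, ?_, ?_, ?_⟩ <;> linarith
  have h2 : T 0 1 = 0 ∧ T 1 0 = 0 ∧ T 3 6 = 0 ∧ T 4 5 = 0 ∧ T 5 4 = 0 ∧ T 6 3 = 0 := by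
    have e0 := h₄ 0 2 3 4
    have e1 := h₄ 0 2 5 6
    have e2 := h₄ 1 2 3 5
    have e3 := h₄ 1 2 4 6
    have e4 := h₅ 0 1 2 3 6
    have e5 := h₅ 0 1 2 4 5
    have e6 := h₅ 2 3 4 5 6
    simp [Fin.sum_univ_seven, psi₀, phi₀, kron, fanoMul, fanoSgn] at e0 e1 e2 e3 e4 e5 e6
    refine ⟨?_, ?_, ?_, ?_, ?_, ?_⟩ <;> linarith
  have h3 : T 0 4 = 0 ∧ T 1 5 = 0 ∧ T 2 6 = 0 ∧ T 4 0 = 0 ∧ T 5 1 = 0 ∧ T 6 2 = 0 := by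
    have e0 := h₄ 0 1 2 3
    have e1 := h₄ 0 3 5 6
    have e2 := h₄ 1 3 4 6
    have e3 := h₄ 2 3 4 5
    have e4 := h₅ 0 1 3 4 5
    have e5 := h₅ 0 2 3 4 6
    have e6 := h₅ 1 2 3 5 6
    simp [Fin.sum_univ_seven, psi₀, phi₀, kron, fanoMul, fanoSgn] at e0 e1 e2 e3 e4 e5 e6
    refine ⟨?_, ?_, ?_, ?_, ?_, ?_⟩ <;> linarith
  have h4 : T 0 3 = 0 ∧ T 1 6 = 0 ∧ T 2 5 = 0 ∧ T 3 0 = 0 ∧ T 5 2 = 0 ∧ T 6 1 = 0 := by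
    have e0 := h₄ 0 1 2 4
    have e1 := h₄ 0 4 5 6
    have e2 := h₄ 1 3 4 5
    have e3 := h₄ 2 3 4 6
    have e4 := h₅ 0 1 3 4 6
    have e5 := h₅ 0 2 3 4 5
    have e6 := h₅ 1 2 4 5 6
    simp [Fin.sum_univ_seven, psi₀, phi₀, kron, fanoMul, fanoSgn] at e0 e1 e2 e3 e4 e5 e6
    refine ⟨?_, ?_, ?_, ?_, ?_, ?_⟩ <;> linarith
  have h5 : T 0 6 = 0 ∧ T 1 3 = 0 ∧ T 2 4 = 0 ∧ T 3 1 = 0 ∧ T 4 2 = 0 ∧ T 6 0 = 0 := by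
    have e0 := h₄ 0 1 2 5
    have e1 := h₄ 0 3 4 5
    have e2 := h₄ 1 4 5 6
    have e3 := h₄ 2 3 5 6
    have e4 := h₅ 0 1 3 5 6
    have e5 := h₅ 0 2 4 5 6
    have e6 := h₅ 1 2 3 4 5
    simp [Fin.sum_univ_seven, psi₀, phi₀, kron, fanoMul, fanoSgn] at e0 e1 e2 e3 e4 e5 e6
    refine ⟨?_, ?_, ?_, ?_, ?_, ?_⟩ <;> linarith
  have h6 : T 0 5 = 0 ∧ T 1 4 = 0 ∧ T 2 3 = 0 ∧ T 3 2 = 0 ∧ T 4 1 = 0 ∧ T 5 0 = 0 := by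
    have e0 := h₄ 0 1 2 6
    have e1 := h₄ 0 3 4 6
    have e2 := h₄ 1 3 5 6
    have e3 := h₄ 2 4 5 6
    have e4 := h₅ 0 1 4 5 6
    have e5 := h₅ 0 2 3 5 6
    have e6 := h₅ 1 2 3 4 6
    simp [Fin.sum_univ_seven, psi₀, phi₀, kron, fanoMul, fanoSgn] at e0 e1 e2 e3 e4 e5 e6
    refine ⟨?_, ?_, ?_, ?_, ?_, ?_⟩ <;> linarith
  revert m n
  refine fin_seven_cases ⟨?_, ?_, ?_, ?_, ?_, ?_, ?_⟩ <;>
    refine fin_seven_cases ⟨?_, ?_, ?_, ?_, ?_, ?_, ?_⟩ <;>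
    simp [kron, hd, h0, h1, h2, h3, h4, h5, h6]

end Torsion

/-! ### The exterior derivative as alternated covariant derivative -/

section Alternating

variable {V : Type*} [AddCommGroup V] [Module ℝ V]

lemma cur₂_swap (α : V [⋀^Fin 2]→ₗ[ℝ] ℝ) (a b : V) : cur₂ α a b = - cur₂ α b a := by
  have := α.map_swap ![b, a] (i := 0) (j := 1) (by decide)
  rwa [show ![b, a] ∘ Equiv.swap (0 : Fin 2) 1 = ![a, b] from by ext i; fin_cases i <;> rfl]
    at this

lemma cur₃_swap₁ (α : V [⋀^Fin 3]→ₗ[ℝ] ℝ) (a b c : V) : cur₃ α a b c = - cur₃ α b a c := by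
  have := α.map_swap ![b, a, c] (i := 0) (j := 1) (by decide)
  rwa [show ![b, a, c] ∘ Equiv.swap (0 : Fin 3) 1 = ![a, b, c] from by ext i; fin_cases i <;> rfl]
    at this

lemma cur₃_swap₂ (α : V [⋀^Fin 3]→ₗ[ℝ] ℝ) (a b c : V) : cur₃ α a b c = - cur₃ α a c b :=
  cur₂_swap (α.curryLeft a) b c

lemma cur₄_swap₁ (α : V [⋀^Fin 4]→ₗ[ℝ] ℝ) (a b c d : V) :
    cur₄ α a b c d = - cur₄ α b a c d := by
  have := α.map_swap ![b, a, c, d] (i := 0) (j := 1) (by decide)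
  rwa [show ![b, a, c, d] ∘ Equiv.swap (0 : Fin 4) 1 = ![a, b, c, d] from by
    ext i; fin_cases i <;> rfl] at this

lemma cur₄_swap₂ (α : V [⋀^Fin 4]→ₗ[ℝ] ℝ) (a b c d : V) :
    cur₄ α a b c d = - cur₄ α a c b d :=
  cur₃_swap₁ (α.curryLeft a) b c d

lemma cur₄_swap₃ (α : V [⋀^Fin 4]→ₗ[ℝ] ℝ) (a b c d : V) :
    cur₄ α a b c d = - cur₄ α a b d c :=
  cur₃_swap₂ (α.curryLeft a) b c d

end Alternating

section Exterior

variable {n : ℕ} {M : Type*} [TopologicalSpace M] [ChartedSpace (E n) M]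
  [Bundle.RiemannianBundle (fun x : M => TangentSpace (𝓡 n) x)]

lemma cov₃_swap₁ (e : OpenPartialHomeomorph M (E n))
    (α : ∀ x : M, TangentSpace (𝓡 n) x [⋀^Fin 3]→L[ℝ] ℝ) (y u a b c : E n) :
    cov₃ e α y u a b c = - cov₃ e α y u b a c := by
  have h1 := cur₃_swap₁ (chartForm e α y).toAlternatingMap
  have h2 := cur₃_swap₁ (fderiv ℝ (chartForm e α) y u).toAlternatingMap a b c
  have h3 : dchart₃ e α y u a b c = - dchart₃ e α y u b a c := h2
  simp only [cov₃, chart₃, h3]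
  rw [h1 (Gam e y u a), h1 a (Gam e y u b), h1 a b]
  ring

lemma cov₃_swap₂ (e : OpenPartialHomeomorph M (E n))
    (α : ∀ x : M, TangentSpace (𝓡 n) x [⋀^Fin 3]→L[ℝ] ℝ) (y u a b c : E n) :
    cov₃ e α y u a b c = - cov₃ e α y u a c b := by
  have h1 := cur₃_swap₂ (chartForm e α y).toAlternatingMap
  have h2 := cur₃_swap₂ (fderiv ℝ (chartForm e α) y u).toAlternatingMap a b c
  have h3 : dchart₃ e α y u a b c = - dchart₃ e α y u a c b := h2
  simp only [cov₃, chart₃, h3]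
  rw [h1 (Gam e y u a), h1 a (Gam e y u b), h1 a b]
  ring

lemma cov₄_self (e : OpenPartialHomeomorph M (E n))
    (α : ∀ x : M, TangentSpace (𝓡 n) x [⋀^Fin 4]→L[ℝ] ℝ) (y u a b c : E n) :
    cov₄ e α y u a b c b = 0 := by
  have h1 := cur₄_swap₂ (chartForm e α y).toAlternatingMap
  have h4 := cur₄_swap₃ (chartForm e α y).toAlternatingMap
  have h2 := cur₄_swap₂ (fderiv ℝ (chartForm e α) y u).toAlternatingMap a
  have h5 := cur₄_swap₃ (fderiv ℝ (chartForm e α) y u).toAlternatingMap a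
  have h3 : dchart₄ e α y u a b c b = - dchart₄ e α y u a b c b := by
    have : dchart₄ e α y u a b c b = - dchart₄ e α y u a c b b := h2 b c b
    have h6 : dchart₄ e α y u a c b b = - dchart₄ e α y u a c b b := h5 c b b
    have h7 : dchart₄ e α y u a b c b = - dchart₄ e α y u a b b c := h5 b c b
    have h8 : dchart₄ e α y u a b b c = - dchart₄ e α y u a b b c := h2 b b c
    linarith
  simp only [cov₄, chart₄] at h3 ⊢
  have e1 := h4 (Gam e y u a) b c b
  have e2 := h1 (Gam e y u a) b b c
  have e3 := h1 a (Gam e y u b) c b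
  have e4 := h4 a c (Gam e y u b) b
  have e5 := h1 a c b (Gam e y u b)
  have e6 := h4 a b (Gam e y u c) b
  have e7 := h1 a b b (Gam e y u c)
  linarith

/-- The exterior derivative of a `3`-form is the alternation of its covariant derivative, since the
connection is symmetric. -/
lemma extDeriv_three (e : OpenPartialHomeomorph M (E n))
    (α : ∀ x : M, TangentSpace (𝓡 n) x [⋀^Fin 3]→L[ℝ] ℝ) (y a b c d : E n) :
    extDeriv (chartForm e α) y ![a, b, c, d] = cov₃ e α y a b c d - cov₃ e α y b a c d
      + cov₃ e α y c a b d - cov₃ e α y d a b c := by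
  have h0 : extDeriv (chartForm e α) y ![a, b, c, d] = dchart₃ e α y a b c d
      - dchart₃ e α y b a c d + dchart₃ e α y c a b d - dchart₃ e α y d a b c := by
    rw [extDeriv, ContinuousAlternatingMap.alternatizeUncurryFin_apply, Fin.sum_univ_four]
    have r0 : Fin.removeNth 0 ![a, b, c, d] = ![b, c, d] := by ext i; fin_cases i <;> rfl
    have r1 : Fin.removeNth 1 ![a, b, c, d] = ![a, c, d] := by ext i; fin_cases i <;> rfl
    have r2 : Fin.removeNth 2 ![a, b, c, d] = ![a, b, d] := by ext i; fin_cases i <;> rfl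
    have r3 : Fin.removeNth 3 ![a, b, c, d] = ![a, b, c] := by ext i; fin_cases i <;> rfl
    rw [r0, r1, r2, r3]
    have hd : ∀ u a b c, dchart₃ e α y u a b c = fderiv ℝ (chartForm e α) y u ![a, b, c] :=
      fun _ _ _ _ => rfl
    simp [hd]
    ring
  rw [h0]
  simp only [cov₃, chart₃]
  have h1 := cur₃_swap₁ (chartForm e α y).toAlternatingMap
  have h2 := cur₃_swap₂ (chartForm e α y).toAlternatingMap
  rw [Gam_symm e y b a, Gam_symm e y c a, Gam_symm e y c b, Gam_symm e y d a, Gam_symm e y d b,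
    Gam_symm e y d c]
  linarith [h1 b (Gam e y a c) d, h1 b (Gam e y a d) c, h2 b c (Gam e y a d),
    h2 a c (Gam e y b d)]

/-- The exterior derivative of a `4`-form is the alternation of its covariant derivative. -/
lemma extDeriv_four (e : OpenPartialHomeomorph M (E n))
    (α : ∀ x : M, TangentSpace (𝓡 n) x [⋀^Fin 4]→L[ℝ] ℝ) (y m a b c d : E n) :
    extDeriv (chartForm e α) y ![m, a, b, c, d] = cov₄ e α y m a b c d - cov₄ e α y a m b c d
      + cov₄ e α y b m a c d - cov₄ e α y c m a b d + cov₄ e α y d m a b c := by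
  have h0 : extDeriv (chartForm e α) y ![m, a, b, c, d] = dchart₄ e α y m a b c d
      - dchart₄ e α y a m b c d + dchart₄ e α y b m a c d - dchart₄ e α y c m a b d
      + dchart₄ e α y d m a b c := by
    rw [extDeriv, ContinuousAlternatingMap.alternatizeUncurryFin_apply, Fin.sum_univ_five]
    have r0 : Fin.removeNth 0 ![m, a, b, c, d] = ![a, b, c, d] := by ext i; fin_cases i <;> rfl
    have r1 : Fin.removeNth 1 ![m, a, b, c, d] = ![m, b, c, d] := by ext i; fin_cases i <;> rfl
    have r2 : Fin.removeNth 2 ![m, a, b, c, d] = ![m, a, c, d] := by ext i; fin_cases i <;> rfl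
    have r3 : Fin.removeNth 3 ![m, a, b, c, d] = ![m, a, b, d] := by ext i; fin_cases i <;> rfl
    have r4 : Fin.removeNth 4 ![m, a, b, c, d] = ![m, a, b, c] := by ext i; fin_cases i <;> rfl
    rw [r0, r1, r2, r3, r4]
    have hd : ∀ u a b c d, dchart₄ e α y u a b c d =
        fderiv ℝ (chartForm e α) y u ![a, b, c, d] := fun _ _ _ _ _ => rfl
    simp [hd]
    ring
  rw [h0]
  simp only [cov₄, chart₄]
  have h1 := cur₄_swap₁ (chartForm e α y).toAlternatingMap
  have h2 := cur₄_swap₂ (chartForm e α y).toAlternatingMap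
  have h3 := cur₄_swap₃ (chartForm e α y).toAlternatingMap
  rw [Gam_symm e y a m, Gam_symm e y b m, Gam_symm e y c m, Gam_symm e y d m, Gam_symm e y b a,
    Gam_symm e y c a, Gam_symm e y c b, Gam_symm e y d a, Gam_symm e y d b, Gam_symm e y d c]
  linarith [h1 a (Gam e y m b) c d, h1 a (Gam e y m c) b d, h2 a b (Gam e y m c) d,
    h1 a (Gam e y m d) b c, h2 a b (Gam e y m d) c, h3 a b c (Gam e y m d),
    h2 m b (Gam e y a c) d, h2 m b (Gam e y a d) c, h3 m b c (Gam e y a d),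
    h3 m a c (Gam e y b d)]

end Exterior

/-! ### The curvature of a nearly `G₂`-manifold in a chart -/

section NearlyG2

variable {M : Type*} [TopologicalSpace M] [ChartedSpace (E 7) M]
  [Bundle.RiemannianBundle (fun x : M => TangentSpace (𝓡 7) x)]
  {φ : ∀ x : M, TangentSpace (𝓡 7) x [⋀^Fin 3]→L[ℝ] ℝ}
  {ψ : ∀ x : M, TangentSpace (𝓡 7) x [⋀^Fin 4]→L[ℝ] ℝ}
  [IsManifold (𝓡 7) ∞ M]
  [IsContMDiffRiemannianBundle (𝓡 7) ∞ (E 7) (fun x : M => TangentSpace (𝓡 7) x)]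

/-- `IsG2Structure.cov_psi`, with the contractions carried out. -/
lemma IsG2Structure.cov_psi_frame (h : IsG2Structure φ ψ) {e : OpenPartialHomeomorph M (E 7)}
    (he : e ∈ atlas (E 7) M) {y : E 7} (hy : y ∈ e.target) {f : Module.Basis (Fin 7) ℝ (E 7)}
    (hf : IsG2Frame e φ ψ y f) (u : E 7) (i j k l : Fin 7) :
    fanoSgn k l * cov₃ e φ y u (f i) (f j) (f (fanoMul k l))
      + fanoSgn i j * cov₃ e φ y u (f k) (f l) (f (fanoMul i j)) =
      - cov₄ e ψ y u (f i) (f j) (f k) (f l) := by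
  rw [← h.cov_psi he hy hf, Finset.sum_add_distrib]
  simp [phi₀, mul_comm]

/-- The covariant derivatives of `φ` and `ψ` in an adapted frame, for a nearly `G₂`-structure. -/
lemma IsG2Structure.cov_frame (h : IsG2Structure φ ψ) {τ : ℝ}
    (hφ : HasExtDeriv φ (fun x => τ • ψ x)) (hψ : HasExtDeriv ψ (fun _ => 0))
    {e : OpenPartialHomeomorph M (E 7)}
    (he : e ∈ atlas (E 7) M) {y : E 7} (hy : y ∈ e.target) {f : Module.Basis (Fin 7) ℝ (E 7)}
    (hf : IsG2Frame e φ ψ y f) (m : Fin 7) :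
    (∀ a b c, cov₃ e φ y (f m) (f a) (f b) (f c) = τ / 4 * psi₀ m a b c) ∧
    ∀ a b c d, cov₄ e ψ y (f m) (f a) (f b) (f c) (f d) = - (τ / 4 * (kron m a * phi₀ b c d
      - kron m b * phi₀ a c d + kron m c * phi₀ a b d - kron m d * phi₀ a b c)) := by
  have hA : ∀ m, ∃ T : Fin 7 → ℝ, ∀ a b c, cov₃ e φ y (f m) (f a) (f b) (f c) =
      ∑ n, T n * psi₀ n a b c := fun m =>
    exists_contraction_psi (p := fun a b c => cov₃ e φ y (f m) (f a) (f b) (f c))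
      (fun _ _ _ => cov₃_swap₁ ..) (fun _ _ _ => cov₃_swap₂ ..) fun a b c => by
      rw [h.cov_psi_frame he hy hf, cov₄_self, neg_zero]
  choose T hT using hA
  have hQ : ∀ m a b c d, cov₄ e ψ y (f m) (f a) (f b) (f c) (f d) = - (T m a * phi₀ b c d
      - T m b * phi₀ a c d + T m c * phi₀ a b d - T m d * phi₀ a b c) := by
    intro m a b c d
    rw [← neg_eq_iff_eq_neg, ← h.cov_psi_frame he hy hf, hT, hT, Finset.mul_sum, Finset.mul_sum,
      ← Finset.sum_add_distrib]
    have : ∀ n, (fanoSgn c d : ℝ) * (T m n * psi₀ n a b (fanoMul c d))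
        + fanoSgn a b * (T m n * psi₀ n c d (fanoMul a b)) =
        T m n * (kron n a * phi₀ b c d - kron n b * phi₀ a c d + kron n c * phi₀ a b d
        - kron n d * phi₀ a b c) := by
      intro n
      have := contract_phi₀_psi₀ n a b c d
      rify at this
      rw [← this]
      ring
    rw [Finset.sum_congr rfl fun n _ => this n]
    simp [kron, mul_add, mul_sub, Finset.sum_add_distrib, Finset.sum_sub_distrib]
  have hTτ : ∀ m n, T m n = τ / 4 * kron m n := by
    refine torsion_eq (fun a b c d => ?_) fun {X} hX m a b c d => ?_
    · have h1 := congrArg (fun L => L ![f a, f b, f c, f d]) (hφ e he y hy)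
      simp only [extDeriv_three, hT] at h1
      have h2 : chartForm e (fun x => τ • ψ x) y ![f a, f b, f c, f d] =
          τ * chart₄ e ψ y (f a) (f b) (f c) (f d) := rfl
      rw [h2, hf.psi] at h1
      rw [← h1]
      simp only [Finset.sum_add_distrib, Finset.sum_sub_distrib]
    · have h1 := congrArg (fun L => L ![f m, f a, f b, f c, f d]) (hψ e he y hy)
      have h2 : chartForm e (fun _ : M => (0 : TangentSpace (𝓡 7) _ [⋀^Fin 5]→L[ℝ] ℝ)) y
          ![f m, f a, f b, f c, f d] = 0 := rfl
      simp only [extDeriv_four, hQ] at h1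
      rw [h2] at h1
      simp only [hX]
      linarith
  refine ⟨fun a b c => ?_, fun a b c d => ?_⟩
  · rw [hT]
    simp [hTτ, kron]
  · rw [hQ]
    simp only [hTτ]
    ring

/-- A nearly `G₂`-structure with `dφ = τ ψ` satisfies `∇φ = (τ / 4) ψ`. -/
lemma IsG2Structure.cov_phi_eq (h : IsG2Structure φ ψ) {τ : ℝ}
    (hφ : HasExtDeriv φ (fun x => τ • ψ x)) (hψ : HasExtDeriv ψ (fun _ => 0))
    {e : OpenPartialHomeomorph M (E 7)}
    (he : e ∈ atlas (E 7) M) {y : E 7} (hy : y ∈ e.target) (u a b c : E 7) :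
    cov₃ e φ y u a b c = τ / 4 * chart₄ e ψ y u a b c := by
  obtain ⟨f, hf⟩ := h.exists_frame he hy
  rw [← sub_eq_zero]
  refine eq_zero_of_basis f (F := fun u => cov₃ e φ y u a b c - τ / 4 * chart₄ e ψ y u a b c)
    ⟨fun _ _ => by simp [cov₃]; ring, fun _ _ => by simp [cov₃]; ring⟩ (fun i => ?_) u
  refine eq_zero_of_basis f (F := fun a => cov₃ e φ y _ a b c - τ / 4 * chart₄ e ψ y _ a b c)
    ⟨fun _ _ => by simp [cov₃]; ring, fun _ _ => by simp [cov₃]; ring⟩ (fun j => ?_) a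
  refine eq_zero_of_basis f (F := fun b => cov₃ e φ y _ _ b c - τ / 4 * chart₄ e ψ y _ _ b c)
    ⟨fun _ _ => by simp [cov₃]; ring, fun _ _ => by simp [cov₃]; ring⟩ (fun k => ?_) b
  refine eq_zero_of_basis f (F := fun c => cov₃ e φ y _ _ _ c - τ / 4 * chart₄ e ψ y _ _ _ c)
    ⟨fun _ _ => by simp [cov₃]; ring, fun _ _ => by simp [cov₃]; ring⟩ (fun l => ?_) c
  rw [(h.cov_frame hφ hψ he hy hf i).1, hf.psi, sub_self]

/-- A nearly `G₂`-structure with `dφ = τ ψ` satisfies `∇_u ψ = - (τ / 4) u ∧ φ`. -/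
lemma IsG2Structure.cov_psi_eq (h : IsG2Structure φ ψ) {τ : ℝ}
    (hφ : HasExtDeriv φ (fun x => τ • ψ x)) (hψ : HasExtDeriv ψ (fun _ => 0))
    {e : OpenPartialHomeomorph M (E 7)}
    (he : e ∈ atlas (E 7) M) {y : E 7} (hy : y ∈ e.target) (u a b c d : E 7) :
    cov₄ e ψ y u a b c d = - (τ / 4 * (gmet e y u a * chart₃ e φ y b c d
      - gmet e y u b * chart₃ e φ y a c d + gmet e y u c * chart₃ e φ y a b d
      - gmet e y u d * chart₃ e φ y a b c)) := by
  obtain ⟨f, hf⟩ := h.exists_frame he hy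
  rw [← sub_eq_zero]
  set F : E 7 → E 7 → E 7 → E 7 → E 7 → ℝ := fun u a b c d => cov₄ e ψ y u a b c d -
    - (τ / 4 * (gmet e y u a * chart₃ e φ y b c d
      - gmet e y u b * chart₃ e φ y a c d + gmet e y u c * chart₃ e φ y a b d
      - gmet e y u d * chart₃ e φ y a b c)) with hF
  refine eq_zero_of_basis f (F := fun u => F u a b c d)
    ⟨fun _ _ => by simp [hF, cov₄]; ring, fun _ _ => by simp [hF, cov₄]; ring⟩ (fun i => ?_) u
  refine eq_zero_of_basis f (F := fun a => F _ a b c d)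
    ⟨fun _ _ => by simp [hF, cov₄]; ring, fun _ _ => by simp [hF, cov₄]; ring⟩ (fun j => ?_) a
  refine eq_zero_of_basis f (F := fun b => F _ _ b c d)
    ⟨fun _ _ => by simp [hF, cov₄]; ring, fun _ _ => by simp [hF, cov₄]; ring⟩ (fun k => ?_) b
  refine eq_zero_of_basis f (F := fun c => F _ _ _ c d)
    ⟨fun _ _ => by simp [hF, cov₄]; ring, fun _ _ => by simp [hF, cov₄]; ring⟩ (fun l => ?_) c
  refine eq_zero_of_basis f (F := fun d => F _ _ _ _ d)
    ⟨fun _ _ => by simp [hF, cov₄]; ring, fun _ _ => by simp [hF, cov₄]; ring⟩ (fun p => ?_) d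
  simp only [hF, (h.cov_frame hφ hψ he hy hf i).2, hf.phi, hf.ortho _ _]
  ring

/-- On a nearly `G₂`-manifold with `dφ = τ ψ` the curvature acts on `φ` as if the sectional
curvature were constant and equal to `τ² / 16`. -/
lemma IsG2Structure.curv_phi (h : IsG2Structure φ ψ) {τ : ℝ}
    (hφ : HasExtDeriv φ (fun x => τ • ψ x)) (hψ : HasExtDeriv ψ (fun _ => 0))
    {e : OpenPartialHomeomorph M (E 7)}
    (he : e ∈ atlas (E 7) M) {y : E 7} (hy : y ∈ e.target) (w u a b c : E 7) :
    chart₃ e φ y (curv (Gam e) y w u a) b c + chart₃ e φ y a (curv (Gam e) y w u b) c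
        + chart₃ e φ y a b (curv (Gam e) y w u c) = τ ^ 2 / 16 * (
      gmet e y u a * chart₃ e φ y w b c - gmet e y w a * chart₃ e φ y u b c
      + (gmet e y u b * chart₃ e φ y a w c - gmet e y w b * chart₃ e φ y a u c)
      + (gmet e y u c * chart₃ e φ y a b w - gmet e y w c * chart₃ e φ y a b u)) := by
  have hd : ∀ u a b c, DifferentiableAt ℝ (fun z => chart₄ e ψ z u a b c) y :=
    fun u a b c => differentiableAt_chartForm_apply he h.smooth_ψ ![u, a, b, c] hy
  have := ricci_identity_three he h.smooth_φ (S := fun y u a b c => τ / 4 * chart₄ e ψ y u a b c)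
    (fun y hy u a b c => h.cov_phi_eq hφ hψ he hy u a b c) hy
    (S₂ := fun w u a b c => τ / 4 * cov₄ e ψ y w u a b c) (fun w u a b c => by
      rw [fderiv_const_mul (hd _ _ _ _)]
      simp only [smul_apply, smul_eq_mul, fderiv_chart₄ he h.smooth_ψ hy, cov₄]
      ring) w u a b c
  simp only [h.cov_psi_eq hφ hψ he hy] at this
  have h1 := cur₃_swap₁ (chartForm e φ y).toAlternatingMap
  have h2 := cur₃_swap₂ (chartForm e φ y).toAlternatingMap
  simp only [chart₃] at this ⊢
  rw [gmet_symm e y u w] at this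
  rw [h1 a w c, h1 a u c, h2 a b w, h2 a b u, h1 a w b, h1 a u b]
  linear_combination this

end NearlyG2

/-! ### Algebraic curvature tensors and Berger's estimate -/

section Curvature

variable {V : Type*} [NormedAddCommGroup V] [InnerProductSpace ℝ V]

/-- `R` has the algebraic symmetries of a Riemann curvature tensor. -/
structure IsCurvatureTensor (R : V → V → V → V → ℝ) : Prop where
  add_left : ∀ u u' v w z, R (u + u') v w z = R u v w z + R u' v w z
  smul_left : ∀ (c : ℝ) u v w z, R (c • u) v w z = c * R u v w z
  antisymm : ∀ u v w z, R u v w z = - R v u w z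
  pair_symm : ∀ u v w z, R u v w z = R w z u v
  cyclic : ∀ u v w z, R u v w z + R v w u z + R w u v z = 0

/-- The curvature tensor of constant sectional curvature `1`. -/
noncomputable def constCurv (u v w z : V) : ℝ :=
  inner ℝ u z * inner ℝ v w - inner ℝ u w * inner ℝ v z

lemma isCurvatureTensor_constCurv : IsCurvatureTensor (constCurv (V := V)) where
  add_left u u' v w z := by simp only [constCurv, inner_add_left]; ring
  smul_left c u v w z := by simp only [constCurv, real_inner_smul_left]; ring
  antisymm u v w z := by simp only [constCurv]; ring
  pair_symm u v w z := by
    simp only [constCurv]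
    rw [real_inner_comm w u, real_inner_comm z u, real_inner_comm w v, real_inner_comm z v]
    ring
  cyclic u v w z := by
    simp only [constCurv]
    rw [real_inner_comm u v, real_inner_comm u w, real_inner_comm v w]
    ring

lemma IsCurvatureTensor.sub_mul {R R' : V → V → V → V → ℝ} (h : IsCurvatureTensor R)
    (h' : IsCurvatureTensor R') (c : ℝ) :
    IsCurvatureTensor (fun u v w z => R u v w z - c * R' u v w z) where
  add_left u u' v w z := by rw [h.add_left, h'.add_left]; ring
  smul_left k u v w z := by rw [h.smul_left, h'.smul_left]; ring
  antisymm u v w z := by rw [h.antisymm, h'.antisymm]; ring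
  pair_symm u v w z := by rw [h.pair_symm, h'.pair_symm]
  cyclic u v w z := by linear_combination h.cyclic u v w z - c * h'.cyclic u v w z

variable {R : V → V → V → V → ℝ}

lemma IsCurvatureTensor.antisymm' (h : IsCurvatureTensor R) (u v w z : V) :
    R u v w z = - R u v z w := by
  rw [h.pair_symm, h.antisymm, h.pair_symm]

lemma IsCurvatureTensor.isLinearMap₁ (h : IsCurvatureTensor R) (v w z : V) :
    IsLinearMap ℝ (fun u => R u v w z) :=
  ⟨fun _ _ => h.add_left .., fun _ _ => h.smul_left ..⟩

lemma IsCurvatureTensor.isLinearMap₂ (h : IsCurvatureTensor R) (u w z : V) :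
    IsLinearMap ℝ (fun v => R u v w z) :=
  ⟨fun _ _ => by rw [h.antisymm, h.add_left, h.antisymm u, h.antisymm u]; ring,
    fun _ _ => by rw [h.antisymm, h.smul_left, h.antisymm u, smul_eq_mul]; ring⟩

lemma IsCurvatureTensor.isLinearMap₃ (h : IsCurvatureTensor R) (u v z : V) :
    IsLinearMap ℝ (fun w => R u v w z) :=
  ⟨fun _ _ => by rw [h.pair_symm, h.add_left, h.pair_symm u, h.pair_symm u],
    fun _ _ => by rw [h.pair_symm, h.smul_left, h.pair_symm u, smul_eq_mul]⟩

lemma IsCurvatureTensor.isLinearMap₄ (h : IsCurvatureTensor R) (u v w : V) :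
    IsLinearMap ℝ (fun z => R u v w z) := by
  simp only [h.pair_symm u v w]
  exact h.isLinearMap₂ w u v

/-- A bound for a partial symmetrization of the curvature tensor, by polarization of the bound for
`R(u, v, v, u)`. -/
lemma IsCurvatureTensor.abs_add_le (h : IsCurvatureTensor R) {ε : ℝ}
    (hε : ∀ u v, |R u v v u| ≤ ε * (inner ℝ u u * inner ℝ v v - inner ℝ u v ^ 2)) {x y z w : V}
    (hxx : inner ℝ x x = (1 : ℝ)) (hyy : inner ℝ y y = (1 : ℝ)) (hzz : inner ℝ z z = (1 : ℝ))
    (hww : inner ℝ w w = (1 : ℝ)) (hxy : inner ℝ x y = (0 : ℝ)) (hxz : inner ℝ x z = (0 : ℝ))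
    (hxw : inner ℝ x w = (0 : ℝ)) (hyz : inner ℝ y z = (0 : ℝ)) (hyw : inner ℝ y w = (0 : ℝ))
    (hzw : inner ℝ z w = (0 : ℝ)) : |R x y z w + R x z y w| ≤ 2 * ε := by
  have hyx := real_inner_comm x y
  have hwx := real_inner_comm x w
  have hzx := real_inner_comm x z
  have hzy := real_inner_comm y z
  have hwy := real_inner_comm y w
  have hwz := real_inner_comm z w
  rw [hxy] at hyx
  rw [hxw] at hwx
  rw [hxz] at hzx
  rw [hyz] at hzy
  rw [hyw] at hwy
  rw [hzw] at hwz
  have key : R (x + w) (y + z) (y + z) (x + w) - R (x + w) (y - z) (y - z) (x + w)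
      - R (x - w) (y + z) (y + z) (x - w) + R (x - w) (y - z) (y - z) (x - w)
      = 8 * (R x y z w + R x z y w) := by
    have e1 : R w y z x = R x z y w := by
      rw [h.pair_symm, h.antisymm, h.antisymm', neg_neg]
    have e2 : R w z y x = R x y z w := by
      rw [h.pair_symm, h.antisymm, h.antisymm', neg_neg]
    simp only [(h.isLinearMap₁ _ _ _).map_add, (h.isLinearMap₂ _ _ _).map_add,
      (h.isLinearMap₃ _ _ _).map_add, (h.isLinearMap₄ _ _ _).map_add,
      (h.isLinearMap₁ _ _ _).map_sub, (h.isLinearMap₂ _ _ _).map_sub,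
      (h.isLinearMap₃ _ _ _).map_sub, (h.isLinearMap₄ _ _ _).map_sub]
    linear_combination 4 * e1 + 4 * e2
  have b1 := abs_le.1 (hε (x + w) (y + z))
  have b2 := abs_le.1 (hε (x + w) (y - z))
  have b3 := abs_le.1 (hε (x - w) (y + z))
  have b4 := abs_le.1 (hε (x - w) (y - z))
  simp only [inner_add_left, inner_add_right, inner_sub_left, inner_sub_right, hxx, hyy, hzz, hww,
    hxy, hxz, hwx, hyz, hzy, hwy, hwz] at b1 b2 b3 b4
  rw [abs_le]
  constructor <;> linarith

/-- Berger's estimate: the mixed components of a curvature tensor in an orthonormal basis are at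
most `4 / 3` times the bound for the sectional curvatures. -/
lemma IsCurvatureTensor.abs_apply_le (h : IsCurvatureTensor R) {ε : ℝ}
    (hε : ∀ u v, |R u v v u| ≤ ε * (inner ℝ u u * inner ℝ v v - inner ℝ u v ^ 2)) {x y z w : V}
    (hxx : inner ℝ x x = (1 : ℝ)) (hyy : inner ℝ y y = (1 : ℝ)) (hzz : inner ℝ z z = (1 : ℝ))
    (hww : inner ℝ w w = (1 : ℝ)) (hxy : inner ℝ x y = (0 : ℝ)) (hxz : inner ℝ x z = (0 : ℝ))
    (hxw : inner ℝ x w = (0 : ℝ)) (hyz : inner ℝ y z = (0 : ℝ)) (hyw : inner ℝ y w = (0 : ℝ))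
    (hzw : inner ℝ z w = (0 : ℝ)) : |R x y z w| ≤ 4 / 3 * ε := by
  have b1 := abs_le.1 (h.abs_add_le hε hxx hyy hzz hww hxy hxz hxw hyz hyw hzw)
  have b2 := abs_le.1 (h.abs_add_le hε hyy hxx hzz hww (by rwa [real_inner_comm]) hyz hyw
    hxz hxw hzw)
  have e1 := h.antisymm y x z w
  have e2 := h.antisymm x z y w
  have e3 := h.cyclic x y z w
  rw [abs_le]
  constructor <;> linarith

end Curvature

/-! ### An inequality for quadratic forms in three variables -/

section Inequality

lemma mul_le_of_abs_le {c x k : ℝ} (hx : |x| ≤ k) (hc : 0 ≤ c) : |c * x| ≤ c * k := by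
  rw [abs_mul, abs_of_nonneg hc]
  exact mul_le_mul_of_nonneg_left hx hc

/-- The quadratic form `∑ Aₐ λₐ² + 2 ∑ wₐᵦ λₐ λᵦ` for `λ = (p + q, -p, -q)`. Suitable multiples of
the three row relations are added before the entries are estimated. -/
lemma abs_quadratic_le_of_le {ε κ A₁ A₂ A₃ w₁₂ w₁₃ w₂₃ p q : ℝ} (hA₁ : |A₁| ≤ ε)
    (hA₂ : |A₂| ≤ ε) (hA₃ : |A₃| ≤ ε) (hw₁₂ : |w₁₂| ≤ 4 / 3 * ε) (hw₁₃ : |w₁₃| ≤ 4 / 3 * ε)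
    (hκ : |κ| ≤ ε) (h₁ : A₁ + κ + w₁₂ + w₁₃ = 0)
    (h₂ : A₂ + κ + w₁₂ + w₂₃ = 0) (h₃ : A₃ + κ + w₁₃ + w₂₃ = 0) (hq : 0 ≤ q) (hqp : q ≤ p) :
    |A₁ * (p + q) ^ 2 + A₂ * p ^ 2 + A₃ * q ^ 2
      + 2 * (w₁₂ * ((p + q) * -p) + w₁₃ * ((p + q) * -q) + w₂₃ * (p * q))| ≤
      7 / 3 * ε * ((p + q) ^ 2 + p ^ 2 + q ^ 2) := by
  have hε : 0 ≤ ε := (abs_nonneg _).trans hκ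
  have hp : 0 ≤ p := hq.trans hqp
  rcases le_total (2 * q) p with h | h
  · -- the multipliers `2q(p + q), -2pq, 0` remove `w₁₃` and `w₂₃`
    have e1 := abs_le.1 (mul_le_of_abs_le hA₁ (c := (p + q) ^ 2 + 2 * q * (p + q)) (by positivity))
    have e2 := abs_le.1 (mul_le_of_abs_le hA₂ (c := p * (p - 2 * q))
      (mul_nonneg hp (by linarith)))
    have e3 := abs_le.1 (mul_le_of_abs_le hA₃ (c := q ^ 2) (by positivity))
    have e4 := abs_le.1 (mul_le_of_abs_le hw₁₂ (c := 2 * p ^ 2 + 2 * q * (p - q))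
      (by have := mul_nonneg hq (sub_nonneg.2 hqp); positivity))
    have e5 := abs_le.1 (mul_le_of_abs_le hκ (c := 2 * q ^ 2) (by positivity))
    have e6 : 0 ≤ q ^ 2 * ε := by positivity
    have r1 : 2 * q * (p + q) * (A₁ + κ + w₁₂ + w₁₃) = 0 := by rw [h₁, mul_zero]
    have r2 : 2 * q * p * (A₂ + κ + w₁₂ + w₂₃) = 0 := by rw [h₂, mul_zero]
    rw [abs_le]
    constructor <;> linarith
  · -- the multipliers `2q(p + q), -p², p² - 2pq` remove `A₂` and `w₂₃`
    have e1 := abs_le.1 (mul_le_of_abs_le hA₁ (c := (p + q) ^ 2 + 2 * q * (p + q)) (by positivity))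
    have e3 := abs_le.1 (mul_le_of_abs_le hA₃ (c := (p - q) ^ 2) (by positivity))
    have e4 := abs_le.1 (mul_le_of_abs_le hw₁₂ (c := 3 * p ^ 2 - 2 * q ^ 2)
      (by nlinarith [mul_nonneg hq (sub_nonneg.2 hqp), mul_nonneg hp (sub_nonneg.2 hqp)]))
    have e6 := abs_le.1 (mul_le_of_abs_le hw₁₃ (c := p * (2 * q - p))
      (mul_nonneg hp (by linarith)))
    have e7 : 0 ≤ q ^ 2 * ε := by positivity
    have e5 := abs_le.1 (mul_le_of_abs_le hκ (c := 2 * q ^ 2) (by positivity))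
    have r1 : 2 * q * (p + q) * (A₁ + κ + w₁₂ + w₁₃) = 0 := by rw [h₁, mul_zero]
    have r2 : p ^ 2 * (A₂ + κ + w₁₂ + w₂₃) = 0 := by rw [h₂, mul_zero]
    have r3 : p * (2 * q - p) * (A₃ + κ + w₁₃ + w₂₃) = 0 := by rw [h₃, mul_zero]
    rw [abs_le]
    constructor <;> linarith

lemma abs_quadratic_le_of_mul_nonneg {ε κ A₁ A₂ A₃ w₁₂ w₁₃ w₂₃ a b c : ℝ} (hA₁ : |A₁| ≤ ε)
    (hA₂ : |A₂| ≤ ε) (hA₃ : |A₃| ≤ ε) (hw₁₂ : |w₁₂| ≤ 4 / 3 * ε) (hw₁₃ : |w₁₃| ≤ 4 / 3 * ε)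
    (hκ : |κ| ≤ ε) (h₁ : A₁ + κ + w₁₂ + w₁₃ = 0)
    (h₂ : A₂ + κ + w₁₂ + w₂₃ = 0) (h₃ : A₃ + κ + w₁₃ + w₂₃ = 0) (h : a + b + c = 0)
    (hbc : 0 ≤ b * c) :
    |A₁ * a ^ 2 + A₂ * b ^ 2 + A₃ * c ^ 2 + 2 * (w₁₂ * (a * b) + w₁₃ * (a * c) + w₂₃ * (b * c))| ≤
      7 / 3 * ε * (a ^ 2 + b ^ 2 + c ^ 2) := by
  obtain rfl : a = - b - c := by linarith
  have key : ∀ {A₂ A₃ w₁₂ w₁₃ b c : ℝ}, |A₂| ≤ ε → |A₃| ≤ ε → |w₁₂| ≤ 4 / 3 * ε →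
      |w₁₃| ≤ 4 / 3 * ε → A₁ + κ + w₁₂ + w₁₃ = 0 → A₂ + κ + w₁₂ + w₂₃ = 0 →
      A₃ + κ + w₁₃ + w₂₃ = 0 → 0 ≤ b * c → |c| ≤ |b| →
      |A₁ * (-b - c) ^ 2 + A₂ * b ^ 2 + A₃ * c ^ 2 + 2 * (w₁₂ * ((-b - c) * b)
        + w₁₃ * ((-b - c) * c) + w₂₃ * (b * c))| ≤
      7 / 3 * ε * ((-b - c) ^ 2 + b ^ 2 + c ^ 2) := by
    intro A₂ A₃ w₁₂ w₁₃ b c hA₂ hA₃ hw₁₂ hw₁₃ h₁ h₂ h₃ hbc hle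
    have := abs_quadratic_le_of_le hA₁ hA₂ hA₃ hw₁₂ hw₁₃ hκ h₁ h₂ h₃ (abs_nonneg c) hle
    have e1 : |b| * |c| = b * c := by rw [← abs_mul, abs_of_nonneg hbc]
    have e2 := sq_abs b
    have e3 := sq_abs c
    have e4 : (|b| + |c|) ^ 2 = (-b - c) ^ 2 := by linear_combination e2 + e3 + 2 * e1
    have e5 : (|b| + |c|) * -|b| = (-b - c) * b := by linear_combination -e2 - e1
    have e6 : (|b| + |c|) * -|c| = (-b - c) * c := by linear_combination -e3 - e1
    rwa [e4, e5, e6, e1, e2, e3] at this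
  rcases le_total |c| |b| with hle | hle
  · exact key hA₂ hA₃ hw₁₂ hw₁₃ h₁ h₂ h₃ hbc hle
  · have := key hA₃ hA₂ hw₁₃ hw₁₂ (by linarith) h₃ h₂ (mul_comm b c ▸ hbc) hle
    convert this using 2 <;> ring

/-- The estimate of a quadratic form in three variables with sum `0`, whose rows sum to `-κ`. Of the
three products of the variables one is nonnegative; a permutation makes it the product of the last
two. -/
lemma abs_quadratic_le {ε κ A₁ A₂ A₃ w₁₂ w₁₃ w₂₃ a b c : ℝ} (hA₁ : |A₁| ≤ ε)
    (hA₂ : |A₂| ≤ ε) (hA₃ : |A₃| ≤ ε) (hw₁₂ : |w₁₂| ≤ 4 / 3 * ε) (hw₁₃ : |w₁₃| ≤ 4 / 3 * ε)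
    (hw₂₃ : |w₂₃| ≤ 4 / 3 * ε) (hκ : |κ| ≤ ε) (h₁ : A₁ + κ + w₁₂ + w₁₃ = 0)
    (h₂ : A₂ + κ + w₁₂ + w₂₃ = 0) (h₃ : A₃ + κ + w₁₃ + w₂₃ = 0) (h : a + b + c = 0) :
    |A₁ * a ^ 2 + A₂ * b ^ 2 + A₃ * c ^ 2 + 2 * (w₁₂ * (a * b) + w₁₃ * (a * c) + w₂₃ * (b * c))| ≤
      7 / 3 * ε * (a ^ 2 + b ^ 2 + c ^ 2) := by
  rcases le_or_gt 0 (b * c) with hbc | hbc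
  · exact abs_quadratic_le_of_mul_nonneg hA₁ hA₂ hA₃ hw₁₂ hw₁₃ hκ h₁ h₂ h₃ h hbc
  rcases le_or_gt 0 (a * c) with hac | hac
  · have := abs_quadratic_le_of_mul_nonneg (w₂₃ := w₁₃) hA₂ hA₁ hA₃ hw₁₂ hw₂₃ hκ (by linarith)
      (by linarith) (by linarith) (show b + a + c = 0 by linarith) hac
    convert this using 2 <;> ring
  · have hab : 0 ≤ a * b := by
      have h1 : 0 < a * b * c ^ 2 := by nlinarith [mul_pos_of_neg_of_neg hbc hac]
      exact (pos_of_mul_pos_left h1 (sq_nonneg c)).le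
    have := abs_quadratic_le_of_mul_nonneg (w₂₃ := w₁₂) hA₃ hA₁ hA₂ hw₁₃ hw₂₃ hκ (by linarith)
      (by linarith) (by linarith) (show c + a + b = 0 by linarith) hab
    convert this using 2 <;> ring

end Inequality

/-! ### Complex frames -/

section NormalForm

variable {V : Type*} [NormedAddCommGroup V] [InnerProductSpace ℝ V]

lemma exists_unit_eigenvector_orthogonal [FiniteDimensional ℝ V] {S : V →ₗ[ℝ] V}
    (hS : S.IsSymmetric) {U : Submodule ℝ V} (hU : ∀ u ∈ U, S u ∈ U)
    (hlt : Module.finrank ℝ U < Module.finrank ℝ V) :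
    ∃ e ∈ Uᗮ, inner ℝ e e = (1 : ℝ) ∧ ∃ μ : ℝ, S e = μ • e := by
  have hU' : ∀ u ∈ Uᗮ, S u ∈ Uᗮ := by
    intro u hu w hw
    rw [← hS w u]
    exact hu _ (hU w hw)
  have hfin := U.finrank_add_finrank_orthogonal
  have : Nontrivial Uᗮ := Module.nontrivial_of_finrank_pos (R := ℝ) (by omega)
  obtain ⟨μ, hμ⟩ : ∃ μ : ℝ, Module.End.HasEigenvalue (S.restrict hU') μ :=
    ⟨_, (hS.restrict_invariant hU').hasEigenvalue_iSup_of_finiteDimensional⟩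
  obtain ⟨e, he⟩ := hμ.exists_hasEigenvector
  have he0 : (e : V) ≠ 0 := fun h => he.2 (Subtype.ext h)
  have hSe : S e = μ • (e : V) := congrArg Subtype.val he.apply_eq_smul
  refine ⟨‖(e : V)‖⁻¹ • (e : V), Uᗮ.smul_mem _ e.2, ?_, μ, ?_⟩
  · rw [real_inner_smul_left, real_inner_smul_right, real_inner_self_eq_norm_sq]
    have := norm_ne_zero_iff.2 he0
    field_simp
  · rw [map_smul, hSe, smul_comm]

/-- `J` is skew-symmetric, and it is a complex structure on the orthogonal complement of the vector
`n`, which is either a unit vector killed by `J` or zero. -/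
structure IsComplexStructure (n : V) (J : V →ₗ[ℝ] V) : Prop where
  skew : ∀ u v, inner ℝ (J u) v = (- inner ℝ u (J v) : ℝ)
  sq : ∀ u, J (J u) = - u + (inner ℝ n u : ℝ) • n
  apply_self : J n = 0

/-- The vectors `eₐ`, `J eₐ`, for `a = 0, 1, 2`, are an orthonormal basis of the orthogonal
complement of `n`. The orthonormality of the `J eₐ` is not listed, as it follows when `J` is a
complex structure on that complement. -/
structure IsComplexFrame (n : V) (J : V →ₗ[ℝ] V) (e : Fin 3 → V) : Prop where
  inner_e : ∀ a b, inner ℝ (e a) (e b) = if a = b then (1 : ℝ) else 0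
  inner_J : ∀ a b, inner ℝ (e a) (J (e b)) = (0 : ℝ)
  inner_n : ∀ a, inner ℝ n (e a) = (0 : ℝ)
  sum_smul : ∀ u, ∑ a, ((inner ℝ (e a) u : ℝ) • e a + (inner ℝ (J (e a)) u : ℝ) • J (e a))
    + (inner ℝ n u : ℝ) • n = u

variable {n : V} {J : V →ₗ[ℝ] V}

lemma IsComplexStructure.inner_apply_self (h : IsComplexStructure n J) (u : V) :
    inner ℝ u (J u) = (0 : ℝ) := by
  have := h.skew u u
  rw [real_inner_comm] at this
  linarith

lemma IsComplexStructure.inner_apply_apply (h : IsComplexStructure n J) (u v : V) :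
    inner ℝ (J u) (J v) = (inner ℝ u v - inner ℝ n u * inner ℝ n v : ℝ) := by
  rw [h.skew, h.sq, inner_add_right, inner_neg_right, real_inner_smul_right, real_inner_comm n u]
  ring

/-- One step in the construction of a frame of eigenvectors: the invariant subspace `U` is enlarged
by a complex line on which `S` is a multiple of the identity. -/
lemma IsComplexStructure.exists_step [FiniteDimensional ℝ V] (h : IsComplexStructure n J)
    {S : V →ₗ[ℝ] V} (hS : S.IsSymmetric) (hSJ : ∀ u, S (J u) = J (S u)) {U : Submodule ℝ V}
    (hn : n ∈ U) (hUS : ∀ u ∈ U, S u ∈ U) (hUJ : ∀ u ∈ U, J u ∈ U)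
    (hlt : Module.finrank ℝ U < Module.finrank ℝ V) :
    ∃ (e : V) (U' : Submodule ℝ V), e ∈ Uᗮ ∧ J e ∈ Uᗮ ∧ inner ℝ e e = (1 : ℝ) ∧
      (∃ μ : ℝ, S e = μ • e) ∧ U ≤ U' ∧ e ∈ U' ∧ J e ∈ U' ∧ (∀ u ∈ U', S u ∈ U') ∧
      (∀ u ∈ U', J u ∈ U') ∧ Module.finrank ℝ U' ≤ Module.finrank ℝ U + 2 := by
  obtain ⟨e, heU, he1, μ, hμ⟩ := exists_unit_eigenvector_orthogonal hS hUS hlt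
  have hJe : J e ∈ Uᗮ := by
    intro w hw
    have := h.skew w e
    rw [heU _ (hUJ w hw)] at this
    linarith
  have hne : inner ℝ n e = (0 : ℝ) := heU n hn
  have hJJ : J (J e) = - e := by rw [h.sq, hne, zero_smul, add_zero]
  have heU' : e ∈ Submodule.span ℝ {e, J e} := Submodule.subset_span (by simp)
  have hJeU' : J e ∈ Submodule.span ℝ {e, J e} := Submodule.subset_span (by simp)
  have hinv : ∀ {T : V →ₗ[ℝ] V}, (∀ u ∈ U, T u ∈ U) → T e ∈ Submodule.span ℝ {e, J e} →
      T (J e) ∈ Submodule.span ℝ {e, J e} →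
      ∀ u ∈ U ⊔ Submodule.span ℝ {e, J e}, T u ∈ U ⊔ Submodule.span ℝ {e, J e} := by
    intro T h1 h2 h3
    have : U ⊔ Submodule.span ℝ {e, J e} ≤ (U ⊔ Submodule.span ℝ {e, J e}).comap T := by
      refine sup_le (fun u hu => Submodule.mem_sup_left (h1 u hu)) (Submodule.span_le.2 ?_)
      rintro u (rfl | rfl)
      · exact Submodule.mem_sup_right h2
      · exact Submodule.mem_sup_right h3
    exact this
  refine ⟨e, U ⊔ Submodule.span ℝ {e, J e}, heU, hJe, he1, ⟨μ, hμ⟩, le_sup_left,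
    Submodule.mem_sup_right heU', Submodule.mem_sup_right hJeU', hinv hUS ?_ ?_,
    hinv hUJ hJeU' ?_, ?_⟩
  · rw [hμ]; exact Submodule.smul_mem _ _ heU'
  · rw [hSJ, hμ, map_smul]; exact Submodule.smul_mem _ _ hJeU'
  · rw [hJJ]; exact Submodule.neg_mem _ heU'
  · refine (Submodule.finrank_add_le_finrank_add_finrank _ _).trans ?_
    have : Module.finrank ℝ (Submodule.span ℝ {e, J e}) ≤ 2 := by
      classical
      have := finrank_span_finset_le_card (R := ℝ) ({e, J e} : Finset V)
      rw [Finset.coe_pair] at this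
      exact this.trans Finset.card_le_two
    omega

lemma IsComplexStructure.inner_self_smul (h : IsComplexStructure n J) :
    (inner ℝ n n : ℝ) • n = n := by
  have := h.sq n
  rw [h.apply_self, map_zero] at this
  rw [← sub_eq_zero, sub_eq_neg_add]
  exact this.symm

/-- A self-adjoint operator which commutes with a complex structure has a complex frame of
eigenvectors. -/
lemma IsComplexStructure.exists_frame [FiniteDimensional ℝ V] (h : IsComplexStructure n J)
    {S : V →ₗ[ℝ] V} (hS : S.IsSymmetric) (hSJ : ∀ u, S (J u) = J (S u)) (hSn : S n = 0)
    (hfin : Module.finrank ℝ (Submodule.span ℝ {n}) + 6 = Module.finrank ℝ V) :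
    ∃ e : Fin 3 → V, IsComplexFrame n J e ∧ ∃ μ : Fin 3 → ℝ, ∀ a, S (e a) = μ a • e a := by
  have hn0 : n ∈ Submodule.span ℝ {n} := Submodule.mem_span_singleton_self n
  have hinv0 : ∀ {T : V →ₗ[ℝ] V}, T n = 0 → ∀ u ∈ Submodule.span ℝ {n},
      T u ∈ Submodule.span ℝ {n} := by
    intro T hT u hu
    obtain ⟨c, rfl⟩ := Submodule.mem_span_singleton.1 hu
    rw [map_smul, hT, smul_zero]
    exact zero_mem _
  obtain ⟨e₀, U₁, h0, hJ0, hn0', hμ0, hle0, m0, mJ0, hS1, hJ1, hd1⟩ :=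
    h.exists_step hS hSJ hn0 (hinv0 hSn) (hinv0 h.apply_self) (by omega)
  obtain ⟨e₁, U₂, h1, hJ1', hn1, hμ1, hle1, m1, mJ1, hS2, hJ2, hd2⟩ :=
    h.exists_step hS hSJ (hle0 hn0) hS1 hJ1 (by omega)
  obtain ⟨e₂, U₃, h2, hJ2', hn2, hμ2, -, -, -, -, -, -⟩ :=
    h.exists_step hS hSJ (hle1 (hle0 hn0)) hS2 hJ2 (by omega)
  obtain ⟨μ₀, hμ0⟩ := hμ0
  obtain ⟨μ₁, hμ1⟩ := hμ1
  obtain ⟨μ₂, hμ2⟩ := hμ2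
  have hsymm : ∀ {x y : V}, inner ℝ x y = (0 : ℝ) → inner ℝ y x = (0 : ℝ) := fun hxy => by
    rwa [real_inner_comm]
  set e : Fin 3 → V := ![e₀, e₁, e₂] with he
  have hin : ∀ a, inner ℝ n (e a) = (0 : ℝ) := by
    intro a
    fin_cases a
    · exact h0 n hn0
    · exact h1 n (hle0 hn0)
    · exact h2 n (hle1 (hle0 hn0))
  have hie : ∀ a b, inner ℝ (e a) (e b) = if a = b then (1 : ℝ) else 0 := by
    intro a b
    fin_cases a <;> fin_cases b
    · exact hn0'
    · exact h1 _ m0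
    · exact h2 _ (hle1 m0)
    · exact hsymm (h1 _ m0)
    · exact hn1
    · exact h2 _ m1
    · exact hsymm (h2 _ (hle1 m0))
    · exact hsymm (h2 _ m1)
    · exact hn2
  have hiJ : ∀ a b, inner ℝ (e a) (J (e b)) = (0 : ℝ) := by
    intro a b
    fin_cases a <;> fin_cases b
    · exact h.inner_apply_self _
    · exact hJ1' _ m0
    · exact hJ2' _ (hle1 m0)
    · exact hsymm (h1 _ mJ0)
    · exact h.inner_apply_self _
    · exact hJ2' _ m1
    · exact hsymm (h2 _ (hle1 mJ0))
    · exact hsymm (h2 _ mJ1)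
    · exact h.inner_apply_self _
  have hJJ : ∀ a b, inner ℝ (J (e a)) (J (e b)) = if a = b then (1 : ℝ) else 0 := by
    intro a b
    rw [h.inner_apply_apply, hie, hin, zero_mul, sub_zero]
  refine ⟨e, ⟨hie, hiJ, hin, fun u => ?_⟩, ![μ₀, μ₁, μ₂], fun a => by
    fin_cases a
    · exact hμ0
    · exact hμ1
    · exact hμ2⟩
  have hmem : ∀ v, inner ℝ n v = (0 : ℝ) → v ∈ (Submodule.span ℝ {n})ᗮ := by
    intro v hv
    rwa [Submodule.mem_orthogonal_singleton_iff_inner_right]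
  have hinJ : ∀ a, inner ℝ n (J (e a)) = (0 : ℝ) := by
    intro a
    have := h.skew n (e a)
    rw [h.apply_self, inner_zero_left] at this
    linarith
  let v : Fin 3 ⊕ Fin 3 → (Submodule.span ℝ {n} : Submodule ℝ V)ᗮ :=
    Sum.elim (fun a => ⟨e a, hmem _ (hin a)⟩) (fun a => ⟨J (e a), hmem _ (hinJ a)⟩)
  have hv : Orthonormal ℝ v := by
    rw [orthonormal_iff_ite]
    rintro (a | a) (b | b)
    · simpa [v] using hie a b
    · simpa [v] using hiJ a b
    · simpa [v] using hsymm (hiJ b a)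
    · simpa [v] using hJJ a b
  have hcard : Fintype.card (Fin 3 ⊕ Fin 3) =
      Module.finrank ℝ (Submodule.span ℝ {n} : Submodule ℝ V)ᗮ := by
    have := (Submodule.span ℝ {n}).finrank_add_finrank_orthogonal
    simp
    omega
  let b : OrthonormalBasis (Fin 3 ⊕ Fin 3) ℝ (Submodule.span ℝ {n} : Submodule ℝ V)ᗮ :=
    OrthonormalBasis.mk hv (hv.linearIndependent.span_eq_top_of_card_eq_finrank' hcard).ge
  have hw : u - (inner ℝ n u : ℝ) • n ∈ (Submodule.span ℝ {n})ᗮ := by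
    apply hmem
    have h1 : (inner ℝ n n : ℝ) * inner ℝ n u = inner ℝ n u := by
      rw [← real_inner_smul_left, h.inner_self_smul]
    rw [inner_sub_right, real_inner_smul_right, mul_comm, h1, sub_self]
  have hsum := congrArg Subtype.val (b.sum_repr' ⟨_, hw⟩)
  rw [Fintype.sum_sum_type] at hsum
  simp only [b, OrthonormalBasis.coe_mk, v, Sum.elim_inl, Sum.elim_inr, Submodule.coe_add,
    Submodule.coe_sum, Submodule.coe_smul, Submodule.coe_inner, inner_sub_right,
    real_inner_smul_right, hsymm (hin _), hsymm (hinJ _), mul_zero, sub_zero] at hsum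
  rw [Finset.sum_add_distrib, hsum, sub_add_cancel]

end NormalForm

/-! ### The eigenvalue estimate for an algebraic curvature tensor -/

section Eigenvalue

variable {V : Type*} [NormedAddCommGroup V] [InnerProductSpace ℝ V]
  {ι : Type*} [Fintype ι] {R : V → V → V → V → ℝ} {n : V} {J : V →ₗ[ℝ] V}

lemma sum_inner_mul (b : OrthonormalBasis ι ℝ V) {F : V → ℝ} (hF : IsLinearMap ℝ F) (x : V) :
    ∑ k, inner ℝ x (b k) * F (b k) = F x := by
  conv_rhs => rw [← b.sum_repr' x]
  change _ = hF.mk' F _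
  rw [map_sum]
  refine Finset.sum_congr rfl fun k _ => ?_
  rw [map_smul, real_inner_comm]
  rfl

lemma sum_inner_mul_inner_mul (b : OrthonormalBasis ι ℝ V) {C : V → V → ℝ}
    (hC₁ : ∀ v, IsLinearMap ℝ (fun u => C u v)) (hC₂ : ∀ u, IsLinearMap ℝ (C u)) (x y : V) :
    ∑ k, ∑ l, inner ℝ x (b k) * inner ℝ y (b l) * C (b k) (b l) = C x y := by
  simp only [mul_assoc, ← Finset.mul_sum, sum_inner_mul b (hC₂ _)]
  exact sum_inner_mul b (hC₁ y) x

/-- `B` is the skew-symmetric operator `∑ₐ cₐ eₐ ∧ J eₐ`, where `u ∧ v` stands for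
`⟨u, ·⟩ v - ⟨v, ·⟩ u`. -/
structure IsDiagonal (n : V) (J : V →ₗ[ℝ] V) (e : Fin 3 → V) (B : V →ₗ[ℝ] V) (c : Fin 3 → ℝ) :
    Prop where
  apply_e : ∀ a, B (e a) = c a • J (e a)
  apply_J : ∀ a, B (J (e a)) = - c a • e a
  apply_n : B n = 0

lemma IsDiagonal.apply {e : Fin 3 → V} {B : V →ₗ[ℝ] V} {c : Fin 3 → ℝ} (hB : IsDiagonal n J e B c)
    (he : IsComplexFrame n J e) (u : V) :
    B u = ∑ a, c a • ((inner ℝ (e a) u : ℝ) • J (e a) - (inner ℝ (J (e a)) u : ℝ) • e a) := by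
  conv_lhs => rw [← he.sum_smul u]
  simp only [map_add, map_sum, map_smul, hB.apply_e, hB.apply_J, hB.apply_n, smul_zero, add_zero]
  refine Finset.sum_congr rfl fun a _ => ?_
  module

/-- The contraction of a skew-symmetric bilinear form with `∑ₐ cₐ eₐ ∧ J eₐ`. -/
lemma IsDiagonal.sum_inner_mul {e : Fin 3 → V} {B : V →ₗ[ℝ] V} {c : Fin 3 → ℝ}
    (hB : IsDiagonal n J e B c) (he : IsComplexFrame n J e) (b : OrthonormalBasis ι ℝ V)
    {C : V → V → ℝ} (hC₁ : ∀ v, IsLinearMap ℝ (fun u => C u v)) (hC₂ : ∀ u, IsLinearMap ℝ (C u))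
    (hC : ∀ u v, C u v = - C v u) :
    ∑ k, ∑ l, inner ℝ (B (b k)) (b l) * C (b k) (b l) = 2 * ∑ a, c a * C (e a) (J (e a)) := by
  have h1 : ∀ k l, inner ℝ (B (b k)) (b l) * C (b k) (b l) = ∑ a, c a *
      (inner ℝ (e a) (b k) * inner ℝ (J (e a)) (b l) * C (b k) (b l)
        - inner ℝ (J (e a)) (b k) * inner ℝ (e a) (b l) * C (b k) (b l)) := by
    intro k l
    rw [hB.apply he, sum_inner, Finset.sum_mul]
    refine Finset.sum_congr rfl fun a _ => ?_
    simp only [real_inner_smul_left, inner_sub_left]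
    ring
  simp only [h1]
  rw [Finset.sum_congr rfl fun k _ => Finset.sum_comm, Finset.sum_comm, Finset.mul_sum]
  refine Finset.sum_congr rfl fun a _ => ?_
  simp only [← Finset.mul_sum, Finset.sum_sub_distrib]
  rw [sum_inner_mul_inner_mul b hC₁ hC₂, sum_inner_mul_inner_mul b hC₁ hC₂, hC (J (e a))]
  ring

lemma IsComplexFrame.inner_J_J {e : Fin 3 → V} (he : IsComplexFrame n J e)
    (hJ : IsComplexStructure n J) (a b : Fin 3) :
    inner ℝ (J (e a)) (J (e b)) = if a = b then (1 : ℝ) else 0 := by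
  rw [hJ.inner_apply_apply, he.inner_e, he.inner_n, zero_mul, sub_zero]

lemma IsComplexStructure.isDiagonal_self {e : Fin 3 → V} (hJ : IsComplexStructure n J)
    (he : IsComplexFrame n J e) : IsDiagonal n J e J (fun _ => 1) where
  apply_e a := by rw [one_smul]
  apply_J a := by rw [hJ.sq, he.inner_n, zero_smul, add_zero, neg_smul, one_smul]
  apply_n := hJ.apply_self

/-- A skew-symmetric operator which commutes with `J` is diagonal in a suitable complex frame. -/
lemma IsComplexStructure.exists_isDiagonal [FiniteDimensional ℝ V] (hJ : IsComplexStructure n J)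
    (hfin : Module.finrank ℝ (Submodule.span ℝ {n}) + 6 = Module.finrank ℝ V)
    {B : V →ₗ[ℝ] V} (hB : ∀ u v, inner ℝ (B u) v = (- inner ℝ u (B v) : ℝ))
    (hBJ : ∀ u, B (J u) = J (B u)) (hBn : B n = 0) :
    ∃ (e : Fin 3 → V) (c : Fin 3 → ℝ), IsComplexFrame n J e ∧ IsDiagonal n J e B c := by
  have hS : (J ∘ₗ B).IsSymmetric := by
    intro u v
    rw [LinearMap.comp_apply, LinearMap.comp_apply, hJ.skew, hB, neg_neg, hBJ]
  obtain ⟨e, he, μ, hμ⟩ := hJ.exists_frame hS (fun u => by simp [hBJ]) (by simp [hBn]) hfin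
  have hBe : ∀ a, B (e a) = (- μ a) • J (e a) := by
    intro a
    have h1 := congrArg J (hμ a)
    rw [LinearMap.comp_apply, hJ.sq, map_smul] at h1
    have h2 := hB n (e a)
    rw [hBn, inner_zero_left, eq_comm, neg_eq_zero] at h2
    rw [h2, zero_smul, add_zero] at h1
    rw [neg_smul, ← h1, neg_neg]
  refine ⟨e, fun a => - μ a, he, hBe, fun a => ?_, hBn⟩
  rw [hBJ, hBe, map_smul, hJ.sq, he.inner_n, zero_smul, add_zero]
  module

/-- The estimate of the eigenvalue `r` of the curvature operator on a `2`-form `β = ⟨B ·, ·⟩`. The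
curvature tensor is compared with the one of constant curvature `κ`: the difference is orthogonal
to the fundamental form `⟨J ·, ·⟩`, and so is `β`. -/
theorem IsCurvatureTensor.eigenvalue_mem [FiniteDimensional ℝ V] (hR : IsCurvatureTensor R)
    {δ Δ κ r : ℝ} (hδ : ∀ u v, δ * (inner ℝ u u * inner ℝ v v - inner ℝ u v ^ 2) ≤ R u v v u)
    (hΔ : ∀ u v, R u v v u ≤ Δ * (inner ℝ u u * inner ℝ v v - inner ℝ u v ^ 2))
    (hκ : κ ∈ Set.Icc δ Δ) (hJ : IsComplexStructure n J)
    (hfin : Module.finrank ℝ (Submodule.span ℝ {n}) + 6 = Module.finrank ℝ V)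
    {B : V →ₗ[ℝ] V} (hB : ∀ u v, inner ℝ (B u) v = (- inner ℝ u (B v) : ℝ))
    (hBJ : ∀ u, B (J u) = J (B u)) (hBn : B n = 0) (hB0 : B ≠ 0) (b : OrthonormalBasis ι ℝ V)
    (hWJ : ∀ u v, ∑ k, ∑ l, inner ℝ (J (b k)) (b l)
      * (R u v (b k) (b l) - κ * constCurv u v (b k) (b l)) = 0)
    (hβJ : ∑ k, ∑ l, inner ℝ (B (b k)) (b l) * inner ℝ (J (b k)) (b l) = (0 : ℝ))
    (hr : ∀ u v, ∑ k, ∑ l, inner ℝ (B (b k)) (b l) * R u v (b k) (b l) = r * inner ℝ (B u) v) :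
    r ∈ Set.Icc (-(Δ + δ) - 7 / 3 * (Δ - δ)) (-(Δ + δ) + 7 / 3 * (Δ - δ)) := by
  obtain ⟨e, c, he, hc⟩ := hJ.exists_isDiagonal hfin hB hBJ hBn
  have heJe : ∀ a b, inner ℝ (J (e a)) (e b) = (0 : ℝ) := fun a b => by
    rw [real_inner_comm, he.inner_J]
  have hK : ∀ a b, constCurv (e a) (J (e a)) (e b) (J (e b)) = if a = b then (-1 : ℝ) else 0 := by
    intro a b
    rw [constCurv, he.inner_J, he.inner_e, he.inner_J_J hJ]
    split_ifs <;> simp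
  -- `β` and `R - κ` are orthogonal to `J`, and `β` is an eigenvector: these facts in the frame are
  -- `hsum`, `hrow` and `heig`.
  have hsum : c 0 + c 1 + c 2 = 0 := by
    have h1 := hc.sum_inner_mul he b (C := fun u v => inner ℝ (J u) v)
      (fun v => ⟨fun _ _ => by rw [map_add, inner_add_left],
        fun _ _ => by rw [map_smul, real_inner_smul_left, smul_eq_mul]⟩)
      (fun u => ⟨fun _ _ => by rw [inner_add_right],
        fun _ _ => by rw [real_inner_smul_right, smul_eq_mul]⟩)
      (fun u v => by rw [hJ.skew, real_inner_comm])
    rw [hβJ, Fin.sum_univ_three] at h1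
    simp only [he.inner_J_J hJ, if_true] at h1
    linarith
  have hrow : ∀ a, ∑ b, R (e a) (J (e a)) (e b) (J (e b)) + κ = 0 := by
    intro a
    have hW := hR.sub_mul isCurvatureTensor_constCurv κ
    have h1 := (hJ.isDiagonal_self he).sum_inner_mul he b
      (C := fun w z => R (e a) (J (e a)) w z - κ * constCurv (e a) (J (e a)) w z)
      (fun v => hW.isLinearMap₃ _ _ _) (fun u => hW.isLinearMap₄ _ _ _)
      (fun u v => hW.antisymm' _ _ _ _)
    rw [hWJ] at h1
    simp only [hK, one_mul, Finset.sum_sub_distrib, ← Finset.mul_sum, Finset.sum_ite_eq,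
      Finset.mem_univ, if_true] at h1
    linarith
  have heig : ∀ a, 2 * ∑ b, c b * R (e a) (J (e a)) (e b) (J (e b)) = r * c a := by
    intro a
    rw [← hc.sum_inner_mul he b (C := fun w z => R (e a) (J (e a)) w z)
      (fun v => hR.isLinearMap₃ _ _ _) (fun u => hR.isLinearMap₄ _ _ _)
      (fun u v => hR.antisymm' _ _ _ _), hr, hc.apply_e, real_inner_smul_left, he.inner_J_J hJ,
      if_pos rfl, mul_one]
  -- the curvature tensor recentred at the midpoint of the interval `[δ, Δ]`
  have hR' := hR.sub_mul isCurvatureTensor_constCurv ((Δ + δ) / 2)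
  have hε : ∀ u v, |R u v v u - (Δ + δ) / 2 * constCurv u v v u| ≤
      (Δ - δ) / 2 * (inner ℝ u u * inner ℝ v v - inner ℝ u v ^ 2) := by
    intro u v
    have h1 := hδ u v
    have h2 := hΔ u v
    rw [constCurv, real_inner_comm u v, abs_le]
    constructor <;> nlinarith
  have hA : ∀ a, |R (e a) (J (e a)) (e a) (J (e a)) + (Δ + δ) / 2| ≤ (Δ - δ) / 2 := by
    intro a
    have h1 := hε (e a) (J (e a))
    simp only [constCurv, he.inner_e, he.inner_J_J hJ, he.inner_J, if_true, heJe] at h1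
    rw [hR.antisymm', ← abs_neg]
    convert h1 using 2 <;> ring
  have hw : ∀ a b, a ≠ b → |R (e a) (J (e a)) (e b) (J (e b))| ≤ 4 / 3 * ((Δ - δ) / 2) := by
    intro a b hab
    have h1 := hR'.abs_apply_le hε (x := e a) (y := J (e a)) (z := e b) (w := J (e b))
      (by rw [he.inner_e, if_pos rfl]) (by rw [he.inner_J_J hJ, if_pos rfl])
      (by rw [he.inner_e, if_pos rfl]) (by rw [he.inner_J_J hJ, if_pos rfl]) (he.inner_J _ _)
      (by simp [he.inner_e, hab]) (he.inner_J _ _) (heJe _ _)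
      (by simp [he.inner_J_J hJ, hab]) (he.inner_J _ _)
    simpa [hK, hab] using h1
  have hsymm : ∀ a b, R (e a) (J (e a)) (e b) (J (e b)) = R (e b) (J (e b)) (e a) (J (e a)) :=
    fun a b => hR.pair_symm _ _ _ _
  have hκ' : |κ - (Δ + δ) / 2| ≤ (Δ - δ) / 2 := by
    rw [abs_le]
    constructor <;> linarith [hκ.1, hκ.2]
  have r0 := hrow 0
  have r1 := hrow 1
  have r2 := hrow 2
  have e0 := heig 0
  have e1 := heig 1
  have e2 := heig 2
  simp only [Fin.sum_univ_three] at r0 r1 r2 e0 e1 e2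
  rw [hsymm 1 0] at r1 e1
  rw [hsymm 2 0, hsymm 2 1] at r2 e2
  have key := abs_le.1 (abs_quadratic_le (hA 0) (hA 1) (hA 2) (hw 0 1 (by decide))
    (hw 0 2 (by decide)) (hw 1 2 (by decide)) hκ' (by linarith) (by linarith) (by linarith) hsum)
  have hpos : 0 < c 0 ^ 2 + c 1 ^ 2 + c 2 ^ 2 := by
    by_contra! hle
    have z0 : c 0 = 0 := by nlinarith [sq_nonneg (c 0), sq_nonneg (c 1), sq_nonneg (c 2)]
    have z1 : c 1 = 0 := by nlinarith [sq_nonneg (c 0), sq_nonneg (c 1), sq_nonneg (c 2)]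
    have z2 : c 2 = 0 := by nlinarith [sq_nonneg (c 0), sq_nonneg (c 1), sq_nonneg (c 2)]
    refine hB0 (LinearMap.ext fun u => ?_)
    rw [hc.apply he, Fin.sum_univ_three, z0, z1, z2]
    simp
  -- The quadratic form of `abs_quadratic_le` at `c` is `½ r |c|² + ½ (Δ + δ) |c|²`.
  have hfinal : r * (c 0 ^ 2 + c 1 ^ 2 + c 2 ^ 2) = c 0 * (r * c 0) + c 1 * (r * c 1)
      + c 2 * (r * c 2) := by ring
  rw [← e0, ← e1, ← e2] at hfinal
  constructor
  · refine le_of_mul_le_mul_right ?_ hpos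
    linear_combination 2 * key.1 - hfinal
  · refine le_of_mul_le_mul_right ?_ hpos
    linear_combination 2 * key.2 + hfinal

lemma gram_pos {u v : V} (h : LinearIndependent ℝ ![u, v]) :
    0 < (inner ℝ u u * inner ℝ v v - inner ℝ u v ^ 2 : ℝ) := by
  have hv : v ≠ 0 := h.ne_zero 1
  have hv0 : 0 < (inner ℝ v v : ℝ) := real_inner_self_pos.2 hv
  have hw : (inner ℝ v v : ℝ) • u + (- inner ℝ u v : ℝ) • v ≠ 0 := fun h0 =>
    hv0.ne' (LinearIndependent.pair_iff.1 h _ _ h0).1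
  have h1 := real_inner_self_pos.2 hw
  simp only [inner_add_left, inner_add_right, real_inner_smul_left, real_inner_smul_right,
    real_inner_comm u v] at h1
  have h2 : 0 < (inner ℝ v v : ℝ) * (inner ℝ u u * inner ℝ v v - inner ℝ u v ^ 2) := by
    linear_combination h1
  exact (mul_pos_iff_of_pos_left hv0).1 h2

/-- Bounds for the sectional curvatures, in the form of inequalities which hold for all pairs of
vectors. -/
lemma IsCurvatureTensor.sectional_bounds (hR : IsCurvatureTensor R) {δ Δ : ℝ}
    (h : ∀ u v, LinearIndependent ℝ ![u, v] →
      R u v v u / (inner ℝ u u * inner ℝ v v - inner ℝ u v ^ 2) ∈ Set.Icc δ Δ) (u v : V) :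
    δ * (inner ℝ u u * inner ℝ v v - inner ℝ u v ^ 2) ≤ R u v v u ∧
      R u v v u ≤ Δ * (inner ℝ u u * inner ℝ v v - inner ℝ u v ^ 2) := by
  by_cases hl : LinearIndependent ℝ ![u, v]
  · have hpos := gram_pos hl
    obtain ⟨h1, h2⟩ := h u v hl
    exact ⟨(le_div_iff₀ hpos).1 h1, (div_le_iff₀ hpos).1 h2⟩
  · have hself : ∀ x w z, R x x w z = 0 := fun x w z => by linarith [hR.antisymm x x w z]
    have hself' : ∀ x w z, R w z x x = 0 := fun x w z => by rw [hR.pair_symm, hself]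
    suffices hz : R u v v u = 0 ∧ (inner ℝ u u * inner ℝ v v - inner ℝ u v ^ 2 : ℝ) = 0 by
      rw [hz.1, hz.2]; simp
    by_cases hv : v = 0
    · subst hv
      have := (hR.isLinearMap₂ u 0 u).map_zero
      simpa using this
    · obtain ⟨a, rfl⟩ : ∃ a : ℝ, a • v = u := by
        by_contra! hne
        exact hl ((LinearIndependent.pair_symm_iff).1
          ((LinearIndependent.pair_iff' hv).2 hne))
      constructor
      · rw [hR.smul_left, hself, mul_zero]
      · simp only [real_inner_smul_left, real_inner_smul_right]
        ring

end Eigenvalue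

/-! ### The curvature tensor at a point -/

section Tangent

variable {n : ℕ} {M : Type*} [TopologicalSpace M] [ChartedSpace (E n) M]
  [Bundle.RiemannianBundle (fun x : M => TangentSpace (𝓡 n) x)]

/-- `L` identifies `ℝⁿ` with the tangent space at `x` through the preferred chart at `x`. -/
structure IsTangentChart (x : M) (L : E n ≃ₗ[ℝ] TangentSpace (𝓡 n) x) : Prop where
  inner_apply : ∀ u v, inner ℝ (L u) (L v) = gmet (chartAt (E n) x) (chartAt (E n) x x) u v
  chartForm_apply : ∀ {k : ℕ} (α : ∀ x : M, TangentSpace (𝓡 n) x [⋀^Fin k]→L[ℝ] ℝ)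
    (v : Fin k → E n), chartForm (chartAt (E n) x) α (chartAt (E n) x x) v = α x (fun s => L (v s))
  mfderiv_apply : ∀ u, mfderiv (𝓡 n) (𝓡 n) (chartAt (E n) x) x (L u) = u

lemma exists_isTangentChart [IsManifold (𝓡 n) ∞ M] (x : M) :
    ∃ L : E n ≃ₗ[ℝ] TangentSpace (𝓡 n) x, IsTangentChart x L := by
  -- The point `e.symm y` is replaced by a variable `p`, since `e.symm (e x) = x` is no definitional
  -- equality and the two tangent spaces have to be identified.
  have key : ∀ (e : OpenPartialHomeomorph M (E n)), e ∈ atlas (E n) M → ∀ y ∈ e.target, ∀ p : M,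
      e.symm y = p → ∃ L : E n ≃ₗ[ℝ] TangentSpace (𝓡 n) p,
        (∀ u v, inner ℝ (L u) (L v) = gmet e y u v) ∧
        (∀ {k : ℕ} (α : ∀ x : M, TangentSpace (𝓡 n) x [⋀^Fin k]→L[ℝ] ℝ) (v : Fin k → E n),
          chartForm e α y v = α p (fun s => L (v s))) ∧
        ∀ u, mfderiv (𝓡 n) (𝓡 n) e p (L u) = u := by
    rintro e he y hy p rfl
    refine ⟨LinearEquiv.ofBijective (mfderiv (𝓡 n) (𝓡 n) e.symm y).toLinearMap
      (mfderiv_symm_bijective he hy), fun u v => rfl, fun α v => rfl, fun u => ?_⟩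
    have h := (mdifferentiable_of_mem_atlas (I := 𝓡 n) he).comp_symm_deriv hy
    exact congrArg (fun T => T u) h
  obtain ⟨L, h1, h2, h3⟩ := key (chartAt (E n) x) (chart_mem_atlas (E n) x) (chartAt (E n) x x)
    (mem_chart_target (E n) x) x ((chartAt (E n) x).left_inv (mem_chart_source (E n) x))
  exact ⟨L, h1, h2, h3⟩

variable [IsManifold (𝓡 n) ∞ M]
  [IsContMDiffRiemannianBundle (𝓡 n) ∞ (E n) (fun x : M => TangentSpace (𝓡 n) x)]

lemma IsTangentChart.riemann_apply {x : M} {L : E n ≃ₗ[ℝ] TangentSpace (𝓡 n) x}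
    (hL : IsTangentChart x L) (u v w z : E n) :
    riemann x (L u) (L v) (L w) (L z) = gmet (chartAt (E n) x) (chartAt (E n) x x)
      (curv (Gam (chartAt (E n) x)) (chartAt (E n) x x) u v w) z := by
  rw [gmet_curv_eq_sum (chart_mem_atlas (E n) x) (mem_chart_target (E n) x)]
  have hc : ∀ i u, coord x i (L u) = u i := by
    intro i u
    exact congrArg (fun a : E n => a i) (hL.mfderiv_apply u)
  simp only [riemann, hc]

lemma isCurvatureTensor_riemann (x : M) : IsCurvatureTensor (riemann (n := n) x) := by
  obtain ⟨L, hL⟩ := exists_isTangentChart (n := n) x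
  have he := chart_mem_atlas (E n) x
  have hy := mem_chart_target (E n) x
  refine ⟨riemann_add_left x, fun c => riemann_smul_left x c, riemann_antisymm x,
    fun u v w z => ?_, fun u v w z => ?_⟩
  all_goals
    obtain ⟨u, rfl⟩ := L.surjective u
    obtain ⟨v, rfl⟩ := L.surjective v
    obtain ⟨w, rfl⟩ := L.surjective w
    obtain ⟨z, rfl⟩ := L.surjective z
    simp only [hL.riemann_apply]
  · exact gmet_curv_pair_symm he hy u v w z
  · rw [← LinearMap.add_apply, ← LinearMap.add_apply, ← map_add, ← map_add,
      curv_cyclic (Gam_symm _), map_zero, LinearMap.zero_apply]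

lemma IsTangentChart.sum_riemann_mul {x : M} {L : E n ≃ₗ[ℝ] TangentSpace (𝓡 n) x}
    (hL : IsTangentChart x L) {ι : Type*} [Fintype ι]
    (b : OrthonormalBasis ι ℝ (TangentSpace (𝓡 n) x)) {F : TangentSpace (𝓡 n) x → ℝ}
    (hF : IsLinearMap ℝ F) (u v w : E n) :
    ∑ m, riemann x (L u) (L v) (L w) (b m) * F (b m) =
      F (L (curv (Gam (chartAt (E n) x)) (chartAt (E n) x x) u v w)) := by
  rw [← sum_inner_mul b hF]
  refine Finset.sum_congr rfl fun m _ => ?_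
  rw [← L.apply_symm_apply (b m), hL.riemann_apply, hL.inner_apply]

end Tangent

/-! ### The curvature takes values in the stabilizer -/

section Action

variable {V : Type*} [NormedAddCommGroup V] [InnerProductSpace ℝ V] {ι : Type*} [Fintype ι]

lemma sum_constCurv_mul (b : OrthonormalBasis ι ℝ V) {F : V → ℝ} (hF : IsLinearMap ℝ F)
    (w u a : V) :
    ∑ m, constCurv w u a (b m) * F (b m) = inner ℝ u a * F w - inner ℝ w a * F u := by
  have : ∀ m, constCurv w u a (b m) * F (b m) = inner ℝ u a * (inner ℝ w (b m) * F (b m))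
      - inner ℝ w a * (inner ℝ u (b m) * F (b m)) := fun m => by
    rw [constCurv]; ring
  simp only [this, Finset.sum_sub_distrib, ← Finset.mul_sum, sum_inner_mul b hF]

/-- The action on the `3`-form `α` of the skew-symmetric endomorphism with components `A`, in an
orthonormal basis. -/
def action₃ (b : ι → V) (α : V →ₗ[ℝ] V →ₗ[ℝ] V →ₗ[ℝ] ℝ) (A : V → V → ℝ) (u v w : V) : ℝ :=
  ∑ m, A u (b m) * α (b m) v w + ∑ m, A v (b m) * α u (b m) w + ∑ m, A w (b m) * α u v (b m)

/-- The action on the `2`-form `α` of the skew-symmetric endomorphism with components `A`, in an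
orthonormal basis. -/
def action₂ (b : ι → V) (α : V →ₗ[ℝ] V →ₗ[ℝ] ℝ) (A : V → V → ℝ) (u v : V) : ℝ :=
  ∑ m, A u (b m) * α (b m) v + ∑ m, A v (b m) * α u (b m)

end Action

section NearlyG2

variable {M : Type*} [TopologicalSpace M] [ChartedSpace (E 7) M]
  [Bundle.RiemannianBundle (fun x : M => TangentSpace (𝓡 7) x)]
  {φ : ∀ x : M, TangentSpace (𝓡 7) x [⋀^Fin 3]→L[ℝ] ℝ}
  {ψ : ∀ x : M, TangentSpace (𝓡 7) x [⋀^Fin 4]→L[ℝ] ℝ}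
  [IsManifold (𝓡 7) ∞ M]
  [IsContMDiffRiemannianBundle (𝓡 7) ∞ (E 7) (fun x : M => TangentSpace (𝓡 7) x)]

/-- The curvature tensor of a nearly `G₂`-manifold, minus a tensor of constant curvature, takes
values in the stabilizer of `φ`. -/
lemma IsNearlyG2.exists_action_eq_zero (h : IsNearlyG2 φ ψ) : ∃ κ : ℝ, ∀ (x : M)
    (b : OrthonormalBasis (Fin 7) ℝ (TangentSpace (𝓡 7) x)) (p q u v w : TangentSpace (𝓡 7) x),
    action₃ b (cur₃ (φ x).toAlternatingMap)
      (fun a c => riemann x p q a c - κ * constCurv p q a c) u v w = 0 := by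
  obtain ⟨τ, -, hφ⟩ := h.dφ
  refine ⟨τ ^ 2 / 16, fun x b p q u v w => ?_⟩
  obtain ⟨L, hL⟩ := exists_isTangentChart (n := 7) x
  obtain ⟨p, rfl⟩ := L.surjective p
  obtain ⟨q, rfl⟩ := L.surjective q
  obtain ⟨u, rfl⟩ := L.surjective u
  obtain ⟨v, rfl⟩ := L.surjective v
  obtain ⟨w, rfl⟩ := L.surjective w
  have hc := h.curv_phi hφ h.dψ (chart_mem_atlas (E 7) x) (mem_chart_target (E 7) x) p q u v w
  have hα : ∀ a b c, chart₃ (chartAt (E 7) x) φ (chartAt (E 7) x x) a b c =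
      cur₃ (φ x).toAlternatingMap (L a) (L b) (L c) := by
    intro a b c
    rw [chart₃_apply, hL.chartForm_apply]
    refine congrArg (φ x) ?_
    ext s; fin_cases s <;> rfl
  set α := cur₃ (φ x).toAlternatingMap with hαdef
  have l1 : ∀ v w, IsLinearMap ℝ (fun m => α m v w) := fun v w =>
    ⟨fun _ _ => by simp, fun _ _ => by simp⟩
  have l2 : ∀ v w, IsLinearMap ℝ (fun m => α v m w) := fun v w =>
    ⟨fun _ _ => by simp, fun _ _ => by simp⟩
  have l3 : ∀ v w, IsLinearMap ℝ (fun m => α v w m) := fun v w =>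
    ⟨fun _ _ => by simp, fun _ _ => by simp⟩
  simp only [action₃, sub_mul, mul_assoc, Finset.sum_sub_distrib, ← Finset.mul_sum]
  rw [hL.sum_riemann_mul b (l1 _ _), hL.sum_riemann_mul b (l2 _ _), hL.sum_riemann_mul b (l3 _ _),
    sum_constCurv_mul b (l1 _ _), sum_constCurv_mul b (l2 _ _), sum_constCurv_mul b (l3 _ _)]
  simp only [hα, ← hL.inner_apply] at hc
  linear_combination hc

end NearlyG2

section NearlyKahler

variable {M : Type*} [TopologicalSpace M] [ChartedSpace (E 6) M]
  [Bundle.RiemannianBundle (fun x : M => TangentSpace (𝓡 6) x)]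
  {om : ∀ x : M, TangentSpace (𝓡 6) x [⋀^Fin 2]→L[ℝ] ℝ}
  {ψp ψm : ∀ x : M, TangentSpace (𝓡 6) x [⋀^Fin 3]→L[ℝ] ℝ}
  [IsManifold (𝓡 6) ∞ M]
  [IsContMDiffRiemannianBundle (𝓡 6) ∞ (E 6) (fun x : M => TangentSpace (𝓡 6) x)]

/-- The curvature tensor of a nearly Kähler manifold, minus the tensor of constant curvature `1`,
takes values in the stabilizer of `ω`. -/
lemma IsNearlyKahler6.action_om_eq_zero (h : IsNearlyKahler6 om ψp ψm) (x : M)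
    (b : OrthonormalBasis (Fin 6) ℝ (TangentSpace (𝓡 6) x)) (p q u v : TangentSpace (𝓡 6) x) :
    action₂ b (cur₂ (om x).toAlternatingMap)
      (fun a c => riemann x p q a c - 1 * constCurv p q a c) u v = 0 := by
  obtain ⟨L, hL⟩ := exists_isTangentChart (n := 6) x
  obtain ⟨p, rfl⟩ := L.surjective p
  obtain ⟨q, rfl⟩ := L.surjective q
  obtain ⟨u, rfl⟩ := L.surjective u
  obtain ⟨v, rfl⟩ := L.surjective v
  have hc := h.curv_om (chart_mem_atlas (E 6) x) (mem_chart_target (E 6) x) p q u v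
  have hβ : ∀ a b, chart₂ (chartAt (E 6) x) om (chartAt (E 6) x x) a b =
      cur₂ (om x).toAlternatingMap (L a) (L b) := by
    intro a b
    rw [chart₂_apply, hL.chartForm_apply]
    refine congrArg (om x) ?_
    ext s; fin_cases s <;> rfl
  set β := cur₂ (om x).toAlternatingMap with hβdef
  have k1 : ∀ v, IsLinearMap ℝ (fun m => β m v) := fun v => ⟨fun _ _ => by simp, fun _ _ => by simp⟩
  have k2 : ∀ v, IsLinearMap ℝ (fun m => β v m) := fun v => ⟨fun _ _ => by simp, fun _ _ => by simp⟩
  simp only [action₂, sub_mul, mul_assoc, Finset.sum_sub_distrib, ← Finset.mul_sum]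
  rw [hL.sum_riemann_mul b (k1 _), hL.sum_riemann_mul b (k2 _),
    sum_constCurv_mul b (k1 _), sum_constCurv_mul b (k2 _)]
  simp only [hβ, ← hL.inner_apply] at hc
  linear_combination hc

/-- The curvature tensor of a nearly Kähler manifold, minus the tensor of constant curvature `1`,
takes values in the stabilizer of `ψ⁺`. -/
lemma IsNearlyKahler6.action_ψp_eq_zero (h : IsNearlyKahler6 om ψp ψm) (x : M)
    (b : OrthonormalBasis (Fin 6) ℝ (TangentSpace (𝓡 6) x)) (p q u v w : TangentSpace (𝓡 6) x) :
    action₃ b (cur₃ (ψp x).toAlternatingMap)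
      (fun a c => riemann x p q a c - 1 * constCurv p q a c) u v w = 0 := by
  obtain ⟨L, hL⟩ := exists_isTangentChart (n := 6) x
  obtain ⟨p, rfl⟩ := L.surjective p
  obtain ⟨q, rfl⟩ := L.surjective q
  obtain ⟨u, rfl⟩ := L.surjective u
  obtain ⟨v, rfl⟩ := L.surjective v
  obtain ⟨w, rfl⟩ := L.surjective w
  have hc := h.curv_ψp (chart_mem_atlas (E 6) x) (mem_chart_target (E 6) x) p q u v w
  have hα : ∀ a b c, chart₃ (chartAt (E 6) x) ψp (chartAt (E 6) x x) a b c =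
      cur₃ (ψp x).toAlternatingMap (L a) (L b) (L c) := by
    intro a b c
    rw [chart₃_apply, hL.chartForm_apply]
    refine congrArg (ψp x) ?_
    ext s; fin_cases s <;> rfl
  set α := cur₃ (ψp x).toAlternatingMap with hαdef
  have l1 : ∀ v w, IsLinearMap ℝ (fun m => α m v w) := fun v w =>
    ⟨fun _ _ => by simp, fun _ _ => by simp⟩
  have l2 : ∀ v w, IsLinearMap ℝ (fun m => α v m w) := fun v w =>
    ⟨fun _ _ => by simp, fun _ _ => by simp⟩
  have l3 : ∀ v w, IsLinearMap ℝ (fun m => α v w m) := fun v w =>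
    ⟨fun _ _ => by simp, fun _ _ => by simp⟩
  simp only [action₃, sub_mul, mul_assoc, Finset.sum_sub_distrib, ← Finset.mul_sum]
  rw [hL.sum_riemann_mul b (l1 _ _), hL.sum_riemann_mul b (l2 _ _), hL.sum_riemann_mul b (l3 _ _),
    sum_constCurv_mul b (l1 _ _), sum_constCurv_mul b (l2 _ _), sum_constCurv_mul b (l3 _ _)]
  simp only [hα, ← hL.inner_apply] at hc
  linear_combination hc

end NearlyKahler

/-! ### The stabilizer of the standard `G₂` form -/

section Components

/-- The contraction of `φ` with `ψ` in one index. -/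
lemma fanoSgn_mul_psi₀ (k l a b c : Fin 7) : fanoSgn k l * psi₀ (fanoMul k l) a b c =
    -(kron a k * phi₀ l b c + kron b k * phi₀ a l c + kron c k * phi₀ a b l)
      + (kron a l * phi₀ k b c + kron b l * phi₀ a k c + kron c l * phi₀ a b k) := by
  revert k l a b c; decide +kernel

/-- The action of a skew-symmetric endomorphism on the standard `G₂` form depends only on its
contraction with that form. -/
lemma sum_action_phi₀ {S : Fin 7 → Fin 7 → ℝ} (hS : ∀ k l, S k l = - S l k) (a b c : Fin 7) :
    ∑ m, S a m * (phi₀ m b c : ℝ) + ∑ m, S b m * (phi₀ a m c : ℝ) + ∑ m, S c m * (phi₀ a b m : ℝ) =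
      -(1 / 2) * ∑ n, psi₀ n a b c * ∑ k, ∑ l, S k l * (phi₀ k l n : ℝ) := by
  have h1 : ∑ n, psi₀ n a b c * ∑ k, ∑ l, S k l * (phi₀ k l n : ℝ) =
      ∑ k, ∑ l, S k l * ((fanoSgn k l * psi₀ (fanoMul k l) a b c : ℤ) : ℝ) := by
    simp only [Finset.mul_sum]
    rw [Finset.sum_comm]
    refine Finset.sum_congr rfl fun k _ => ?_
    rw [Finset.sum_comm]
    refine Finset.sum_congr rfl fun l _ => ?_
    rw [Finset.sum_eq_single (fanoMul k l)]
    · simp [phi₀]; ring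
    · intro n _ hn
      simp [phi₀, hn]
    · simp
  have h2 : ∑ k, ∑ l, S k l * ((kron a l * phi₀ k b c + kron b l * phi₀ a k c
      + kron c l * phi₀ a b k : ℤ) : ℝ) = - ∑ k, ∑ l, S k l * ((kron a k * phi₀ l b c
      + kron b k * phi₀ a l c + kron c k * phi₀ a b l : ℤ) : ℝ) := by
    rw [Finset.sum_comm]
    simp only [← Finset.sum_neg_distrib]
    refine Finset.sum_congr rfl fun l _ => Finset.sum_congr rfl fun k _ => ?_
    rw [hS]; ring
  have h3 : ∑ k, ∑ l, S k l * ((kron a k * phi₀ l b c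
      + kron b k * phi₀ a l c + kron c k * phi₀ a b l : ℤ) : ℝ) =
      ∑ m, S a m * (phi₀ m b c : ℝ) + ∑ m, S b m * (phi₀ a m c : ℝ)
        + ∑ m, S c m * (phi₀ a b m : ℝ) := by
    push_cast
    simp only [mul_add, Finset.sum_add_distrib]
    simp [kron]
  simp only [fanoSgn_mul_psi₀, Int.cast_add, Int.cast_neg, mul_add, mul_neg,
    Finset.sum_add_distrib, Finset.sum_neg_distrib] at h1 h2 h3 ⊢
  linarith

/-- A skew-symmetric endomorphism which stabilizes the standard `G₂` form is orthogonal to the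
contractions of that form. -/
lemma sum_mul_phi₀_eq_zero {S : Fin 7 → Fin 7 → ℝ} (hS : ∀ k l, S k l = - S l k)
    (h : ∀ a b c, ∑ m, S a m * (phi₀ m b c : ℝ) + ∑ m, S b m * (phi₀ a m c : ℝ)
      + ∑ m, S c m * (phi₀ a b m : ℝ) = 0) (n : Fin 7) :
    ∑ k, ∑ l, S k l * (phi₀ k l n : ℝ) = 0 := by
  have h1 : ∀ a b c, ∑ n, psi₀ n a b c * ∑ k, ∑ l, S k l * (phi₀ k l n : ℝ) = 0 := by
    intro a b c
    have := h a b c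
    rw [sum_action_phi₀ hS] at this
    linarith
  obtain ⟨c, hc⟩ : ∃ c : Fin 7 → ℝ, ∀ n, ∑ k, ∑ l, S k l * (phi₀ k l n : ℝ) = c n :=
    ⟨_, fun _ => rfl⟩
  rw [hc]
  simp only [hc] at h1
  revert n
  refine fin_seven_cases ⟨?_, ?_, ?_, ?_, ?_, ?_, ?_⟩
  · simpa [Fin.sum_univ_seven, psi₀, kron, fanoMul, fanoSgn] using h1 1 3 6
  · simpa [Fin.sum_univ_seven, psi₀, kron, fanoMul, fanoSgn] using h1 0 3 6
  · simpa [Fin.sum_univ_seven, psi₀, kron, fanoMul, fanoSgn] using h1 0 3 5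
  · simpa [Fin.sum_univ_seven, psi₀, kron, fanoMul, fanoSgn] using h1 0 1 6
  · simpa [Fin.sum_univ_seven, psi₀, kron, fanoMul, fanoSgn] using h1 0 1 5
  · simpa [Fin.sum_univ_seven, psi₀, kron, fanoMul, fanoSgn] using h1 0 1 4
  · simpa [Fin.sum_univ_seven, psi₀, kron, fanoMul, fanoSgn] using h1 0 1 3

/-- A curvature tensor with values in the stabilizer of the standard `G₂` form is Ricci flat. This
is the component of the Ricci tensor along `e₀`, for `w j k l = R(e₀, eⱼ, e_k, e_l)`. -/
lemma sum_ricci_eq_zero_of_phi₀ {w : Fin 7 → Fin 7 → Fin 7 → ℝ}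
    (hw : ∀ j k l, w j k l = - w j l k) (hcyc : ∀ j k l, w j k l + w k l j + w l j k = 0)
    (h : ∀ j n, ∑ k, ∑ l, w j k l * (phi₀ k l n : ℝ) = 0) : ∑ j, w j j 0 = 0 := by
  have s₁ : ∀ j k l, l < k → w j k l = - w j l k := fun j k l _ => hw j k l
  have s₂ : ∀ j k, w j k k = 0 := fun j k => by linarith [hw j k k]
  have h1 := h 1 2
  have h2 := h 2 1
  have h3 := h 3 4
  have h4 := h 4 3
  have h5 := h 5 6
  have h6 := h 6 5
  have c1 := hcyc 1 3 6
  have c2 := hcyc 1 4 5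
  have c3 := hcyc 2 3 5
  have c4 := hcyc 2 4 6
  simp [Fin.sum_univ_seven, phi₀, fanoMul, fanoSgn, s₁, s₂] at h1 h2 h3 h4 h5 h6 c1 c2 c3 c4 ⊢
  linarith

end Components

/-! ### The stabilizer of the standard `SU(3)`-structure -/

section Components

/-- The index `k` with `ψ⁺ᵢⱼₖ ≠ 0`, for the standard `SU(3)`-structure, if there is one. -/
def suMul : Fin 6 → Fin 6 → Fin 6 :=
  ![![0, 0, 4, 5, 2, 3], ![0, 0, 5, 4, 3, 2], ![4, 5, 0, 0, 0, 1], ![5, 4, 0, 0, 1, 0],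
    ![2, 3, 0, 1, 0, 0], ![3, 2, 1, 0, 0, 0]]

/-- The value of `ψ⁺ᵢⱼₖ` for `k = suMul i j`. -/
def suSgn : Fin 6 → Fin 6 → ℤ :=
  ![![0, 0, 1, -1, -1, 1], ![0, 0, -1, -1, 1, 1], ![-1, 1, 0, 0, 1, -1], ![1, 1, 0, 0, -1, -1],
    ![1, -1, -1, 1, 0, 0], ![-1, -1, 1, 1, 0, 0]]

/-- The components of the standard form `ψ⁺`. -/
def psip₀ (i j k : Fin 6) : ℤ := if k = suMul i j then suSgn i j else 0

/-- The standard complex structure of `ℝ⁶`, on indices: `J eᵢ = ± e_{suConj i}`. -/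
def suConj : Fin 6 → Fin 6 := ![1, 0, 3, 2, 5, 4]

/-- The components of the standard form `ω`. -/
def om₀ (i j : Fin 6) : ℤ := if j = suConj i then ![1, -1, 1, -1, 1, -1] i else 0

lemma minor₃_eq_psip₀ (i j k : Fin 6) :
    minor₃ ![0, 2, 4] i j k - minor₃ ![0, 3, 5] i j k - minor₃ ![1, 2, 5] i j k
      - minor₃ ![1, 3, 4] i j k = psip₀ i j k := by
  revert i j k; decide +kernel

lemma minor₂_eq_om₀ (i j : Fin 6) :
    (kron 0 i * kron 1 j - kron 0 j * kron 1 i) + (kron 2 i * kron 3 j - kron 2 j * kron 3 i)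
      + (kron 4 i * kron 5 j - kron 4 j * kron 5 i) = om₀ i j := by
  revert i j; decide +kernel

lemma sum_om₀_mul_om₀ (i j : Fin 6) : ∑ m, om₀ i m * om₀ j m = kron i j := by
  revert i j; decide +kernel

lemma fin_six_cases {P : Fin 6 → Prop} (h : P 0 ∧ P 1 ∧ P 2 ∧ P 3 ∧ P 4 ∧ P 5) (i : Fin 6) :
    P i := by
  obtain ⟨h0, h1, h2, h3, h4, h5⟩ := h
  fin_cases i <;> assumption

/-- The skew-symmetric endomorphisms orthogonal to the contractions of `ψ⁺` are complex linear. -/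
lemma sum_action_om₀_eq_zero {S : Fin 6 → Fin 6 → ℝ} (hS : ∀ k l, S k l = - S l k)
    (h : ∀ m, ∑ k, ∑ l, S k l * (psip₀ k l m : ℝ) = 0) (a b : Fin 6) :
    ∑ m, S a m * (om₀ m b : ℝ) + ∑ m, S b m * (om₀ a m : ℝ) = 0 := by
  have s₁ : ∀ k l, l < k → S k l = - S l k := fun k l _ => hS k l
  have s₂ : ∀ k, S k k = 0 := fun k => by linarith [hS k k]
  have h0 := h 0
  have h1 := h 1
  have h2 := h 2
  have h3 := h 3
  have h4 := h 4
  have h5 := h 5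
  simp [Fin.sum_univ_six, psip₀, suMul, suSgn, s₁, s₂] at h0 h1 h2 h3 h4 h5
  revert a b
  refine fin_six_cases ⟨?_, ?_, ?_, ?_, ?_, ?_⟩ <;>
    refine fin_six_cases ⟨?_, ?_, ?_, ?_, ?_, ?_⟩ <;>
    simp [Fin.sum_univ_six, om₀, suConj, s₁, s₂] <;> linarith

/-- The complex linear skew-symmetric endomorphisms are orthogonal to the contractions of `ψ⁺`. -/
lemma sum_mul_psip₀_eq_zero {S : Fin 6 → Fin 6 → ℝ} (hS : ∀ k l, S k l = - S l k)
    (h : ∀ a b, ∑ m, S a m * (om₀ m b : ℝ) + ∑ m, S b m * (om₀ a m : ℝ) = 0) (m : Fin 6) :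
    ∑ k, ∑ l, S k l * (psip₀ k l m : ℝ) = 0 := by
  have s₁ : ∀ k l, l < k → S k l = - S l k := fun k l _ => hS k l
  have s₂ : ∀ k, S k k = 0 := fun k => by linarith [hS k k]
  have h0 := h 0 2
  have h1 := h 0 3
  have h2 := h 0 4
  have h3 := h 0 5
  have h4 := h 2 4
  have h5 := h 2 5
  simp [Fin.sum_univ_six, om₀, suConj, s₁, s₂] at h0 h1 h2 h3 h4 h5
  revert m
  refine fin_six_cases ⟨?_, ?_, ?_, ?_, ?_, ?_⟩ <;>
    simp [Fin.sum_univ_six, psip₀, suMul, suSgn, s₁, s₂] <;> linarith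

/-- A skew-symmetric endomorphism which stabilizes `ψ⁺` is orthogonal to `ω`. -/
lemma sum_mul_om₀_eq_zero {S : Fin 6 → Fin 6 → ℝ} (hS : ∀ k l, S k l = - S l k)
    (h : ∀ a b c, ∑ m, S a m * (psip₀ m b c : ℝ) + ∑ m, S b m * (psip₀ a m c : ℝ)
      + ∑ m, S c m * (psip₀ a b m : ℝ) = 0) :
    ∑ k, ∑ l, S k l * (om₀ k l : ℝ) = 0 := by
  have s₁ : ∀ k l, l < k → S k l = - S l k := fun k l _ => hS k l
  have s₂ : ∀ k, S k k = 0 := fun k => by linarith [hS k k]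
  have h0 := h 0 2 5
  simp [Fin.sum_univ_six, psip₀, suMul, suSgn, s₁] at h0
  simp [Fin.sum_univ_six, om₀, suConj, s₁, s₂]
  linarith

/-- A curvature tensor with values in `su(3)` is Ricci flat. This is the component of the Ricci
tensor along `e₀`, for `w j k l = R(e₀, eⱼ, e_k, e_l)`. -/
lemma sum_ricci_eq_zero_of_om₀ {w : Fin 6 → Fin 6 → Fin 6 → ℝ}
    (hw : ∀ j k l, w j k l = - w j l k) (hcyc : ∀ j k l, w j k l + w k l j + w l j k = 0)
    (h : ∀ j a b, ∑ m, w j a m * (om₀ m b : ℝ) + ∑ m, w j b m * (om₀ a m : ℝ) = 0)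
    (htr : ∀ j, ∑ k, ∑ l, w j k l * (om₀ k l : ℝ) = 0) : ∑ j, w j j 0 = 0 := by
  have s₁ : ∀ j k l, l < k → w j k l = - w j l k := fun j k l _ => hw j k l
  have s₂ : ∀ j k, w j k k = 0 := fun j k => by linarith [hw j k k]
  have h1 := htr 1
  have h2 := h 2 0 3
  have h3 := h 3 0 2
  have h4 := h 4 0 5
  have h5 := h 5 0 4
  have c1 := hcyc 1 2 3
  have c2 := hcyc 1 4 5
  simp [Fin.sum_univ_six, om₀, suConj, s₁, s₂] at h1 h2 h3 h4 h5 c1 c2 ⊢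
  linarith

end Components

/-! ### The eigenvalue estimate at a point -/

section Operators

variable {V : Type*} [NormedAddCommGroup V] [InnerProductSpace ℝ V] {ι : Type*} [Fintype ι]

/-- The operator `B` with `⟨B u, v⟩ = β(u, v)`. -/
noncomputable def operatorOf (b : OrthonormalBasis ι ℝ V) (β : V →ₗ[ℝ] V →ₗ[ℝ] ℝ) : V →ₗ[ℝ] V :=
  ∑ k, (β.flip (b k)).smulRight (b k)

lemma inner_operatorOf (b : OrthonormalBasis ι ℝ V) (β : V →ₗ[ℝ] V →ₗ[ℝ] ℝ) (u v : V) :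
    inner ℝ (operatorOf b β u) v = β u v := by
  rw [operatorOf, LinearMap.sum_apply, sum_inner]
  conv_rhs => rw [← b.sum_repr' v, map_sum]
  refine Finset.sum_congr rfl fun k _ => ?_
  simp [real_inner_smul_left, mul_comm]

lemma inner_operatorOf_skew (b : OrthonormalBasis ι ℝ V) {β : V →ₗ[ℝ] V →ₗ[ℝ] ℝ}
    (hβ : ∀ u v, β u v = - β v u) (u v : V) :
    inner ℝ (operatorOf b β u) v = (- inner ℝ u (operatorOf b β v) : ℝ) := by
  rw [real_inner_comm _ u, inner_operatorOf, inner_operatorOf, hβ]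

lemma operatorOf_ne_zero (b : OrthonormalBasis ι ℝ V) {β : V →ₗ[ℝ] V →ₗ[ℝ] ℝ} (hβ : β ≠ 0) :
    operatorOf b β ≠ 0 := by
  intro h
  refine hβ (LinearMap.ext fun u => LinearMap.ext fun v => ?_)
  rw [← inner_operatorOf b β, h]
  simp

/-- A skew-symmetric form on an odd-dimensional space has a unit vector in its kernel. -/
lemma exists_unit_kernel {k : ℕ} (hk : Odd k) (b : OrthonormalBasis (Fin k) ℝ V)
    {β : V →ₗ[ℝ] V →ₗ[ℝ] ℝ} (hβ : ∀ u v, β u v = - β v u) :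
    ∃ n : V, inner ℝ n n = (1 : ℝ) ∧ ∀ v, β n v = 0 := by
  let A : Matrix (Fin k) (Fin k) ℝ := Matrix.of fun i j => β (b i) (b j)
  have hA : A.transpose = -A := by
    ext i j
    exact hβ _ _
  have hdet : A.det = 0 := by
    have h1 : A.det = (-1) ^ k * A.det := by
      conv_lhs => rw [← Matrix.det_transpose, hA, Matrix.det_neg]
      simp
    rw [hk.neg_one_pow] at h1
    linarith
  obtain ⟨c, hc0, hc⟩ := Matrix.exists_vecMul_eq_zero_iff.2 hdet
  set n : V := ∑ i, c i • b i with hn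
  have hn0 : n ≠ 0 := by
    intro h0
    apply hc0
    ext i
    exact linearIndependent_iff'.1 b.toBasis.linearIndependent Finset.univ c
      (by simpa [hn] using h0) i (Finset.mem_univ _)
  have hβn : ∀ v, β n v = 0 := by
    intro v
    refine eq_zero_of_basis b.toBasis (F := fun v => β n v)
      ⟨fun _ _ => map_add _ _ _, fun _ _ => map_smul _ _ _⟩ (fun j => ?_) v
    have := congrFun hc j
    simpa [hn, Matrix.vecMul, dotProduct, A] using this
  refine ⟨‖n‖⁻¹ • n, ?_, fun v => by simp [hβn]⟩
  rw [real_inner_smul_left, real_inner_smul_right, real_inner_self_eq_norm_sq]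
  have := norm_ne_zero_iff.2 hn0
  field_simp

/-- The constant `κ` lies between the bounds of the sectional curvature, if one component of the
Ricci tensor of `R - κ` vanishes. -/
lemma mem_Icc_of_ricci {k : ℕ} (b : OrthonormalBasis (Fin (k + 2)) ℝ V) {R : V → V → V → V → ℝ}
    (hR : IsCurvatureTensor R) {δ Δ κ : ℝ}
    (hδ : ∀ u v, δ * (inner ℝ u u * inner ℝ v v - inner ℝ u v ^ 2) ≤ R u v v u)
    (hΔ : ∀ u v, R u v v u ≤ Δ * (inner ℝ u u * inner ℝ v v - inner ℝ u v ^ 2))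
    (h : ∑ j, (R (b 0) (b j) (b j) (b 0) - κ * constCurv (b 0) (b j) (b j) (b 0)) = 0) :
    κ ∈ Set.Icc δ Δ := by
  have hin := b.inner_eq_ite
  have h0 : R (b 0) (b 0) (b 0) (b 0) - κ * constCurv (b 0) (b 0) (b 0) (b 0) = 0 := by
    have := hR.antisymm (b 0) (b 0) (b 0) (b 0)
    rw [constCurv, sub_self]
    linarith
  have hK : ∀ j : Fin (k + 1), constCurv (b 0) (b j.succ) (b j.succ) (b 0) = 1 := by
    intro j
    simp [constCurv, hin, (Fin.succ_ne_zero j).symm]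
  have hG : ∀ j : Fin (k + 1), (inner ℝ (b 0) (b 0) * inner ℝ (b j.succ) (b j.succ)
      - inner ℝ (b 0) (b j.succ) ^ 2 : ℝ) = 1 := by
    intro j
    simp [hin, (Fin.succ_ne_zero j).symm]
  rw [Fin.sum_univ_succ, h0, zero_add, Finset.sum_sub_distrib] at h
  simp only [hK, mul_one, Finset.sum_const, Finset.card_univ, Fintype.card_fin, nsmul_eq_mul] at h
  have hpos : (0 : ℝ) < ((k + 1 : ℕ) : ℝ) := by positivity
  have h1 : ∑ j : Fin (k + 1), δ ≤ ∑ j : Fin (k + 1), R (b 0) (b j.succ) (b j.succ) (b 0) :=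
    Finset.sum_le_sum fun j _ => by
    have := hδ (b 0) (b j.succ)
    rwa [hG, mul_one] at this
  have h2 : ∑ j : Fin (k + 1), R (b 0) (b j.succ) (b j.succ) (b 0) ≤ ∑ j : Fin (k + 1), Δ :=
    Finset.sum_le_sum fun j _ => by
    have := hΔ (b 0) (b j.succ)
    rwa [hG, mul_one] at this
  simp only [Finset.sum_const, Finset.card_univ, Fintype.card_fin, nsmul_eq_mul] at h1 h2
  constructor
  · refine le_of_mul_le_mul_left ?_ hpos
    linarith
  · refine le_of_mul_le_mul_left ?_ hpos
    linarith

end Operators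

section G2

variable {V : Type*} [NormedAddCommGroup V] [InnerProductSpace ℝ V]
  {b : OrthonormalBasis (Fin 7) ℝ V} {α : V →ₗ[ℝ] V →ₗ[ℝ] V →ₗ[ℝ] ℝ}

lemma phi₀_cyclic (i j k : Fin 7) : phi₀ i j k = phi₀ j k i := by
  revert i j k; decide +kernel

lemma phi₀_antisymm (i j k : Fin 7) : phi₀ i j k = - phi₀ i k j := by
  revert i j k; decide +kernel

lemma psi₀_swap (i j k l : Fin 7) : psi₀ i j k l = - psi₀ k j i l := by
  revert i j k l; decide +kernel

lemma trilinear_eq_zero_of_basis {F : V → V → V → ℝ} (b : OrthonormalBasis (Fin 7) ℝ V)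
    (h1 : ∀ v w, IsLinearMap ℝ (fun u => F u v w)) (h2 : ∀ u w, IsLinearMap ℝ (fun v => F u v w))
    (h3 : ∀ u v, IsLinearMap ℝ (fun w => F u v w)) (h : ∀ i j k, F (b i) (b j) (b k) = 0)
    (u v w : V) : F u v w = 0 := by
  refine eq_zero_of_basis b.toBasis (h1 v w) (fun i => ?_) u
  refine eq_zero_of_basis b.toBasis (h2 _ w) (fun j => ?_) v
  refine eq_zero_of_basis b.toBasis (h3 _ _) (fun k => ?_) w
  simpa using h i j k

lemma trilinear_cyclic (hα : ∀ i j k, α (b i) (b j) (b k) = (phi₀ i j k : ℝ)) (u v w : V) :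
    α u v w = α v w u := by
  rw [← sub_eq_zero]
  refine trilinear_eq_zero_of_basis (F := fun u v w => α u v w - α v w u) b
    (fun _ _ => ⟨fun _ _ => by simp; ring, fun _ _ => by simp; ring⟩)
    (fun _ _ => ⟨fun _ _ => by simp; ring, fun _ _ => by simp; ring⟩)
    (fun _ _ => ⟨fun _ _ => by simp; ring, fun _ _ => by simp; ring⟩) (fun i j k => ?_) u v w
  rw [hα, hα, phi₀_cyclic, sub_self]

lemma trilinear_antisymm (hα : ∀ i j k, α (b i) (b j) (b k) = (phi₀ i j k : ℝ)) (u v w : V) :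
    α u v w = - α u w v := by
  rw [← sub_eq_zero]
  refine trilinear_eq_zero_of_basis (F := fun u v w => α u v w - - α u w v) b
    (fun _ _ => ⟨fun _ _ => by simp; ring, fun _ _ => by simp; ring⟩)
    (fun _ _ => ⟨fun _ _ => by simp; ring, fun _ _ => by simp; ring⟩)
    (fun _ _ => ⟨fun _ _ => by simp; ring, fun _ _ => by simp; ring⟩) (fun i j k => ?_) u v w
  rw [hα, hα, phi₀_antisymm]
  simp

/-- For a unit vector `n` the contraction `n ⌟ φ` is a complex structure on the orthogonal
complement of `n`. The proof polarizes in `n`, since then `ψ` drops out of the contraction identity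
for `φ ⊗ φ`. -/
lemma sum_trilinear_mul (hα : ∀ i j k, α (b i) (b j) (b k) = (phi₀ i j k : ℝ)) (n u v : V) :
    ∑ m, α n u (b m) * α n v (b m) = inner ℝ n n * inner ℝ u v - inner ℝ n u * inner ℝ n v := by
  have key : ∀ x y u v, ∑ m, α x u (b m) * α y v (b m) + ∑ m, α y u (b m) * α x v (b m) =
      2 * (inner ℝ x y * inner ℝ u v) - inner ℝ x v * inner ℝ u y - inner ℝ y v * inner ℝ u x := by
    intro x y u v
    rw [← sub_eq_zero]
    refine eq_zero_of_basis b.toBasis (F := fun v =>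
      ∑ m, α x u (b m) * α y v (b m) + ∑ m, α y u (b m) * α x v (b m) -
        (2 * (inner ℝ x y * inner ℝ u v) - inner ℝ x v * inner ℝ u y - inner ℝ y v * inner ℝ u x))
      ⟨fun _ _ => by simp [inner_add_right, mul_add, Finset.sum_add_distrib]; ring,
        fun _ _ => by simp [inner_smul_right, mul_left_comm, ← Finset.mul_sum]; ring⟩
      (fun l => ?_) v
    refine trilinear_eq_zero_of_basis (F := fun x y u =>
      ∑ m, α x u (b m) * α y (b.toBasis l) (b m) + ∑ m, α y u (b m) * α x (b.toBasis l) (b m) -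
        (2 * (inner ℝ x y * inner ℝ u (b.toBasis l)) - inner ℝ x (b.toBasis l) * inner ℝ u y
          - inner ℝ y (b.toBasis l) * inner ℝ u x)) b (fun _ _ => ⟨fun _ _ => ?_, fun _ _ => ?_⟩)
        (fun _ _ => ⟨fun _ _ => ?_, fun _ _ => ?_⟩) (fun _ _ => ⟨fun _ _ => ?_, fun _ _ => ?_⟩)
        (fun i j k => ?_) x y u
    · simp [inner_add_right, inner_add_left, mul_add, add_mul, Finset.sum_add_distrib]; ring
    · simp [inner_smul_right, inner_smul_left, mul_left_comm, mul_assoc, ← Finset.mul_sum]; ring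
    · simp [inner_add_right, inner_add_left, mul_add, add_mul, Finset.sum_add_distrib]; ring
    · simp [inner_smul_right, inner_smul_left, mul_left_comm, mul_assoc, ← Finset.mul_sum]; ring
    · simp [inner_add_left, mul_add, add_mul, Finset.sum_add_distrib]; ring
    · simp [inner_smul_left, mul_left_comm, mul_assoc, ← Finset.mul_sum]; ring
    · have e1 := sum_phi₀_mul_phi₀ i k j l
      have e2 := sum_phi₀_mul_phi₀ j k i l
      have e3 := psi₀_swap i k j l
      have e4 : kron j i = kron i j := by simp only [kron, eq_comm]
      rw [e4] at e2
      simp only [OrthonormalBasis.coe_toBasis, hα, inner_basis_eq_kron]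
      rify at e1 e2 e3
      linear_combination e1 + e2 - e3
  have := key n n u v
  rw [real_inner_comm n u] at this
  linarith

/-- A curvature tensor `R - κ` with values in the stabilizer of `φ` is orthogonal to the
contractions of `φ`. -/
lemma IsCurvatureTensor.sum_trilinear_eq_zero {R : V → V → V → V → ℝ} {κ : ℝ}
    (hR : IsCurvatureTensor R) (hα : ∀ i j k, α (b i) (b j) (b k) = (phi₀ i j k : ℝ))
    (hW : ∀ p q u v w, action₃ b α (fun a c => R p q a c - κ * constCurv p q a c) u v w = 0)
    (p q w : V) :
    ∑ k, ∑ l, (R p q (b k) (b l) - κ * constCurv p q (b k) (b l)) * α (b k) (b l) w = 0 := by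
  have hW' := hR.sub_mul isCurvatureTensor_constCurv κ
  refine eq_zero_of_basis b.toBasis (F := fun w => ∑ k, ∑ l, (R p q (b k) (b l) -
    κ * constCurv p q (b k) (b l)) * α (b k) (b l) w)
    ⟨fun _ _ => by simp [mul_add, Finset.sum_add_distrib],
      fun _ _ => by simp [mul_left_comm, ← Finset.mul_sum]⟩ (fun n => ?_) w
  simp only [OrthonormalBasis.coe_toBasis, hα]
  refine sum_mul_phi₀_eq_zero (S := fun k l => R p q (b k) (b l) -
    κ * constCurv p q (b k) (b l)) (fun k l => hW'.antisymm' p q (b k) (b l)) (fun i j k => ?_) n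
  have := hW p q (b i) (b j) (b k)
  simpa only [action₃, hα] using this

/-- The eigenvalue estimate at a point of a nearly `G₂`-manifold. As the dimension is odd, the form
`β` kills a unit vector `n`, and `β ∈ 𝔤₂` then lies in the copy of `𝔰𝔲(3)` which stabilizes `n`; the
complex structure is `n ⌟ φ`. -/
theorem IsCurvatureTensor.eigenvalue_mem_of_phi₀ [FiniteDimensional ℝ V] {R : V → V → V → V → ℝ}
    {δ Δ κ r : ℝ} (hR : IsCurvatureTensor R)
    (hsec : ∀ u v, LinearIndependent ℝ ![u, v] →
      R u v v u / (inner ℝ u u * inner ℝ v v - inner ℝ u v ^ 2) ∈ Set.Icc δ Δ)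
    (hα : ∀ i j k, α (b i) (b j) (b k) = (phi₀ i j k : ℝ))
    (hW : ∀ p q u v w, action₃ b α (fun a c => R p q a c - κ * constCurv p q a c) u v w = 0)
    {β : V →ₗ[ℝ] V →ₗ[ℝ] ℝ} (hβ : ∀ u v, β u v = - β v u) (hβ0 : β ≠ 0)
    (hβα : ∀ w, ∑ k, ∑ l, β (b k) (b l) * α (b k) (b l) w = 0)
    (hr : ∀ u v, ∑ k, ∑ l, β (b k) (b l) * R u v (b k) (b l) = r * β u v) :
    r ∈ Set.Icc (-(Δ + δ) - 7 / 3 * (Δ - δ)) (-(Δ + δ) + 7 / 3 * (Δ - δ)) := by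
  have hδ := fun u v => (hR.sectional_bounds hsec u v).1
  have hΔ := fun u v => (hR.sectional_bounds hsec u v).2
  have hW' := hR.sub_mul isCurvatureTensor_constCurv κ
  have hWα := hR.sum_trilinear_eq_zero hα hW
  have hκ : κ ∈ Set.Icc δ Δ := by
    refine mem_Icc_of_ricci (k := 5) b hR hδ hΔ (sum_ricci_eq_zero_of_phi₀ (w := fun j k l =>
      R (b 0) (b j) (b k) (b l) - κ * constCurv (b 0) (b j) (b k) (b l))
      (fun j k l => hW'.antisymm' ..) (fun j k l => ?_) fun j n => ?_)
    · have e1 := hW'.cyclic (b j) (b k) (b l) (b 0)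
      have e2 := fun j k l => (hW'.pair_symm (b j) (b k) (b l) (b 0)).trans (hW'.antisymm ..)
      simp only [e2] at e1
      linarith
    · simpa only [hα] using hWα (b 0) (b j) (b n)
  obtain ⟨n, hn1, hn⟩ := exists_unit_kernel (by decide) b hβ
  have hcyc := trilinear_cyclic hα
  have hanti := trilinear_antisymm hα
  have hJskew : ∀ u v, α n u v = - α n v u := fun u v => hanti n u v
  have hnn : ∀ v, α n n v = 0 := fun v => by
    rw [hcyc, hcyc]
    linarith [hanti v n n]
  have hJ := inner_operatorOf b (α n)
  have hB := inner_operatorOf b β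
  have hBn : operatorOf b β n = 0 := by
    rw [← inner_self_eq_zero (𝕜 := ℝ), hB, hn]
  have hJn : operatorOf b (α n) n = 0 := by
    rw [← inner_self_eq_zero (𝕜 := ℝ), hJ, hnn]
  have hcs : IsComplexStructure n (operatorOf b (α n)) := by
    refine ⟨inner_operatorOf_skew b hJskew, fun u => ext_inner_right ℝ fun v => ?_, hJn⟩
    rw [inner_operatorOf_skew b hJskew, inner_add_left, inner_neg_left, real_inner_smul_left,
      ← b.sum_inner_mul_inner]
    have : ∀ m, inner ℝ (operatorOf b (α n) u) (b m) * inner ℝ (b m) (operatorOf b (α n) v) =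
        α n u (b m) * α n v (b m) := by
      intro m
      rw [hJ, real_inner_comm, hJ]
    simp only [this, sum_trilinear_mul hα, hn1]
    ring
  -- `β` lies in the stabilizer of `φ`, hence commutes with the contraction of `φ` with `n`
  have hact : ∀ u v w, action₃ b α (fun a c => β a c) u v w = 0 := by
    have hlin : ∀ {F : V → ℝ}, IsLinearMap ℝ F → ∀ u, ∑ m, β u (b m) * F (b m) =
        F (operatorOf b β u) := by
      intro F hF u
      rw [← sum_inner_mul b hF]
      simp only [hB]
    have l1 : ∀ v w, IsLinearMap ℝ (fun m => α m v w) := fun v w =>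
      ⟨fun _ _ => by simp, fun _ _ => by simp⟩
    have l2 : ∀ v w, IsLinearMap ℝ (fun m => α v m w) := fun v w =>
      ⟨fun _ _ => by simp, fun _ _ => by simp⟩
    have l3 : ∀ v w, IsLinearMap ℝ (fun m => α v w m) := fun v w =>
      ⟨fun _ _ => by simp, fun _ _ => by simp⟩
    refine trilinear_eq_zero_of_basis b (fun v w => ?_) (fun u w => ?_) (fun u v => ?_)
      fun i j k => ?_
    · simp only [action₃, hlin (l1 _ _), hlin (l2 _ _), hlin (l3 _ _)]
      exact ⟨fun _ _ => by simp; ring, fun _ _ => by simp; ring⟩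
    · simp only [action₃, hlin (l1 _ _), hlin (l2 _ _), hlin (l3 _ _)]
      exact ⟨fun _ _ => by simp; ring, fun _ _ => by simp; ring⟩
    · simp only [action₃, hlin (l1 _ _), hlin (l2 _ _), hlin (l3 _ _)]
      exact ⟨fun _ _ => by simp; ring, fun _ _ => by simp; ring⟩
    · simp only [action₃, hα]
      rw [sum_action_phi₀ (S := fun i j => β (b i) (b j)) (fun i j => hβ (b i) (b j))]
      have : ∀ n, ∑ k, ∑ l, β (b k) (b l) * (phi₀ k l n : ℝ) = 0 := fun n => by
        simpa only [hα] using hβα (b n)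
      simp only [this, mul_zero, Finset.sum_const_zero]
  have hcomm : ∀ u, operatorOf b β (operatorOf b (α n) u) =
      operatorOf b (α n) (operatorOf b β u) := by
    intro u
    refine ext_inner_right ℝ fun v => ?_
    have h0 := hact n u v
    simp only [action₃, hn, zero_mul, Finset.sum_const_zero, zero_add] at h0
    simp only [← hB _ (b _)] at h0
    rw [sum_inner_mul b (F := fun m => α n m v) ⟨fun _ _ => by simp, fun _ _ => by simp⟩,
      sum_inner_mul b (F := fun m => α n u m) ⟨fun _ _ => by simp, fun _ _ => by simp⟩] at h0
    rw [inner_operatorOf_skew b hβ, hJ, hJ]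
    linarith
  refine hR.eigenvalue_mem hδ hΔ hκ hcs ?_ (inner_operatorOf_skew b hβ) hcomm hBn
    (operatorOf_ne_zero b hβ0) b (fun u v => ?_) ?_ (fun u v => ?_)
  · have hn0 : n ≠ 0 := by
      rintro rfl
      simp at hn1
    rw [finrank_span_singleton hn0, Module.finrank_eq_card_basis b.toBasis]
    simp
  · simp only [hJ, hcyc n]
    rw [← hWα u v n]
    exact Finset.sum_congr rfl fun k _ => Finset.sum_congr rfl fun l _ => mul_comm _ _
  · simp only [hJ, hB, hcyc n]
    exact hβα n
  · simp only [hB]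
    exact hr u v

end G2

section SU3

variable {V : Type*} [NormedAddCommGroup V] [InnerProductSpace ℝ V]
  {b : OrthonormalBasis (Fin 6) ℝ V} {α : V →ₗ[ℝ] V →ₗ[ℝ] V →ₗ[ℝ] ℝ} {σ : V →ₗ[ℝ] V →ₗ[ℝ] ℝ}

lemma om₀_antisymm (i j : Fin 6) : om₀ i j = - om₀ j i := by
  revert i j; decide +kernel

lemma bilinear_eq_zero_of_basis {F : V → V → ℝ} (b : OrthonormalBasis (Fin 6) ℝ V)
    (h1 : ∀ v, IsLinearMap ℝ (fun u => F u v)) (h2 : ∀ u, IsLinearMap ℝ (fun v => F u v))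
    (h : ∀ i j, F (b i) (b j) = 0) (u v : V) : F u v = 0 := by
  refine eq_zero_of_basis b.toBasis (h1 v) (fun i => ?_) u
  refine eq_zero_of_basis b.toBasis (h2 _) (fun j => ?_) v
  simpa using h i j

lemma bilinear_antisymm (hω : ∀ i j, σ (b i) (b j) = (om₀ i j : ℝ)) (u v : V) :
    σ u v = - σ v u := by
  rw [← sub_eq_zero]
  refine bilinear_eq_zero_of_basis (F := fun u v => σ u v - - σ v u) b
    (fun _ => ⟨fun _ _ => by simp; ring, fun _ _ => by simp; ring⟩)
    (fun _ => ⟨fun _ _ => by simp; ring, fun _ _ => by simp; ring⟩) (fun i j => ?_) u v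
  rw [hω, hω, om₀_antisymm]
  simp

lemma sum_bilinear_mul (hω : ∀ i j, σ (b i) (b j) = (om₀ i j : ℝ)) (u v : V) :
    ∑ m, σ u (b m) * σ v (b m) = inner ℝ u v := by
  rw [← sub_eq_zero]
  refine bilinear_eq_zero_of_basis (F := fun u v => ∑ m, σ u (b m) * σ v (b m) - inner ℝ u v) b
    (fun _ => ⟨fun _ _ => ?_, fun _ _ => ?_⟩)
    (fun _ => ⟨fun _ _ => ?_, fun _ _ => ?_⟩) (fun i j => ?_) u v
  · simp [inner_add_left, add_mul, Finset.sum_add_distrib]; ring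
  · simp [inner_smul_left, mul_assoc, ← Finset.mul_sum]; ring
  · simp [inner_add_right, mul_add, Finset.sum_add_distrib]; ring
  · simp [inner_smul_right, mul_left_comm, ← Finset.mul_sum]; ring
  · simp only [hω, inner_basis_eq_kron]
    rw [sub_eq_zero]
    exact_mod_cast sum_om₀_mul_om₀ i j

/-- A curvature tensor `R - κ` with values in the stabilizer of `ψ⁺` is orthogonal to `ω`. -/
lemma IsCurvatureTensor.sum_bilinear_eq_zero {R : V → V → V → V → ℝ} {κ : ℝ}
    (hR : IsCurvatureTensor R) (hω : ∀ i j, σ (b i) (b j) = (om₀ i j : ℝ))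
    (hα : ∀ i j k, α (b i) (b j) (b k) = (psip₀ i j k : ℝ))
    (hW : ∀ p q u v w, action₃ b α (fun a c => R p q a c - κ * constCurv p q a c) u v w = 0)
    (p q : V) :
    ∑ k, ∑ l, (R p q (b k) (b l) - κ * constCurv p q (b k) (b l)) * σ (b k) (b l) = 0 := by
  have hW' := hR.sub_mul isCurvatureTensor_constCurv κ
  simp only [hω]
  refine sum_mul_om₀_eq_zero (S := fun k l => R p q (b k) (b l) -
    κ * constCurv p q (b k) (b l)) (fun k l => hW'.antisymm' p q (b k) (b l)) (fun i j k => ?_)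
  have := hW p q (b i) (b j) (b k)
  simpa only [action₃, hα] using this

/-- A curvature tensor `R - κ` with values in the stabilizer of `ω` is orthogonal to the
contractions of `ψ⁺`. -/
lemma IsCurvatureTensor.sum_psip_eq_zero {R : V → V → V → V → ℝ} {κ : ℝ}
    (hR : IsCurvatureTensor R) (hω : ∀ i j, σ (b i) (b j) = (om₀ i j : ℝ))
    (hα : ∀ i j k, α (b i) (b j) (b k) = (psip₀ i j k : ℝ))
    (hW : ∀ p q u v, action₂ b σ (fun a c => R p q a c - κ * constCurv p q a c) u v = 0)
    (p q w : V) :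
    ∑ k, ∑ l, (R p q (b k) (b l) - κ * constCurv p q (b k) (b l)) * α (b k) (b l) w = 0 := by
  have hW' := hR.sub_mul isCurvatureTensor_constCurv κ
  refine eq_zero_of_basis b.toBasis (F := fun w => ∑ k, ∑ l, (R p q (b k) (b l) -
    κ * constCurv p q (b k) (b l)) * α (b k) (b l) w)
    ⟨fun _ _ => by simp [mul_add, Finset.sum_add_distrib],
      fun _ _ => by simp [mul_left_comm, ← Finset.mul_sum]⟩ (fun n => ?_) w
  simp only [OrthonormalBasis.coe_toBasis, hα]
  refine sum_mul_psip₀_eq_zero (S := fun k l => R p q (b k) (b l) -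
    κ * constCurv p q (b k) (b l)) (fun k l => hW'.antisymm' p q (b k) (b l)) (fun i j => ?_) n
  have := hW p q (b i) (b j)
  simpa only [action₂, hω] using this

/-- The eigenvalue estimate at a point of a nearly Kähler manifold. -/
theorem IsCurvatureTensor.eigenvalue_mem_of_om₀ [FiniteDimensional ℝ V] {R : V → V → V → V → ℝ}
    {δ Δ κ r : ℝ} (hR : IsCurvatureTensor R)
    (hsec : ∀ u v, LinearIndependent ℝ ![u, v] →
      R u v v u / (inner ℝ u u * inner ℝ v v - inner ℝ u v ^ 2) ∈ Set.Icc δ Δ)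
    (hω : ∀ i j, σ (b i) (b j) = (om₀ i j : ℝ))
    (hα : ∀ i j k, α (b i) (b j) (b k) = (psip₀ i j k : ℝ))
    (hWω : ∀ p q u v, action₂ b σ (fun a c => R p q a c - κ * constCurv p q a c) u v = 0)
    (hWα : ∀ p q u v w, action₃ b α (fun a c => R p q a c - κ * constCurv p q a c) u v w = 0)
    {β : V →ₗ[ℝ] V →ₗ[ℝ] ℝ} (hβ : ∀ u v, β u v = - β v u) (hβ0 : β ≠ 0)
    (hβα : ∀ w, ∑ k, ∑ l, β (b k) (b l) * α (b k) (b l) w = 0)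
    (hβω : ∑ k, ∑ l, β (b k) (b l) * σ (b k) (b l) = 0)
    (hr : ∀ u v, ∑ k, ∑ l, β (b k) (b l) * R u v (b k) (b l) = r * β u v) :
    r ∈ Set.Icc (-(Δ + δ) - 7 / 3 * (Δ - δ)) (-(Δ + δ) + 7 / 3 * (Δ - δ)) := by
  have hδ := fun u v => (hR.sectional_bounds hsec u v).1
  have hΔ := fun u v => (hR.sectional_bounds hsec u v).2
  have hW' := hR.sub_mul isCurvatureTensor_constCurv κ
  have htr := hR.sum_bilinear_eq_zero hω hα hWα
  have hκ : κ ∈ Set.Icc δ Δ := by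
    refine mem_Icc_of_ricci (k := 4) b hR hδ hΔ (sum_ricci_eq_zero_of_om₀ (w := fun j k l =>
      R (b 0) (b j) (b k) (b l) - κ * constCurv (b 0) (b j) (b k) (b l))
      (fun j k l => hW'.antisymm' ..) (fun j k l => ?_) (fun j k l => ?_) fun j => ?_)
    · have e1 := hW'.cyclic (b j) (b k) (b l) (b 0)
      have e2 := fun j k l => (hW'.pair_symm (b j) (b k) (b l) (b 0)).trans (hW'.antisymm ..)
      simp only [e2] at e1
      linarith
    · simpa only [action₂, hω] using hWω (b 0) (b j) (b k) (b l)
    · simpa only [hω] using htr (b 0) (b j)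
  have hωskew := bilinear_antisymm hω
  have hJ := inner_operatorOf b σ
  have hB := inner_operatorOf b β
  have hcs : IsComplexStructure 0 (operatorOf b σ) := by
    refine ⟨inner_operatorOf_skew b hωskew, fun u => ext_inner_right ℝ fun v => ?_, map_zero _⟩
    rw [inner_operatorOf_skew b hωskew, smul_zero, add_zero, inner_neg_left,
      ← b.sum_inner_mul_inner, ← sum_bilinear_mul hω]
    congr 1
    exact Finset.sum_congr rfl fun m _ => by rw [hJ, real_inner_comm, hJ]
  -- `β` is of type `(1, 1)`, hence commutes with the complex structure
  have hcomm : ∀ u, operatorOf b β (operatorOf b σ u) = operatorOf b σ (operatorOf b β u) := by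
    intro u
    refine ext_inner_right ℝ fun v => ?_
    have h0 : σ (operatorOf b β u) v + σ u (operatorOf b β v) = 0 := by
      refine bilinear_eq_zero_of_basis
        (F := fun u v => σ (operatorOf b β u) v + σ u (operatorOf b β v)) b
        (fun _ => ⟨fun _ _ => by simp; ring, fun _ _ => by simp; ring⟩)
        (fun _ => ⟨fun _ _ => by simp; ring, fun _ _ => by simp; ring⟩) (fun i j => ?_) u v
      rw [← sum_inner_mul b (F := fun m => σ m (b j)) ⟨fun _ _ => by simp, fun _ _ => by simp⟩,
        ← sum_inner_mul b (F := fun m => σ (b i) m) ⟨fun _ _ => by simp, fun _ _ => by simp⟩]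
      simp only [hB, hω]
      exact sum_action_om₀_eq_zero (S := fun i j => β (b i) (b j)) (fun i j => hβ (b i) (b j))
        (fun m => by simpa only [hα] using hβα (b m)) i j
    rw [inner_operatorOf_skew b hβ, hJ, hJ]
    linarith
  refine hR.eigenvalue_mem hδ hΔ hκ hcs ?_ (inner_operatorOf_skew b hβ) hcomm (map_zero _)
    (operatorOf_ne_zero b hβ0) b (fun u v => ?_) ?_ (fun u v => ?_)
  · rw [Submodule.span_zero_singleton, finrank_bot, Module.finrank_eq_card_basis b.toBasis]
    simp
  · simp only [hJ]
    rw [← htr u v]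
    exact Finset.sum_congr rfl fun k _ => Finset.sum_congr rfl fun l _ => mul_comm _ _
  · simp only [hJ, hB]
    exact hβω
  · simp only [hB]
    exact hr u v

end SU3

/-! ### Independence of the orthonormal frame -/

section Traces

variable {V : Type*} [NormedAddCommGroup V] [InnerProductSpace ℝ V] {ι κ : Type*} [Fintype ι]
  [Fintype κ]

lemma sum_mul_eq_sum_mul (f : OrthonormalBasis ι ℝ V) (b : OrthonormalBasis κ ℝ V) {F G : V → ℝ}
    (hF : IsLinearMap ℝ F) (hG : IsLinearMap ℝ G) :
    ∑ k, F (f k) * G (f k) = ∑ m, F (b m) * G (b m) := by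
  have h1 : ∀ k, F (f k) * G (f k) = ∑ m, G (b m) * (inner ℝ (b m) (f k) * F (f k)) := by
    intro k
    rw [← sum_inner_mul b hG (f k), Finset.mul_sum]
    refine Finset.sum_congr rfl fun m _ => ?_
    rw [real_inner_comm]
    ring
  simp only [h1]
  rw [Finset.sum_comm]
  refine Finset.sum_congr rfl fun m _ => ?_
  rw [← Finset.mul_sum, sum_inner_mul f hF, mul_comm]

/-- The contraction of two bilinear forms does not depend on the orthonormal basis. -/
lemma sum_sum_mul_eq (f : OrthonormalBasis ι ℝ V) (b : OrthonormalBasis κ ℝ V) {F G : V → V → ℝ}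
    (hF₁ : ∀ v, IsLinearMap ℝ (fun u => F u v)) (hF₂ : ∀ u, IsLinearMap ℝ (F u))
    (hG₁ : ∀ v, IsLinearMap ℝ (fun u => G u v)) (hG₂ : ∀ u, IsLinearMap ℝ (G u)) :
    ∑ k, ∑ l, F (f k) (f l) * G (f k) (f l) = ∑ k, ∑ l, F (b k) (b l) * G (b k) (b l) := by
  simp only [sum_mul_eq_sum_mul f b (hF₂ _) (hG₂ _)]
  rw [Finset.sum_comm,
    Finset.sum_congr rfl fun l _ => sum_mul_eq_sum_mul f b (hF₁ (b l)) (hG₁ (b l)),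
    Finset.sum_comm]

/-- The curvature operator preserves the orthogonality to `C`, if the difference with a curvature
tensor of constant curvature is orthogonal to `C`. -/
lemma IsCurvatureTensor.sum_curvature_mul_eq_zero {R : V → V → V → V → ℝ} {c : ℝ}
    (hR : IsCurvatureTensor R) (b : OrthonormalBasis ι ℝ V) {β C : V → V → ℝ}
    (hβ : ∀ u v, β u v = - β v u)
    (hC : ∀ p q, ∑ k, ∑ l, (R p q (b k) (b l) - c * constCurv p q (b k) (b l)) * C (b k) (b l) = 0)
    (hβC : ∑ k, ∑ l, β (b k) (b l) * C (b k) (b l) = 0) :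
    ∑ i, ∑ j, (∑ k, ∑ l, β (b k) (b l) * R (b i) (b j) (b k) (b l)) * C (b i) (b j) = 0 := by
  classical
  have hK : ∀ k l, ∑ i, ∑ j, constCurv (b k) (b l) (b i) (b j) * C (b i) (b j) =
      C (b l) (b k) - C (b k) (b l) := by
    intro k l
    have h : ∀ i j, constCurv (b k) (b l) (b i) (b j) * C (b i) (b j) =
        (if l = i then if k = j then C (b i) (b j) else 0 else 0) -
          (if k = i then if l = j then C (b i) (b j) else 0 else 0) := by
      intro i j
      simp only [constCurv, b.inner_eq_ite]
      split_ifs <;> ring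
    simp only [h, Finset.sum_sub_distrib]
    simp
  have h1 : ∀ k l, ∑ i, ∑ j, R (b k) (b l) (b i) (b j) * C (b i) (b j) =
      c * (C (b l) (b k) - C (b k) (b l)) := by
    intro k l
    rw [← hK, ← sub_eq_zero, ← hC (b k) (b l), Finset.mul_sum, ← Finset.sum_sub_distrib]
    refine Finset.sum_congr rfl fun i _ => ?_
    rw [Finset.mul_sum, ← Finset.sum_sub_distrib]
    exact Finset.sum_congr rfl fun j _ => by ring
  have h2 : ∑ i, ∑ j, (∑ k, ∑ l, β (b k) (b l) * R (b i) (b j) (b k) (b l)) * C (b i) (b j) =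
      ∑ k, ∑ l, β (b k) (b l) * ∑ i, ∑ j, R (b k) (b l) (b i) (b j) * C (b i) (b j) := by
    simp only [Finset.sum_mul, Finset.mul_sum]
    rw [Finset.sum_congr rfl fun i _ => Finset.sum_comm, Finset.sum_comm]
    refine Finset.sum_congr rfl fun k _ => ?_
    rw [Finset.sum_congr rfl fun i _ => Finset.sum_congr rfl fun j _ => rfl,
      Finset.sum_congr rfl fun i _ => Finset.sum_comm, Finset.sum_comm]
    refine Finset.sum_congr rfl fun l _ => Finset.sum_congr rfl fun i _ =>
      Finset.sum_congr rfl fun j _ => ?_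
    rw [hR.pair_symm, mul_assoc]
  have h3 : ∑ k, ∑ l, β (b k) (b l) * C (b l) (b k) = 0 := by
    rw [Finset.sum_comm, ← neg_eq_zero, ← hβC, ← Finset.sum_neg_distrib]
    refine Finset.sum_congr rfl fun k _ => ?_
    rw [← Finset.sum_neg_distrib]
    refine Finset.sum_congr rfl fun l _ => ?_
    rw [hβ]; ring
  rw [h2]
  simp only [h1, mul_left_comm _ c, ← Finset.mul_sum, mul_sub, Finset.sum_sub_distrib, hβC, h3]
  simp

end Traces

section Fibres

lemma cur₂_ne_zero {n : ℕ} {M : Type*} [TopologicalSpace M] [ChartedSpace (E n) M] {x : M}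
    {β : TwoForm (n := n) x} (hβ : β ≠ 0) :
    cur₂ β.toAlternatingMap ≠ 0 := by
  intro h
  refine hβ (ContinuousAlternatingMap.ext fun v => ?_)
  rw [← vec_two_eta v]
  exact congrArg (fun L => L (v 0) (v 1)) h

variable {n : ℕ} {M : Type*} [TopologicalSpace M] [ChartedSpace (E n) M]
  [Bundle.RiemannianBundle (fun x : M => TangentSpace (𝓡 n) x)]

lemma isLinearMap_cur₂_left {V : Type*} [AddCommGroup V] [Module ℝ V] (β : V →ₗ[ℝ] V →ₗ[ℝ] ℝ)
    (v : V) : IsLinearMap ℝ (fun u => β u v) := ⟨fun _ _ => by simp, fun _ _ => by simp⟩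

lemma isLinearMap_cur₂_right {V : Type*} [AddCommGroup V] [Module ℝ V] (β : V →ₗ[ℝ] V →ₗ[ℝ] ℝ)
    (u : V) : IsLinearMap ℝ (fun v => β u v) := ⟨fun _ _ => by simp, fun _ _ => by simp⟩

lemma mem_annihilator₂_iff {x : M} (b : OrthonormalBasis (Fin n) ℝ (TangentSpace (𝓡 n) x))
    {α β : TwoForm (n := n) x} : β ∈ annihilator₂ x α ↔
      ∑ i, ∑ j, cur₂ β.toAlternatingMap (b i) (b j) * cur₂ α.toAlternatingMap (b i) (b j) = 0 := by
  rw [← sum_sum_mul_eq (frame x) b (isLinearMap_cur₂_left _) (isLinearMap_cur₂_right _)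
    (isLinearMap_cur₂_left _) (isLinearMap_cur₂_right _)]
  rfl

lemma mem_annihilator₃_iff {x : M} (b : OrthonormalBasis (Fin n) ℝ (TangentSpace (𝓡 n) x))
    {α : TangentSpace (𝓡 n) x [⋀^Fin 3]→L[ℝ] ℝ} {β : TwoForm (n := n) x} :
    β ∈ annihilator₃ x α ↔ ∀ w, ∑ i, ∑ j, cur₂ β.toAlternatingMap (b i) (b j)
      * cur₃ α.toAlternatingMap (b i) (b j) w = 0 := by
  have h1 : β ∈ annihilator₃ x α ↔ ∀ k, ∑ i, ∑ j, cur₂ β.toAlternatingMap (frame x i) (frame x j)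
      * cur₃ α.toAlternatingMap (frame x i) (frame x j) (frame x k) = 0 := Iff.rfl
  have h2 : ∀ w, ∑ i, ∑ j, cur₂ β.toAlternatingMap (frame x i) (frame x j)
      * cur₃ α.toAlternatingMap (frame x i) (frame x j) w =
      ∑ i, ∑ j, cur₂ β.toAlternatingMap (b i) (b j) * cur₃ α.toAlternatingMap (b i) (b j) w :=
    fun w => sum_sum_mul_eq (frame x) b (G := fun u v => cur₃ α.toAlternatingMap u v w)
      (isLinearMap_cur₂_left _) (isLinearMap_cur₂_right _)
      (fun _ => ⟨fun _ _ => by simp, fun _ _ => by simp⟩)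
      (fun _ => ⟨fun _ _ => by simp, fun _ _ => by simp⟩)
  rw [h1]
  simp only [← h2]
  refine ⟨fun h w => ?_, fun h k => h _⟩
  refine eq_zero_of_basis (frame x).toBasis (F := fun w => ∑ i, ∑ j,
    cur₂ β.toAlternatingMap (frame x i) (frame x j)
      * cur₃ α.toAlternatingMap (frame x i) (frame x j) w)
    ⟨fun _ _ => by simp [mul_add, Finset.sum_add_distrib],
      fun _ _ => by simp [mul_left_comm, ← Finset.mul_sum]⟩ (fun k => ?_) w
  simpa using h k

variable [IsManifold (𝓡 n) ∞ M]
  [IsContMDiffRiemannianBundle (𝓡 n) ∞ (E n) (fun x : M => TangentSpace (𝓡 n) x)]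

/-- The curvature operator may be computed in any orthonormal basis. -/
lemma cur₂_hatR {x : M} (b : OrthonormalBasis (Fin n) ℝ (TangentSpace (𝓡 n) x))
    (β : TwoForm (n := n) x) (u v : TangentSpace (𝓡 n) x) :
    cur₂ (hatR x β).toAlternatingMap u v =
      ∑ k, ∑ l, cur₂ β.toAlternatingMap (b k) (b l) * riemann x u v (b k) (b l) := by
  have hR := isCurvatureTensor_riemann (n := n) x
  rw [← sum_sum_mul_eq (frame x) b (G := fun w z => riemann x u v w z)
    (isLinearMap_cur₂_left _) (isLinearMap_cur₂_right _) (fun _ => hR.isLinearMap₃ _ _ _)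
    (fun _ => hR.isLinearMap₄ _ _ _), cur₂_apply]
  change hatR x β ![u, v] = _
  simp only [hatR, LinearMap.coe_mk, AddHom.coe_mk, ContinuousAlternatingMap.sum_apply,
    ContinuousAlternatingMap.smul_apply, smul_eq_mul]
  rfl

end Fibres

/-! ### Invariance and the eigenvalue estimate on a manifold -/

section Theorem

lemma exists_eigenvector {V : Type*} [AddCommGroup V] [Module ℝ V] {T : V →ₗ[ℝ] V}
    {U : Submodule ℝ V} {h : ∀ v ∈ U, T v ∈ U} {r : ℝ}
    (hr : Module.End.HasEigenvalue (T.restrict h) r) : ∃ v ∈ U, v ≠ 0 ∧ T v = r • v := by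
  obtain ⟨v, hv⟩ := hr.exists_hasEigenvector
  exact ⟨v, v.2, fun h0 => hv.2 (Subtype.ext h0), congrArg Subtype.val hv.apply_eq_smul⟩

theorem IsNearlyG2.hatR_mem_and_eigenvalue_mem {M : Type*} [TopologicalSpace M]
    [ChartedSpace (E 7) M]
    [IsManifold (𝓡 7) ∞ M] [Bundle.RiemannianBundle (fun x : M => TangentSpace (𝓡 7) x)]
    [IsContMDiffRiemannianBundle (𝓡 7) ∞ (E 7) (fun x : M => TangentSpace (𝓡 7) x)]
    {φ : ∀ x : M, TangentSpace (𝓡 7) x [⋀^Fin 3]→L[ℝ] ℝ}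
    {ψ : ∀ x : M, TangentSpace (𝓡 7) x [⋀^Fin 4]→L[ℝ] ℝ} {δ Δ : ℝ} (h : IsNearlyG2 φ ψ)
    (hsec : SectionalCurvatureBounds 7 M δ Δ) (x : M) :
    (∀ β ∈ Lambda14 φ x, hatR (n := 7) x β ∈ Lambda14 φ x) ∧
    ∀ (r : ℝ), ∀ β ∈ Lambda14 φ x, β ≠ 0 → hatR (n := 7) x β = r • β →
      r ∈ Set.Icc (-(Δ + δ) - 7 / 3 * (Δ - δ)) (-(Δ + δ) + 7 / 3 * (Δ - δ)) := by
  obtain ⟨κ, hκ⟩ := h.exists_action_eq_zero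
  obtain ⟨b, hφ, -⟩ := h.exists_orthonormalBasis x
  have hR := isCurvatureTensor_riemann (n := 7) x
  have hα : ∀ i j k, cur₃ (φ x).toAlternatingMap (b i) (b j) (b k) = (phi₀ i j k : ℝ) := hφ
  refine ⟨fun β hβ => ?_, fun r β hβ hβ0 hr => ?_⟩
  · rw [Lambda14, mem_annihilator₃_iff b] at hβ ⊢
    intro w
    simp only [cur₂_hatR b]
    exact hR.sum_curvature_mul_eq_zero b (β := fun u v => cur₂ β.toAlternatingMap u v)
      (C := fun u v => cur₃ (φ x).toAlternatingMap u v w) (cur₂_swap β.toAlternatingMap)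
      (fun p q => hR.sum_trilinear_eq_zero hα (hκ x b) p q w) (hβ w)
  · rw [Lambda14, mem_annihilator₃_iff b] at hβ
    refine hR.eigenvalue_mem_of_phi₀ (hsec x) hα (hκ x b) (cur₂_swap β.toAlternatingMap)
      (cur₂_ne_zero hβ0) hβ fun u v => ?_
    rw [← cur₂_hatR b, hr]
    rfl

theorem IsNearlyKahler6.hatR_mem_and_eigenvalue_mem {M : Type*} [TopologicalSpace M]
    [ChartedSpace (E 6) M]
    [IsManifold (𝓡 6) ∞ M] [Bundle.RiemannianBundle (fun x : M => TangentSpace (𝓡 6) x)]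
    [IsContMDiffRiemannianBundle (𝓡 6) ∞ (E 6) (fun x : M => TangentSpace (𝓡 6) x)]
    {om : ∀ x : M, TangentSpace (𝓡 6) x [⋀^Fin 2]→L[ℝ] ℝ}
    {ψp ψm : ∀ x : M, TangentSpace (𝓡 6) x [⋀^Fin 3]→L[ℝ] ℝ} {δ Δ : ℝ}
    (h : IsNearlyKahler6 om ψp ψm) (hsec : SectionalCurvatureBounds 6 M δ Δ) (x : M) :
    (∀ β ∈ Lambda8 om ψp x, hatR (n := 6) x β ∈ Lambda8 om ψp x) ∧
    ∀ (r : ℝ), ∀ β ∈ Lambda8 om ψp x, β ≠ 0 → hatR (n := 6) x β = r • β →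
      r ∈ Set.Icc (-(Δ + δ) - 7 / 3 * (Δ - δ)) (-(Δ + δ) + 7 / 3 * (Δ - δ)) := by
  obtain ⟨b, hom, hψp, -⟩ := h.adapted x
  have hR := isCurvatureTensor_riemann (n := 6) x
  have hω : ∀ i j, cur₂ (om x).toAlternatingMap (b i) (b j) = (om₀ i j : ℝ) := by
    intro i j
    rw [cur₂_apply, ← minor₂_eq_om₀]
    refine (hom _).trans ?_
    simp only [wedge_two_basis]
    push_cast
    rfl
  have hα : ∀ i j k, cur₃ (ψp x).toAlternatingMap (b i) (b j) (b k) = (psip₀ i j k : ℝ) := by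
    intro i j k
    rw [cur₃_apply, ← minor₃_eq_psip₀]
    refine (hψp _).trans ?_
    simp only [wedge_three_basis]
    push_cast
    rfl
  have hWω := h.action_om_eq_zero x b
  have hWα := h.action_ψp_eq_zero x b
  refine ⟨fun β hβ => ?_, fun r β hβ hβ0 hr => ?_⟩
  · rw [Lambda8, Submodule.mem_inf, mem_annihilator₃_iff b, mem_annihilator₂_iff b] at hβ ⊢
    simp only [cur₂_hatR b]
    refine ⟨fun w => ?_, ?_⟩
    · exact hR.sum_curvature_mul_eq_zero b (β := fun u v => cur₂ β.toAlternatingMap u v)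
        (C := fun u v => cur₃ (ψp x).toAlternatingMap u v w) (cur₂_swap β.toAlternatingMap)
        (fun p q => hR.sum_psip_eq_zero hω hα hWω p q w) (hβ.1 w)
    · exact hR.sum_curvature_mul_eq_zero b (β := fun u v => cur₂ β.toAlternatingMap u v)
        (C := fun u v => cur₂ (om x).toAlternatingMap u v) (cur₂_swap β.toAlternatingMap)
        (fun p q => hR.sum_bilinear_eq_zero hω hα hWα p q) hβ.2
  · rw [Lambda8, Submodule.mem_inf, mem_annihilator₃_iff b, mem_annihilator₂_iff b] at hβ
    refine hR.eigenvalue_mem_of_om₀ (hsec x) hω hα hWω hWα (cur₂_swap β.toAlternatingMap)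
      (cur₂_ne_zero hβ0) hβ.1 hβ.2 fun u v => ?_
    rw [← cur₂_hatR b, hr]
    rfl

end Theorem

end NearlyGeom

theorem mainTheorem10 :
    (∀ (M : Type*) [TopologicalSpace M] [T2Space M] [SecondCountableTopology M]
      [ChartedSpace (NearlyGeom.E 7) M] [IsManifold (𝓡 7) ∞ M]
      [Bundle.RiemannianBundle (fun x : M => TangentSpace (𝓡 7) x)]
      [IsContMDiffRiemannianBundle (𝓡 7) ∞ (NearlyGeom.E 7)
        (fun x : M => TangentSpace (𝓡 7) x)]
      (φ : ∀ x : M, TangentSpace (𝓡 7) x [⋀^Fin 3]→L[ℝ] ℝ)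
      (ψ : ∀ x : M, TangentSpace (𝓡 7) x [⋀^Fin 4]→L[ℝ] ℝ)
      (δ Δ : ℝ),
      NearlyGeom.IsNearlyG2 φ ψ → NearlyGeom.SectionalCurvatureBounds 7 M δ Δ →
      ∀ x : M, ∃ h : ∀ β ∈ NearlyGeom.Lambda14 φ x,
          NearlyGeom.hatR (n := 7) x β ∈ NearlyGeom.Lambda14 φ x,
        ∀ r : ℝ, Module.End.HasEigenvalue (R := ℝ) (M := NearlyGeom.Lambda14 φ x)
            ((NearlyGeom.hatR (n := 7) x).restrict h) r →
          r ∈ Set.Icc (-(Δ + δ) - 7 / 3 * (Δ - δ)) (-(Δ + δ) + 7 / 3 * (Δ - δ))) ∧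
    (∀ (M : Type*) [TopologicalSpace M] [T2Space M] [SecondCountableTopology M]
      [ChartedSpace (NearlyGeom.E 6) M] [IsManifold (𝓡 6) ∞ M]
      [Bundle.RiemannianBundle (fun x : M => TangentSpace (𝓡 6) x)]
      [IsContMDiffRiemannianBundle (𝓡 6) ∞ (NearlyGeom.E 6)
        (fun x : M => TangentSpace (𝓡 6) x)]
      (om : ∀ x : M, TangentSpace (𝓡 6) x [⋀^Fin 2]→L[ℝ] ℝ)
      (ψp ψm : ∀ x : M, TangentSpace (𝓡 6) x [⋀^Fin 3]→L[ℝ] ℝ)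
      (δ Δ : ℝ),
      NearlyGeom.IsNearlyKahler6 om ψp ψm → NearlyGeom.SectionalCurvatureBounds 6 M δ Δ →
      ∀ x : M, ∃ h : ∀ β ∈ NearlyGeom.Lambda8 om ψp x,
          NearlyGeom.hatR (n := 6) x β ∈ NearlyGeom.Lambda8 om ψp x,
        ∀ r : ℝ, Module.End.HasEigenvalue (R := ℝ) (M := NearlyGeom.Lambda8 om ψp x)
            ((NearlyGeom.hatR (n := 6) x).restrict h) r →
          r ∈ Set.Icc (-(Δ + δ) - 7 / 3 * (Δ - δ)) (-(Δ + δ) + 7 / 3 * (Δ - δ))) := by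
  refine ⟨?_, ?_⟩
  · intro M _ _ _ _ _ _ _ φ ψ δ Δ h hsec x
    obtain ⟨h1, h2⟩ := h.hatR_mem_and_eigenvalue_mem hsec x
    refine ⟨h1, fun r hr => ?_⟩
    obtain ⟨β, hβ, hβ0, he⟩ := NearlyGeom.exists_eigenvector hr
    exact h2 r β hβ hβ0 he
  · intro M _ _ _ _ _ _ _ om ψp ψm δ Δ h hsec x
    obtain ⟨h1, h2⟩ := h.hatR_mem_and_eigenvalue_mem hsec x
    refine ⟨h1, fun r hr => ?_⟩
    obtain ⟨β, hβ, hβ0, he⟩ := NearlyGeom.exists_eigenvector hr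
    exact h2 r β hβ hβ0 he
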